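/- Let $d\in\{2,3\}$, let $\Omega\subset\mathbb R^d$ be a bounded domain (open, connected, non-empty), $T>0$, let $\eta:\mathbb R\to\mathbb R$ be Lipschitz and $\mathbf f\in C([0,T];\mathbf L^2(\Omega))$. Let $(\rho,\mathbf u,p)$ be a weak solution on $\Omega\times[0,T]$ of $$\partial_t\rho+\nabla\cdot(\rho\mathbf u)=0,\qquad \partial_t(\rho\mathbf u)+\nabla\cdot(\rho\mathbf u\otimes\mathbf u)-2\nabla\cdot(\eta(\rho)\varepsilon(\mathbf u))+\nabla p=\mathbf f,\qquad \nabla\cdot\mathbf u=0,\qquad \mathbf u|_{\partial\Omega}=0,$$ where $\varepsilon(\mathbf u)=\frac12(\nabla\mathbf u+(\nabla\mathbf u)^{T})$, with the regularity $\rho\in W^{1,\infty}(0,T;L^\infty(\Omega))$, $\mathbf u\in L^\infty(0,T;\mathbf W^{1,\infty}(\Omega))\cap W^{2,\infty}(0,T;\mathbf L^\infty(\Omega))$, $p\in W^{1,\infty}(0,T;L^\infty(\Omega))$. Write $\rho^0=\rho(0)$, let $\rho_{\min},\rho_{\max}$ be the (essential) infimum and supremum of $\rho^0$ on $\Omega$,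 and assume $\rho_{\min}>0$ and $\eta>0$ on $[\rho_{\min},\rho_{\max}]$. Let $\lambda>0$, $\bar\nu=1.1\,\|\eta(\rho^0)/\rho^0\|_{L^\infty}$, $\bar\lambda=1.1\,\lambda\,\|1/\rho^0\|_{L^\infty}$, let $\gamma>0$ satisfy $\gamma^2\le\min\left(\frac14,\frac1{64\bar\nu}\right)$, and let $C_\rho>0$. For a time step $\tau>0$ and an integer $N$ with $N\tau=T$ set $t_n=n\tau$, $\delta\phi^{n+1}=\phi^{n+1}-\phi^n$, $\eta^n=\eta(\rho^n)$. Consider sequences $(\rho^n,\mathbf m^n,\mathbf u^n,p^n)_{0\le n\le N}$ with $\rho^n\in H^1(\Omega)$, $\mathbf m^n,\mathbf u^n\in\mathbf H^1_0(\Omega)$, $p^n\in L^2(\Omega)$, with $\mathbf m^n=\rho^n\mathbf u^n$ for $0\le n\le N$, with $(\rho^0,\mathbf u^0,p^0)=(\rho(0),\mathbf u(0),p(0))$, and such that for $0\le n<N$, with $\mathbf m^{*,n}=\rho^{n+1}\mathbf u^n$, $$\tfrac{\delta\rho^{n+1}}\tau+\mathbf u^n\cdot\nabla\rho^n=R_\rho^{n+1},\qquad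 p^{n+1}=p^n-\lambda\nabla\cdot\mathbf u^{n+1},$$ $$\tfrac{\delta\mathbf m^{n+1}}\tau-2\bar\nu\nabla\cdot\varepsilon(\mathbf m^{n+1}-\mathbf m^{*,n})-2\nabla\cdot(\eta^{n+1}\varepsilon(\mathbf u^n))-\bar\lambda\nabla\nabla\cdot(\mathbf m^{n+1}-\mathbf m^{*,n})-\lambda\nabla\nabla\cdot\mathbf u^n+\nabla p^n+\nabla\cdot(\rho^n\mathbf u^{n+1}\otimes\mathbf u^n)-\tfrac12\rho^n\mathbf u^{n+1}\nabla\cdot\mathbf u^n-\tfrac12R_\rho^{n+1}\mathbf u^{n+1}=\mathbf f(t_{n+1})$$ (the last equation tested with $\mathbf H^1_0(\Omega)$). Assume further that $\rho_{\min}\le\rho^n\le\rho_{\max}$ for $0\le n\le N$, that for $0\le n<N$ $$(\tau\bar\nu)^{1/2}\left\|\tfrac{\nabla\rho^{n+1}}{\sqrt{\rho^n\eta^{n+1}}}\right\|_{L^\infty}\le\gamma,\quad \tau^{1/2}\bar\lambda\left\|\tfrac{\nabla\rho^{n+1}}{\sqrt{\rho^n\eta^{n+1}}}\right\|_{L^\infty}\le\gamma,\quad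 \left\|\tfrac{\bar\nu\,\delta\rho^{n+1}}{\eta^{n+1}}\right\|_{L^\infty}\le1,\quad \left\|\tfrac{\bar\lambda\,\delta\rho^{n+1}}{\lambda}\right\|_{L^\infty}\le1,$$ and that, with $e_\rho^n=\rho(t_n)-\rho^n$ and $\mathbf e_u^n=\mathbf u(t_n)-\mathbf u^n$, for $0\le n\le N$ $$\tau\sum_{k=1}^n\|R_\rho^k\|_{L^2}^2\le C_\rho\tau^2+C_\rho\tau\sum_{k=0}^{n-1}\|\mathbf e_u^k\|_{L^2}^2,\qquad \tau\sum_{k=0}^n\|e_\rho^k\|_{L^2}^2\le C_\rho\tau^2+C_\rho\tau\sum_{k=0}^{n-1}\|\mathbf e_u^k\|_{L^2}^2 .$$ Then there are positive constants $C,\tilde C$, independent of $\tau$ (and $N$) and of the approximations, such that whenever $C\tau<\frac12$, $$\max_{0\le n\le N}\|\mathbf e_u^n\|_{\mathbf L^2(\Omega)}^2+\tau\sum_{n=0}^N\|\mathbf e_u^n\|_{\mathbf H^1(\Omega)}^2\le\tilde C\,\tau .$$ -/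

import Mathlib

open Set Filter Topology MeasureTheory
open scoped ENNReal NNReal ContDiff

namespace ACM

/-- The Euclidean space `ℝ^d`. -/
abbrev E (d : ℕ) : Type := EuclideanSpace ℝ (Fin d)

/-! ### Sobolev spaces on an open set -/

/-- `φ ∈ C_c^∞(Ω)`. -/
def IsTest {d : ℕ} (Ω : Set (E d)) (φ : E d → ℝ) : Prop :=
  ContDiff ℝ ∞ φ ∧ HasCompactSupport φ ∧ tsupport φ ⊆ Ω

/-- The classical partial derivative `∂_j φ`. -/
noncomputable def cpartial {d : ℕ} (j : Fin d) (φ : E d → ℝ) (x : E d) : ℝ :=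
  fderiv ℝ φ x (EuclideanSpace.single j 1)

/-- `g` is the weak partial derivative `∂_j f` of `f` in `Ω`. -/
def HasWeakPartial {d : ℕ} (Ω : Set (E d)) (j : Fin d) (f g : E d → ℝ) : Prop :=
  LocallyIntegrableOn f Ω ∧ LocallyIntegrableOn g Ω ∧
    ∀ φ : E d → ℝ, IsTest Ω φ →
      ∫ x in Ω, f x * cpartial j φ x = -∫ x in Ω, g x * φ x

open Classical in
/-- The weak partial derivative `∂_j f` in `Ω` (unique up to null sets; `0` if there is none). -/
noncomputable def wd {d : ℕ} (Ω : Set (E d)) (j : Fin d) (f : E d → ℝ) : E d → ℝ :=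
  if h : ∃ g, HasWeakPartial Ω j f g then h.choose else 0

/-- `f ∈ H¹(Ω)`. -/
def MemH1 {d : ℕ} (Ω : Set (E d)) (f : E d → ℝ) : Prop :=
  MemLp f 2 (volume.restrict Ω) ∧
    ∀ j, (∃ g, HasWeakPartial Ω j f g) ∧ MemLp (wd Ω j f) 2 (volume.restrict Ω)

/-- `f ∈ H¹₀(Ω)`, the closure of `C_c^∞(Ω)` in `H¹(Ω)`. -/
def MemH10 {d : ℕ} (Ω : Set (E d)) (f : E d → ℝ) : Prop :=
  MemH1 Ω f ∧ ∃ φ : ℕ → E d → ℝ, (∀ k, IsTest Ω (φ k)) ∧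
    Tendsto (fun k => eLpNorm (fun x => φ k x - f x) 2 (volume.restrict Ω)) atTop (𝓝 0) ∧
    ∀ j, Tendsto (fun k => eLpNorm (fun x => cpartial j (φ k) x - wd Ω j f x) 2
      (volume.restrict Ω)) atTop (𝓝 0)

/-- `v ∈ H¹₀(Ω)^d`: the vector fields in `H¹` that vanish on the boundary. -/
def MemH10v {d : ℕ} (Ω : Set (E d)) (v : E d → E d) : Prop :=
  ∀ i, MemH10 Ω (fun x => v x i)

/-! ### Differential operators (in the weak sense) -/

/-- The Jacobian `(∇v)_{ij} = ∂_j v_i`. -/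
noncomputable def jac {d : ℕ} (Ω : Set (E d)) (v : E d → E d) (x : E d) :
    Matrix (Fin d) (Fin d) ℝ :=
  Matrix.of fun i j => wd Ω j (fun y => v y i) x

/-- The strain rate `ε(v) = (∇v + (∇v)ᵀ) / 2`. -/
noncomputable def strain {d : ℕ} (Ω : Set (E d)) (v : E d → E d) (x : E d) :
    Matrix (Fin d) (Fin d) ℝ :=
  (1 / 2 : ℝ) • (jac Ω v x + (jac Ω v x).transpose)

/-- The divergence `∇ · v`. -/
noncomputable def dvg {d : ℕ} (Ω : Set (E d)) (v : E d → E d) (x : E d) : ℝ :=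
  (jac Ω v x).trace

/-- The gradient of a scalar function. -/
noncomputable def grad {d : ℕ} (Ω : Set (E d)) (f : E d → ℝ) (x : E d) : E d :=
  WithLp.toLp 2 fun j => wd Ω j f x

/-- The product `A : B = ∑ A_{ij} B_{ij}` of matrices. -/
def ddot {d : ℕ} (A B : Matrix (Fin d) (Fin d) ℝ) : ℝ := ∑ i, ∑ j, A i j * B i j

/-- The tensor product `(a ⊗ b)_{ij} = a_i b_j`. -/
def tens {d : ℕ} (a b : E d) : Matrix (Fin d) (Fin d) ℝ := Matrix.vecMulVec a b

/-! ### Norms -/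

/-- `‖f‖²_{L²(Ω)}`. -/
noncomputable def l2sq {d : ℕ} {F : Type*} [NormedAddCommGroup F] (Ω : Set (E d))
    (f : E d → F) : ℝ :=
  ∫ x in Ω, ‖f x‖ ^ 2

/-- `‖v‖²_{H¹(Ω)} = ‖v‖²_{L²} + ‖∇v‖²_{L²}`. -/
noncomputable def h1sq {d : ℕ} (Ω : Set (E d)) (v : E d → E d) : ℝ :=
  l2sq Ω v + ∑ i, ∑ j, l2sq Ω (wd Ω j fun x => v x i)

/-- `‖f‖_{L^∞(Ω)}` of a bounded function. -/
noncomputable def linf {d : ℕ} (Ω : Set (E d)) (f : E d → ℝ) : ℝ :=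
  (eLpNorm f ∞ (volume.restrict Ω)).toReal

/-- `L^p(Ω)`. -/
abbrev LpΩ {d : ℕ} (F : Type) [NormedAddCommGroup F] (p : ℝ≥0∞) (Ω : Set (E d)) : Type :=
  Lp F p ((volume : Measure (E d)).restrict Ω)

/-- `φ ∈ W^{1,∞}(0,T;X)`, for its continuous representative: `φ` is Lipschitz on `[0,T]`. -/
def MemW1Inf {X : Type*} [NormedAddCommGroup X] (T : ℝ) (φ : ℝ → X) : Prop :=
  ∃ K : ℝ≥0, LipschitzOnWith K φ (Icc 0 T)

/-- `φ ∈ W^{2,∞}(0,T;X)`, for its continuous representative: `φ` is continuously differentiable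
on `[0,T]` (one-sided at the end points) and its derivative lies in `W^{1,∞}(0,T;X)`. -/
def MemW2Inf {X : Type*} [NormedAddCommGroup X] [NormedSpace ℝ X] (T : ℝ) (φ : ℝ → X) : Prop :=
  ∃ φ' : ℝ → X, (∀ t ∈ Icc 0 T, HasDerivWithinAt φ (φ' t) (Icc 0 T) t) ∧ MemW1Inf T φ'

/-! ### The continuous problem -/

/-- `(ρ, u, p)` is a weak solution on `Ω × [0,T]`, with `u = 0` on the boundary, of
`∂_t ρ + ∇·(ρu) = 0`, `∂_t (ρu) + ∇·(ρu ⊗ u) - 2∇·(η(ρ)ε(u)) + ∇p = f`, `∇·u = 0`,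
with `ρ ∈ W^{1,∞}(L^∞)`, `u ∈ L^∞(W^{1,∞}) ∩ W^{2,∞}(L^∞)`, `p ∈ W^{1,∞}(L^∞)`. The weak
formulations are integrated from `0` to `t`. -/
structure IsExact {d : ℕ} (Ω : Set (E d)) (T : ℝ) (η : ℝ → ℝ) (f : ℝ → LpΩ (E d) 2 Ω)
    (ρ : ℝ → LpΩ ℝ ∞ Ω) (u : ℝ → LpΩ (E d) ∞ Ω) (p : ℝ → LpΩ ℝ ∞ Ω) : Prop where
  rho_reg : MemW1Inf T ρ
  u_reg_time : MemW2Inf T u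
  p_reg : MemW1Inf T p
  u_dirichlet : ∀ t ∈ Icc 0 T, MemH10v Ω (u t)
  u_reg_space : ∃ K : ℝ, ∀ t ∈ Icc 0 T, ∀ i j,
    ∀ᵐ x ∂(volume.restrict Ω), |jac Ω (u t) x i j| ≤ K
  incompressible : ∀ t ∈ Icc 0 T, ∀ᵐ x ∂(volume.restrict Ω), dvg Ω (u t) x = 0
  mass : ∀ φ : E d → ℝ, MemH10 Ω φ → ∀ t ∈ Icc 0 T,
    (∫ x in Ω, ρ t x * φ x) - ∫ x in Ω, ρ 0 x * φ x
      = ∫ s in (0 : ℝ)..t, ∫ x in Ω, ρ s x * inner ℝ (u s x) (grad Ω φ x)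
  momentum : ∀ v : E d → E d, MemH10v Ω v → ∀ t ∈ Icc 0 T,
    (∫ x in Ω, inner ℝ (ρ t x • u t x) (v x)) - ∫ x in Ω, inner ℝ (ρ 0 x • u 0 x) (v x)
      = ∫ s in (0 : ℝ)..t, ∫ x in Ω,
          (ddot (tens (ρ s x • u s x) (u s x)) (jac Ω v x)
            - 2 * (η (ρ s x) * ddot (strain Ω (u s) x) (strain Ω v x))
            + p s x * dvg Ω v x + inner ℝ (f s x) (v x))

/-! ### The parameters of the scheme -/

/-- `ρ_min`, for the initial density `ρ0`. -/
noncomputable def rhoMin {d : ℕ} (Ω : Set (E d)) (ρ0 : E d → ℝ) : ℝ :=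
  essInf ρ0 (volume.restrict Ω)

/-- `ρ_max`, for the initial density `ρ0`. -/
noncomputable def rhoMax {d : ℕ} (Ω : Set (E d)) (ρ0 : E d → ℝ) : ℝ :=
  essSup ρ0 (volume.restrict Ω)

/-- `ν̄ = 1.1 ‖η(ρ⁰)/ρ⁰‖_{L^∞}`. -/
noncomputable def nuBar {d : ℕ} (Ω : Set (E d)) (η : ℝ → ℝ) (ρ0 : E d → ℝ) : ℝ :=
  11 / 10 * linf Ω fun x => η (ρ0 x) / ρ0 x

/-- `λ̄ = 1.1 λ ‖1/ρ⁰‖_{L^∞}`. -/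
noncomputable def lamBar {d : ℕ} (Ω : Set (E d)) (lam : ℝ) (ρ0 : E d → ℝ) : ℝ :=
  11 / 10 * lam * linf Ω fun x => 1 / ρ0 x

/-! ### The time marching algorithm -/

/-- The sequences `(ρⁿ, mⁿ, uⁿ, pⁿ)`, `0 ≤ n ≤ N`, with the density residuals `Rⁿ`, are generated
by the scheme with time step `τ` and initial data `(ρ0, u0, p0)`; the momentum equation is
understood in the weak sense, with homogeneous Dirichlet conditions. -/
structure IsScheme {d : ℕ} (Ω : Set (E d)) (η : ℝ → ℝ) (f : ℝ → LpΩ (E d) 2 Ω)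
    (ρ0 : E d → ℝ) (u0 : E d → E d) (p0 : E d → ℝ) (lam τ : ℝ) (N : ℕ)
    (ρ : ℕ → E d → ℝ) (m u : ℕ → E d → E d) (p : ℕ → E d → ℝ) (R : ℕ → E d → ℝ) : Prop where
  rho_init : ρ 0 =ᵐ[volume.restrict Ω] ρ0
  u_init : u 0 =ᵐ[volume.restrict Ω] u0
  p_init : p 0 =ᵐ[volume.restrict Ω] p0
  rho_mem : ∀ n ≤ N, MemH1 Ω (ρ n)
  m_mem : ∀ n ≤ N, MemH10v Ω (m n)
  u_mem : ∀ n ≤ N, MemH10v Ω (u n)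
  p_mem : ∀ n ≤ N, MemLp (p n) 2 (volume.restrict Ω)
  /-- `δρ^{n+1}/τ + uⁿ·∇ρⁿ = R^{n+1}` -/
  density : ∀ n < N, ∀ᵐ x ∂(volume.restrict Ω),
    (ρ (n + 1) x - ρ n x) / τ + inner ℝ (u n x) (grad Ω (ρ n) x) = R (n + 1) x
  /-- The momentum equation; here `m^{*,n} = ρ^{n+1} uⁿ` and `η^{n+1} = η(ρ^{n+1})`. -/
  momentum : ∀ n < N, ∀ v : E d → E d, MemH10v Ω v →
    (∫ x in Ω, inner ℝ (τ⁻¹ • (m (n + 1) x - m n x)) (v x))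
    + (∫ x in Ω, 2 * nuBar Ω η ρ0 *
        ddot (strain Ω (fun y => m (n + 1) y - ρ (n + 1) y • u n y) x) (strain Ω v x))
    + (∫ x in Ω, 2 * (η (ρ (n + 1) x) * ddot (strain Ω (u n) x) (strain Ω v x)))
    + (∫ x in Ω, lamBar Ω lam ρ0 *
        (dvg Ω (fun y => m (n + 1) y - ρ (n + 1) y • u n y) x * dvg Ω v x))
    + (∫ x in Ω, lam * (dvg Ω (u n) x * dvg Ω v x))
    - (∫ x in Ω, p n x * dvg Ω v x)
    - (∫ x in Ω, ddot (tens (ρ n x • u (n + 1) x) (u n x)) (jac Ω v x))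
    - (∫ x in Ω, 1 / 2 * (ρ n x * dvg Ω (u n) x * inner ℝ (u (n + 1) x) (v x)))
    - (∫ x in Ω, 1 / 2 * (R (n + 1) x * inner ℝ (u (n + 1) x) (v x)))
    = ∫ x in Ω, inner ℝ (f (((n + 1 : ℕ) : ℝ) * τ) x) (v x)
  /-- `uⁿ = mⁿ/ρⁿ` -/
  velocity : ∀ n ≤ N, ∀ᵐ x ∂(volume.restrict Ω), u n x = (ρ n x)⁻¹ • m n x
  /-- `p^{n+1} = pⁿ - λ ∇·u^{n+1}` -/
  pressure : ∀ n < N, ∀ᵐ x ∂(volume.restrict Ω),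
    p (n + 1) x = p n x - lam * dvg Ω (u (n + 1)) x

/-- The conditions on the approximate densities: the maximum principle, the bounds on `∇ρ^{n+1}`
and on the increments `δρ^{n+1}` (all `L^∞` bounds are written almost everywhere). -/
structure DensityConditions {d : ℕ} (Ω : Set (E d)) (η : ℝ → ℝ) (ρ0 : E d → ℝ)
    (lam γ τ : ℝ) (N : ℕ) (ρ : ℕ → E d → ℝ) : Prop where
  max_principle : ∀ n ≤ N, ∀ᵐ x ∂(volume.restrict Ω), rhoMin Ω ρ0 ≤ ρ n x ∧ ρ n x ≤ rhoMax Ω ρ0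
  grad_nu : ∀ n < N, ∀ᵐ x ∂(volume.restrict Ω),
    √(τ * nuBar Ω η ρ0) *
      (‖grad Ω (ρ (n + 1)) x‖ / √(ρ n x * η (ρ (n + 1) x))) ≤ γ
  grad_lam : ∀ n < N, ∀ᵐ x ∂(volume.restrict Ω),
    √τ * lamBar Ω lam ρ0 *
      (‖grad Ω (ρ (n + 1)) x‖ / √(ρ n x * η (ρ (n + 1) x))) ≤ γ
  incr_nu : ∀ n < N, ∀ᵐ x ∂(volume.restrict Ω),
    |nuBar Ω η ρ0 * (ρ (n + 1) x - ρ n x) / η (ρ (n + 1) x)| ≤ 1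
  incr_lam : ∀ n < N, ∀ᵐ x ∂(volume.restrict Ω),
    |lamBar Ω lam ρ0 * (ρ (n + 1) x - ρ n x) / lam| ≤ 1

end ACM

open ACM

namespace ACM

section

/-! ### Convergence in `L^p` and products -/

/-! Write e = u(tₙ) − uⁿ, w = u(tₙ₊₁) − uⁿ⁺¹, q = ρⁿ, r = ρⁿ⁺¹, h = η(ρⁿ⁺¹), and ν, μ for ν̄, λ̄.
The scheme is subtracted from the exact momentum equation at tₙ₊₁ and both are tested with w. The
proof is an energy estimate for ½ q|e|² + τ(ν q|ε(e)|² + ½ μ q (div e)² + (p(tₙ) − pⁿ)²/(2λ)),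
closed by a discrete Gronwall argument.

Stability. The implicit correction acts on r(uⁿ⁺¹ − uⁿ), the physical viscosity is explicit.
Polarisation of their sum gives (νr + h)|ε(w)|² − (νr − h)|ε(e)|² + (νr − h)|ε(w − e)|². Since νr ≥
h the last term may be dropped, and since ν(r − q) ≤ h the second is at most νq|ε(e)|²; the energy
telescopes and h|ε(w)|² is left as dissipation. The grad-div terms and the pressure update behave in
the same way. The terms in which ∇r multiplies w − e are absorbed by ½ q|w − e|² and three quarters
of the dissipation; this is where the bound on γ enters. The identity is `stepResidual_eq` and its
consequence `StepBounds.le_stepResidual`.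

Convection. By `integral_convection_skew` and the density equation, the convective terms are
rewritten so that only the bounded gradient of the exact velocity is differentiated. This uses the
embedding of H¹₀ in L⁴ for d ≤ 3.

Exact solution. The weak formulation is integrated in time, so it is first differentiated to give a
non-conservative equation at each time, `ExactBounds.momentum_at`. No time regularity of ∇u is
assumed. Testing the equations at two times with the velocity increment still bounds the squared L²
norm of the strain increment by the time step and the squared density error,
`ExactBounds.integral_strain_sub_le`. This and the terms with ∇r, which is only of size τ^(-1/2),
give squared errors of order τ.

The inequality νr ≥ h is needed at every density in [ρ_min, ρ_max], whereas ν only sees the values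
of ρ⁰. As ρ⁰ is in H¹ on a connected set its essential range is the whole interval,
`frequently_abs_sub_lt`.

The residuals and the density errors are controlled by past velocity errors, so `energy_gronwall`
applies; `korn_inequality` turns the accumulated strain into the H¹ norm. -/

instance holderTriple_four : ENNReal.HolderTriple 4 4 2 where
  inv_add_inv_eq_inv := by
    have h : (4 : ℝ≥0∞)⁻¹ = 2⁻¹ * 2⁻¹ := by
      rw [← ENNReal.mul_inv (by simp) (by simp)]; norm_num
    rw [h, ← mul_add, ENNReal.inv_two_add_inv_two, mul_one]

/-- Convergence of a sequence of real functions in `L^p`. -/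
def TendstoLp {α : Type*} [MeasurableSpace α] (p : ℝ≥0∞) (μ : Measure α) (F : ℕ → α → ℝ)
    (f : α → ℝ) : Prop :=
  Tendsto (fun k => eLpNorm (fun x => F k x - f x) p μ) atTop (𝓝 0)

section Lp

variable {α : Type*} [MeasurableSpace α] {μ : Measure α}

theorem TendstoLp.const (p : ℝ≥0∞) (f : α → ℝ) : TendstoLp p μ (fun _ => f) f := by
  simp [TendstoLp]

/-- Hölder's inequality is applied to FG − fg = (F − f)(G − g) + (F − f)g + f(G − g), so only the
limits need to be in the spaces. -/
theorem TendstoLp.mul {p q r : ℝ≥0∞} [ENNReal.HolderTriple p q r] (hr : 1 ≤ r)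
    {F G : ℕ → α → ℝ} {f g : α → ℝ}
    (hF : ∀ k, AEStronglyMeasurable (F k) μ) (hG : ∀ k, AEStronglyMeasurable (G k) μ)
    (hf : MemLp f p μ) (hg : MemLp g q μ) (hFf : TendstoLp p μ F f) (hGg : TendstoLp q μ G g) :
    TendstoLp r μ (fun k x => F k x * G k x) (fun x => f x * g x) := by
  have hol : ∀ (a b : α → ℝ), AEStronglyMeasurable a μ → AEStronglyMeasurable b μ →
      eLpNorm (fun x => a x * b x) r μ ≤ eLpNorm a p μ * eLpNorm b q μ := by
    intro a b ha hb
    simpa using eLpNorm_le_eLpNorm_mul_eLpNorm'_of_norm (p := p) (q := q) (r := r) ha hb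
      (fun x y => x * y) 1 (Eventually.of_forall fun x => by simp)
  have hb : ∀ k, eLpNorm (fun x => F k x * G k x - f x * g x) r μ
      ≤ eLpNorm (fun x => F k x - f x) p μ * eLpNorm (fun x => G k x - g x) q μ
        + eLpNorm (fun x => F k x - f x) p μ * eLpNorm g q μ
        + eLpNorm f p μ * eLpNorm (fun x => G k x - g x) q μ := by
    intro k
    have hFk := (hF k).sub hf.1
    have hGk := (hG k).sub hg.1
    have e : (fun x => F k x * G k x - f x * g x) =
        ((fun x => (F k x - f x) * (G k x - g x)) + fun x => (F k x - f x) * g x)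
          + fun x => f x * (G k x - g x) := by
      ext x; simp only [Pi.add_apply]; ring
    rw [e]
    refine (eLpNorm_add_le ((hFk.mul hGk).add (hFk.mul hg.1)) (hf.1.mul hGk) hr).trans ?_
    gcongr
    · refine (eLpNorm_add_le (hFk.mul hGk) (hFk.mul hg.1) hr).trans ?_
      gcongr
      · exact hol _ _ hFk hGk
      · exact hol _ _ hFk hg.1
    · exact hol _ _ hf.1 hGk
  refine tendsto_of_tendsto_of_tendsto_of_le_of_le tendsto_const_nhds ?_ (fun _ => zero_le) hb
  have h1 := ENNReal.Tendsto.mul hFf (Or.inr ENNReal.zero_ne_top) hGg (Or.inr ENNReal.zero_ne_top)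
  have h2 := ENNReal.Tendsto.mul_const (b := eLpNorm g q μ) hFf (Or.inr hg.2.ne)
  have h3 := ENNReal.Tendsto.const_mul (a := eLpNorm f p μ) hGg (Or.inr hf.2.ne)
  simpa using (h1.add h2).add h3

theorem TendstoLp.integral {F : ℕ → α → ℝ} {f : α → ℝ} (hf : Integrable f μ)
    (hF : ∀ k, Integrable (F k) μ) (h : TendstoLp 1 μ F f) :
    Tendsto (fun k => ∫ x, F k x ∂μ) atTop (𝓝 (∫ x, f x ∂μ)) :=
  tendsto_integral_of_L1' f hf.1 (Eventually.of_forall hF) h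

theorem memLp_mul {p q r : ℝ≥0∞} [ENNReal.HolderTriple p q r] {f g : α → ℝ} (hf : MemLp f p μ)
    (hg : MemLp g q μ) : MemLp (fun x => f x * g x) r μ :=
  MemLp.mul' hg hf

theorem integrable_mul_of_memLp {f g : α → ℝ} (hf : MemLp f 2 μ) (hg : MemLp g 2 μ) :
    Integrable (fun x => f x * g x) μ :=
  memLp_one_iff_integrable.1 (memLp_mul hf hg)

/-- Convergence of integrals of products of `L²`-convergent sequences. -/
theorem TendstoLp.integral_mul {F G : ℕ → α → ℝ} {f g : α → ℝ}
    (hF : ∀ k, MemLp (F k) 2 μ) (hG : ∀ k, MemLp (G k) 2 μ)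
    (hf : MemLp f 2 μ) (hg : MemLp g 2 μ) (hFf : TendstoLp 2 μ F f) (hGg : TendstoLp 2 μ G g) :
    Tendsto (fun k => ∫ x, F k x * G k x ∂μ) atTop (𝓝 (∫ x, f x * g x ∂μ)) :=
  TendstoLp.integral (integrable_mul_of_memLp hf hg)
    (fun k => integrable_mul_of_memLp (hF k) (hG k))
    (TendstoLp.mul le_rfl (fun k => (hF k).1) (fun k => (hG k).1) hf hg hFf hGg)

end Lp

/-! ### Test functions and weak derivatives -/

variable {d : ℕ} {Ω : Set (E d)}

theorem IsTest.sub {φ ψ : E d → ℝ} (hφ : IsTest Ω φ) (hψ : IsTest Ω ψ) :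
    IsTest Ω (fun x => φ x - ψ x) := by
  refine ⟨hφ.1.sub hψ.1, hφ.2.1.sub hψ.2.1, ?_⟩
  exact (tsupport_sub φ ψ).trans (union_subset hφ.2.2 hψ.2.2)

theorem IsTest.mul_left {φ ψ : E d → ℝ} (hφ : ContDiff ℝ ∞ φ) (hψ : IsTest Ω ψ) :
    IsTest Ω (fun x => φ x * ψ x) :=
  ⟨hφ.mul hψ.1, hψ.2.1.mul_left, (tsupport_mul_subset_right (f := φ)).trans hψ.2.2⟩

theorem contDiff_cpartial {φ : E d → ℝ} (hφ : ContDiff ℝ ∞ φ) (j : Fin d) :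
    ContDiff ℝ ∞ (cpartial j φ) :=
  (hφ.fderiv_right (m := ∞) (by simp)).clm_apply contDiff_const

theorem hasCompactSupport_cpartial {φ : E d → ℝ} (hφ : HasCompactSupport φ) (j : Fin d) :
    HasCompactSupport (cpartial j φ) := hφ.fderiv_apply ℝ _

theorem tsupport_cpartial_subset (φ : E d → ℝ) (j : Fin d) :
    tsupport (cpartial j φ) ⊆ tsupport φ := tsupport_fderiv_apply_subset ℝ _

theorem IsTest.cpartial {φ : E d → ℝ} (hφ : IsTest Ω φ) (j : Fin d) : IsTest Ω (cpartial j φ) :=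
  ⟨contDiff_cpartial hφ.1 j, hasCompactSupport_cpartial hφ.2.1 j,
    (tsupport_cpartial_subset φ j).trans hφ.2.2⟩

theorem memLp_of_smooth {φ : E d → ℝ} (hφ : ContDiff ℝ ∞ φ) (h : HasCompactSupport φ)
    (p : ℝ≥0∞) : MemLp φ p (volume.restrict Ω) :=
  (hφ.continuous.memLp_of_hasCompactSupport h).restrict _

theorem IsTest.memLp {φ : E d → ℝ} (hφ : IsTest Ω φ) (p : ℝ≥0∞) :
    MemLp φ p (volume.restrict Ω) := memLp_of_smooth hφ.1 hφ.2.1 p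

theorem cpartial_mul {φ ψ : E d → ℝ} (hφ : ContDiff ℝ ∞ φ) (hψ : ContDiff ℝ ∞ ψ) (j : Fin d)
    (x : E d) : cpartial j (fun x => φ x * ψ x) x
      = cpartial j φ x * ψ x + φ x * cpartial j ψ x := by
  have h1 := (hφ.differentiable (by simp)) x
  have h2 := (hψ.differentiable (by simp)) x
  simp only [cpartial]
  rw [fderiv_fun_mul h1 h2]
  simp; ring

theorem cpartial_sub {φ ψ : E d → ℝ} (hφ : ContDiff ℝ ∞ φ) (hψ : ContDiff ℝ ∞ ψ) (j : Fin d)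
    (x : E d) : cpartial j (fun x => φ x - ψ x) x = cpartial j φ x - cpartial j ψ x := by
  have h1 := (hφ.differentiable (by simp)) x
  have h2 := (hψ.differentiable (by simp)) x
  simp only [cpartial]
  rw [fderiv_fun_sub h1 h2]
  simp

theorem integral_cpartial {φ : E d → ℝ} (hφ : ContDiff ℝ ∞ φ) (hc : HasCompactSupport φ)
    (j : Fin d) : ∫ x, cpartial j φ x = 0 := by
  have := integral_mul_fderiv_eq_neg_fderiv_mul_of_integrable (𝕜 := ℝ) (μ := (volume : Measure (E d)))
    (f := fun _ => (1 : ℝ)) (g := φ) (v := EuclideanSpace.single j 1)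
    (by simp) (by
      simp only [one_mul]
      exact ((contDiff_cpartial hφ j).continuous.integrable_of_hasCompactSupport
        (hasCompactSupport_cpartial hc j)))
    (by simpa using hφ.continuous.integrable_of_hasCompactSupport hc)
    (by simp) (fun x _ => hφ.differentiable (by simp) x)
  simpa [cpartial] using this

theorem setIntegral_eq_of_tsupport {φ : E d → ℝ} (h : tsupport φ ⊆ Ω) :
    ∫ x in Ω, φ x = ∫ x, φ x :=
  setIntegral_eq_integral_of_forall_compl_eq_zero fun x hx => by
    by_contra h0
    exact hx (h (subset_tsupport _ h0))

theorem locallyIntegrableOn_of_memLp [IsFiniteMeasure (volume.restrict Ω)] {f : E d → ℝ}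
    {p : ℝ≥0∞} (hp : 1 ≤ p) (hf : MemLp f p (volume.restrict Ω)) : LocallyIntegrableOn f Ω :=
  (show IntegrableOn f Ω volume from hf.integrable hp).locallyIntegrableOn

/-- A locally integrable function times a test function is integrable. -/
theorem IsTest.integrable_mul (hΩ : IsOpen Ω) {f φ : E d → ℝ} (hf : LocallyIntegrableOn f Ω)
    (hφ : IsTest Ω φ) : Integrable (fun x => f x * φ x) (volume.restrict Ω) := by
  have h1 : IntegrableOn (fun x => f x * φ x) (tsupport φ) :=
    (hf.integrableOn_compact_subset hφ.2.2 hφ.2.1).mul_continuousOn hφ.1.continuous.continuousOn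
      hφ.2.1
  have h2 : IntegrableOn (fun x => f x * φ x) Ω := by
    refine h1.of_forall_sdiff_eq_zero hΩ.measurableSet fun x hx => ?_
    rw [image_eq_zero_of_notMem_tsupport hx.2, mul_zero]
  exact h2

/-- The fundamental lemma of the calculus of variations. As `wd` is an arbitrary choice, every
computation with it passes through this uniqueness. -/
theorem HasWeakPartial.ae_eq (hΩ : IsOpen Ω) {j : Fin d} {f g g' : E d → ℝ}
    (h : HasWeakPartial Ω j f g) (h' : HasWeakPartial Ω j f g') : g =ᵐ[volume.restrict Ω] g' := by
  have := hΩ.ae_eq_zero_of_integral_contDiff_smul_eq_zero (h.2.1.sub h'.2.1) (by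
    intro φ h1 h2 h3
    have hφ : IsTest Ω φ := ⟨h1, h2, h3⟩
    have e := (h.2.2 φ hφ).symm.trans (h'.2.2 φ hφ)
    rw [← setIntegral_eq_of_tsupport (Ω := Ω)
      ((tsupport_smul_subset_left φ _).trans h3)]
    have : ∀ x, φ x • (g - g') x = g x * φ x - g' x * φ x := by
      intro x; simp; ring
    simp_rw [this]
    rw [integral_sub (hφ.integrable_mul hΩ h.2.1) (hφ.integrable_mul hΩ h'.2.1)]
    linarith)
  rw [EventuallyEq, ae_restrict_iff' hΩ.measurableSet]
  filter_upwards [this] with x hx hxΩ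
  simpa [sub_eq_zero] using hx hxΩ

theorem hasWeakPartial_wd {j : Fin d} {f : E d → ℝ} (h : ∃ g, HasWeakPartial Ω j f g) :
    HasWeakPartial Ω j f (wd Ω j f) := by
  rw [wd, dif_pos h]; exact h.choose_spec

theorem HasWeakPartial.wd_ae_eq (hΩ : IsOpen Ω) {j : Fin d} {f g : E d → ℝ}
    (h : HasWeakPartial Ω j f g) : wd Ω j f =ᵐ[volume.restrict Ω] g :=
  (hasWeakPartial_wd ⟨g, h⟩).ae_eq hΩ h

theorem locallyIntegrableOn_congr (hΩ : IsOpen Ω) {f f' : E d → ℝ}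
    (hf : f =ᵐ[volume.restrict Ω] f') (h : LocallyIntegrableOn f Ω) : LocallyIntegrableOn f' Ω := by
  intro x hx
  obtain ⟨U, hU, hi⟩ := h x hx
  rw [hΩ.nhdsWithin_eq hx] at hU
  refine ⟨U ∩ Ω, ?_, ?_⟩
  · exact inter_mem (mem_nhdsWithin_of_mem_nhds hU) self_mem_nhdsWithin
  · exact (hi.mono_set inter_subset_left).congr_fun_ae
      (ae_restrict_of_ae_restrict_of_subset inter_subset_right hf)

theorem HasWeakPartial.congr (hΩ : IsOpen Ω) {j : Fin d} {f f' g g' : E d → ℝ}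
    (h : HasWeakPartial Ω j f g) (hf : f =ᵐ[volume.restrict Ω] f')
    (hg : g =ᵐ[volume.restrict Ω] g') : HasWeakPartial Ω j f' g' := by
  refine ⟨locallyIntegrableOn_congr hΩ hf h.1, locallyIntegrableOn_congr hΩ hg h.2.1,
    fun φ hφ => ?_⟩
  have h1 : ∫ x in Ω, f' x * ACM.cpartial j φ x = ∫ x in Ω, f x * ACM.cpartial j φ x :=
    integral_congr_ae (by filter_upwards [hf] with x hx; rw [hx])
  have h2 : ∫ x in Ω, g' x * φ x = ∫ x in Ω, g x * φ x :=
    integral_congr_ae (by filter_upwards [hg] with x hx; rw [hx])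
  rw [h1, h2]; exact h.2.2 φ hφ

theorem HasWeakPartial.sub (hΩ : IsOpen Ω) {j : Fin d} {f f' g g' : E d → ℝ}
    (h : HasWeakPartial Ω j f g) (h' : HasWeakPartial Ω j f' g') :
    HasWeakPartial Ω j (fun x => f x - f' x) (fun x => g x - g' x) := by
  refine ⟨h.1.sub h'.1, h.2.1.sub h'.2.1, fun φ hφ => ?_⟩
  simp_rw [sub_mul]
  rw [integral_sub ((hφ.cpartial j).integrable_mul hΩ h.1)
      ((hφ.cpartial j).integrable_mul hΩ h'.1),
    integral_sub (hφ.integrable_mul hΩ h.2.1) (hφ.integrable_mul hΩ h'.2.1),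
    h.2.2 φ hφ, h'.2.2 φ hφ]
  ring

theorem IsTest.hasWeakPartial [IsFiniteMeasure (volume.restrict Ω)]
    {φ : E d → ℝ} (hφ : IsTest Ω φ) (j : Fin d) :
    HasWeakPartial Ω j φ (ACM.cpartial j φ) := by
  refine ⟨locallyIntegrableOn_of_memLp le_rfl (hφ.memLp 1),
    locallyIntegrableOn_of_memLp le_rfl ((hφ.cpartial j).memLp 1), fun ψ hψ => ?_⟩
  have h0 : ∫ x in Ω, ACM.cpartial j (fun x => φ x * ψ x) x = 0 := by
    have ht := IsTest.mul_left hφ.1 hψ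
    rw [setIntegral_eq_of_tsupport (ht.cpartial j).2.2, integral_cpartial ht.1 ht.2.1]
  simp_rw [cpartial_mul hφ.1 hψ.1] at h0
  rw [integral_add] at h0
  · linarith
  · exact integrable_mul_of_memLp ((hφ.cpartial j).memLp 2) (hψ.memLp 2)
  · exact integrable_mul_of_memLp (hφ.memLp 2) ((hψ.cpartial j).memLp 2)

/-! ### The spaces `H¹` and `H¹₀` -/

theorem MemH1.of_hasWeakPartial (hΩ : IsOpen Ω) {f : E d → ℝ} {g : Fin d → E d → ℝ}
    (hf : MemLp f 2 (volume.restrict Ω)) (hg : ∀ j, HasWeakPartial Ω j f (g j))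
    (hg2 : ∀ j, MemLp (g j) 2 (volume.restrict Ω)) : MemH1 Ω f :=
  ⟨hf, fun j => ⟨⟨_, hg j⟩, (memLp_congr_ae ((hg j).wd_ae_eq hΩ)).2 (hg2 j)⟩⟩

theorem MemH1.hasWeakPartial {f : E d → ℝ} (h : MemH1 Ω f) (j : Fin d) :
    HasWeakPartial Ω j f (wd Ω j f) := hasWeakPartial_wd (h.2 j).1

theorem MemH1.congr (hΩ : IsOpen Ω) {f f' : E d → ℝ} (h : MemH1 Ω f)
    (hf : f =ᵐ[volume.restrict Ω] f') : MemH1 Ω f' :=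
  .of_hasWeakPartial hΩ ((memLp_congr_ae hf).1 h.1)
    (fun j => (h.hasWeakPartial j).congr hΩ hf (ae_eq_refl _)) fun j => (h.2 j).2

theorem wd_congr (hΩ : IsOpen Ω) {f f' : E d → ℝ} (h : MemH1 Ω f)
    (hf : f =ᵐ[volume.restrict Ω] f') (j : Fin d) :
    wd Ω j f' =ᵐ[volume.restrict Ω] wd Ω j f :=
  ((h.hasWeakPartial j).congr hΩ hf (ae_eq_refl _)).wd_ae_eq hΩ

theorem wd_sub (hΩ : IsOpen Ω) {f g : E d → ℝ} (hf : MemH1 Ω f) (hg : MemH1 Ω g) (j : Fin d) :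
    wd Ω j (fun x => f x - g x) =ᵐ[volume.restrict Ω] fun x => wd Ω j f x - wd Ω j g x :=
  ((hf.hasWeakPartial j).sub hΩ (hg.hasWeakPartial j)).wd_ae_eq hΩ

theorem MemH1.sub (hΩ : IsOpen Ω) {f g : E d → ℝ} (hf : MemH1 Ω f) (hg : MemH1 Ω g) :
    MemH1 Ω (fun x => f x - g x) :=
  .of_hasWeakPartial hΩ (hf.1.sub hg.1)
    (fun j => (hf.hasWeakPartial j).sub hΩ (hg.hasWeakPartial j))
    fun j => (hf.2 j).2.sub (hg.2 j).2

theorem TendstoLp.congr {F G : ℕ → E d → ℝ} {f g : E d → ℝ} {p : ℝ≥0∞} {μ : Measure (E d)}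
    (h : TendstoLp p μ F f) (hF : ∀ k, F k =ᵐ[μ] G k) (hf : f =ᵐ[μ] g) : TendstoLp p μ G g := by
  refine Tendsto.congr (fun k => eLpNorm_congr_ae ?_) h
  filter_upwards [hF k, hf] with x h1 h2
  rw [h1, h2]

theorem TendstoLp.sub {F G : ℕ → E d → ℝ} {f g : E d → ℝ} {p : ℝ≥0∞} (hp : 1 ≤ p)
    {μ : Measure (E d)}
    (hF : ∀ k, AEStronglyMeasurable (F k) μ) (hG : ∀ k, AEStronglyMeasurable (G k) μ)
    (hf' : AEStronglyMeasurable f μ) (hg' : AEStronglyMeasurable g μ)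
    (hf : TendstoLp p μ F f) (hg : TendstoLp p μ G g) :
    TendstoLp p μ (fun k x => F k x - G k x) fun x => f x - g x := by
  have h3 : Tendsto (fun k => eLpNorm (fun x => F k x - f x) p μ
        + eLpNorm (fun x => G k x - g x) p μ) atTop (𝓝 0) := by simpa using Tendsto.add hf hg
  refine tendsto_of_tendsto_of_tendsto_of_le_of_le tendsto_const_nhds h3
    (fun _ => zero_le) fun k => ?_
  have e : (fun x => F k x - G k x - (f x - g x)) = (fun x => F k x - f x) - fun x => G k x - g x := by
    ext x; simp; ring
  simp only [e]
  exact eLpNorm_sub_le ((hF k).sub hf') ((hG k).sub hg') hp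

theorem TendstoLp.add {F G : ℕ → E d → ℝ} {f g : E d → ℝ} {p : ℝ≥0∞} (hp : 1 ≤ p)
    {μ : Measure (E d)}
    (hF : ∀ k, AEStronglyMeasurable (F k) μ) (hG : ∀ k, AEStronglyMeasurable (G k) μ)
    (hf' : AEStronglyMeasurable f μ) (hg' : AEStronglyMeasurable g μ)
    (hf : TendstoLp p μ F f) (hg : TendstoLp p μ G g) :
    TendstoLp p μ (fun k x => F k x + G k x) fun x => f x + g x := by
  have h3 : Tendsto (fun k => eLpNorm (fun x => F k x - f x) p μ
        + eLpNorm (fun x => G k x - g x) p μ) atTop (𝓝 0) := by simpa using Tendsto.add hf hg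
  refine tendsto_of_tendsto_of_tendsto_of_le_of_le tendsto_const_nhds h3
    (fun _ => zero_le) fun k => ?_
  have e : (fun x => F k x + G k x - (f x + g x)) = (fun x => F k x - f x) + fun x => G k x - g x := by
    ext x; simp; ring
  simp only [e]
  exact eLpNorm_add_le ((hF k).sub hf') ((hG k).sub hg') hp

theorem MemH10.exists_seq {f : E d → ℝ} (h : MemH10 Ω f) : ∃ φ : ℕ → E d → ℝ,
    (∀ k, IsTest Ω (φ k)) ∧ TendstoLp 2 (volume.restrict Ω) φ f ∧
    ∀ j, TendstoLp 2 (volume.restrict Ω) (fun k => cpartial j (φ k)) (wd Ω j f) := h.2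

theorem MemH10.sub (hΩ : IsOpen Ω) {f g : E d → ℝ} (hf : MemH10 Ω f) (hg : MemH10 Ω g) :
    MemH10 Ω (fun x => f x - g x) := by
  obtain ⟨φ, h1, h2, h3⟩ := hf.exists_seq
  obtain ⟨ψ, k1, k2, k3⟩ := hg.exists_seq
  refine ⟨hf.1.sub hΩ hg.1, fun k x => φ k x - ψ k x, fun k => (h1 k).sub (k1 k), ?_, fun j => ?_⟩
  · exact h2.sub (by norm_num) (fun k => ((h1 k).memLp 2).1) (fun k => ((k1 k).memLp 2).1)
      hf.1.1.1 hg.1.1.1 k2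
  · refine ((h3 j).sub (by norm_num) (fun k => (((h1 k).cpartial j).memLp 2).1)
      (fun k => (((k1 k).cpartial j).memLp 2).1) (hf.1.2 j).2.1 (hg.1.2 j).2.1 (k3 j)).congr
      (fun k => ?_) (wd_sub hΩ hf.1 hg.1 j).symm
    exact Eventually.of_forall fun x => (cpartial_sub (h1 k).1 (k1 k).1 j x).symm

end

section

variable {d : ℕ} {Ω : Set (E d)}

/-! ### The embedding of `H¹₀` in `L⁴` -/

theorem sum_smul_single (x : E d) : ∑ j, x j • EuclideanSpace.single j (1 : ℝ) = x := by
  have := (EuclideanSpace.basisFun (Fin d) ℝ).sum_repr x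
  simpa using this

theorem norm_fderiv_le_sum (φ : E d → ℝ) (x : E d) :
    ‖fderiv ℝ φ x‖ ≤ ∑ j, ‖cpartial j φ x‖ := by
  refine ContinuousLinearMap.opNorm_le_bound _ (by positivity) fun y => ?_
  have h : fderiv ℝ φ x y = ∑ j, y j * cpartial j φ x := by
    conv_lhs => rw [← sum_smul_single y]
    simp [cpartial]
  rw [h, Finset.sum_mul]
  refine (norm_sum_le _ _).trans (Finset.sum_le_sum fun j _ => ?_)
  rw [norm_mul, mul_comm]
  gcongr
  exact PiLp.norm_apply_le y j

theorem eLpNorm_fderiv_restrict {φ : E d → ℝ} (hφ : IsTest Ω φ) (p : ℝ≥0∞) :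
    eLpNorm (fderiv ℝ φ) p (volume.restrict Ω) = eLpNorm (fderiv ℝ φ) p volume := by
  have h : Function.support (fun x => ‖fderiv ℝ φ x‖) ⊆ Ω := by
    intro x hx
    refine hφ.2.2 (tsupport_fderiv_subset ℝ (subset_tsupport _ ?_))
    simpa using hx
  rw [← eLpNorm_norm, ← eLpNorm_norm (fderiv ℝ φ)]
  exact eLpNorm_restrict_eq_of_support_subset h

/-- The Gagliardo–Nirenberg–Sobolev inequality from an exponent below 2, followed by Hölder on the
set Ω of finite measure. -/
theorem exists_sobolev_const (hd : d = 2 ∨ d = 3) (hb : Bornology.IsBounded Ω)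
    [IsFiniteMeasure (volume.restrict Ω)] :
    ∃ C : ℝ≥0∞, C ≠ ⊤ ∧ ∀ φ, IsTest Ω φ →
      eLpNorm φ 4 (volume.restrict Ω) ≤ C * ∑ j, eLpNorm (cpartial j φ) 2 (volume.restrict Ω) := by
  have hfr : Module.finrank ℝ (E d) = d := by simp
  -- 12/7 has Sobolev conjugate exactly 4 in dimension three, and is still below 2, as dimension two
  -- requires.
  set p : ℝ≥0 := 12 / 7 with hp
  have hp1 : 1 ≤ p := by
    rw [hp, ← NNReal.coe_le_coe]; push_cast; norm_num
  have hpd : p < (Module.finrank ℝ (E d) : ℝ≥0) := by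
    rw [hfr, hp, ← NNReal.coe_lt_coe]
    rcases hd with rfl | rfl <;> push_cast <;> norm_num
  have hpq : (p : ℝ)⁻¹ - (Module.finrank ℝ (E d) : ℝ)⁻¹ ≤ ((4 : ℝ≥0) : ℝ)⁻¹ := by
    rw [hfr, hp]
    rcases hd with rfl | rfl <;> push_cast <;> norm_num
  have hp2 : (p : ℝ≥0∞) ≤ 2 := by
    have : p ≤ 2 := by rw [hp, ← NNReal.coe_le_coe]; push_cast; norm_num
    exact_mod_cast this
  set c := MeasureTheory.eLpNormLESNormFDerivOfLeConst ℝ (volume : Measure (E d)) Ω p 4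
  set m := (volume.restrict Ω) univ ^ (1 / (p : ℝ≥0∞).toReal - 1 / (2 : ℝ≥0∞).toReal)
  refine ⟨c * m, ?_, fun φ hφ => ?_⟩
  · refine ENNReal.mul_ne_top ENNReal.coe_ne_top (ENNReal.rpow_ne_top_of_nonneg ?_
      (measure_ne_top _ _))
    rw [hp]; simp; norm_num
  · have h1 := eLpNorm_le_eLpNorm_fderiv_of_le (μ := (volume : Measure (E d))) (u := φ) (s := Ω)
      (p := p) (q := 4) (hφ.1.of_le (by simp)) ((subset_tsupport φ).trans hφ.2.2) hp1 hpd hpq hb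
    have h2 : eLpNorm (fderiv ℝ φ) p volume = eLpNorm (fderiv ℝ φ) p (volume.restrict Ω) := by
      exact (eLpNorm_fderiv_restrict hφ p).symm
    have hcont : Continuous (fderiv ℝ φ) := hφ.1.continuous_fderiv (by simp)
    have h3 : eLpNorm (fderiv ℝ φ) p (volume.restrict Ω)
        ≤ eLpNorm (fderiv ℝ φ) 2 (volume.restrict Ω) * m :=
      eLpNorm_le_eLpNorm_mul_rpow_measure_univ hp2 hcont.aestronglyMeasurable
    have h4 : eLpNorm (fderiv ℝ φ) 2 (volume.restrict Ω)
        ≤ ∑ j, eLpNorm (cpartial j φ) 2 (volume.restrict Ω) := by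
      refine (eLpNorm_mono_real (g := fun x => ∑ j, ‖cpartial j φ x‖)
        (norm_fderiv_le_sum φ)).trans ?_
      have := eLpNorm_sum_le (p := 2) (μ := volume.restrict Ω) (s := Finset.univ)
        (f := fun j x => ‖cpartial j φ x‖) (fun j _ =>
          ((contDiff_cpartial hφ.1 j).continuous.norm.aestronglyMeasurable)) (by norm_num)
      simp only [eLpNorm_norm] at this
      refine le_trans (le_of_eq ?_) this
      congr 1; ext x; simp
    calc eLpNorm φ 4 (volume.restrict Ω) ≤ eLpNorm φ 4 volume :=
          eLpNorm_mono_measure _ Measure.restrict_le_self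
      _ ≤ c * eLpNorm (fderiv ℝ φ) p volume := by simpa using h1
      _ ≤ c * (eLpNorm (fderiv ℝ φ) 2 (volume.restrict Ω) * m) := by rw [h2]; gcongr
      _ ≤ c * ((∑ j, eLpNorm (cpartial j φ) 2 (volume.restrict Ω)) * m) := by gcongr
      _ = _ := by ring

theorem TendstoLp.add_swap {p : ℝ≥0∞} (hp : 1 ≤ p) {μ : Measure (E d)} {F : ℕ → E d → ℝ}
    {f : E d → ℝ} (hF : ∀ k, AEStronglyMeasurable (F k) μ) (hf : AEStronglyMeasurable f μ)
    (k l : ℕ) : eLpNorm (fun x => F k x - F l x) p μ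
      ≤ eLpNorm (fun x => F k x - f x) p μ + eLpNorm (fun x => F l x - f x) p μ := by
  have e : (fun x => F k x - F l x) = (fun x => F k x - f x) - fun x => F l x - f x := by
    ext x; simp
  rw [e]
  exact eLpNorm_sub_le ((hF k).sub hf) ((hF l).sub hf) hp

/-- The approximating test functions of `f ∈ H¹₀` converge also in `L⁴`. -/
theorem tendstoLp_four (hd : d = 2 ∨ d = 3) (hb : Bornology.IsBounded Ω)
    [IsFiniteMeasure (volume.restrict Ω)] {f : E d → ℝ} {g : Fin d → E d → ℝ}
    {φ : ℕ → E d → ℝ} (hφ : ∀ k, IsTest Ω (φ k)) (hf : AEStronglyMeasurable f (volume.restrict Ω))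
    (hg : ∀ j, AEStronglyMeasurable (g j) (volume.restrict Ω))
    (h0 : TendstoLp 2 (volume.restrict Ω) φ f)
    (h1 : ∀ j, TendstoLp 2 (volume.restrict Ω) (fun k => cpartial j (φ k)) (g j)) :
    TendstoLp 4 (volume.restrict Ω) φ f := by
  obtain ⟨C, hC, hS⟩ := exists_sobolev_const hd hb
  have hm := tendstoInMeasure_of_tendsto_eLpNorm (by norm_num) (fun k => ((hφ k).memLp 2).1) hf h0
  obtain ⟨ns, hns, hae⟩ := hm.exists_seq_tendsto_ae
  set A : ℕ → ℝ≥0∞ := fun k => ∑ j, eLpNorm (fun x => cpartial j (φ k) x - g j x) 2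
    (volume.restrict Ω) with hA
  have hA0 : Tendsto A atTop (𝓝 0) := by
    have := tendsto_finsetSum Finset.univ fun j _ => h1 j
    simpa [hA] using this
  have hkl : ∀ k l, eLpNorm (fun x => φ k x - φ l x) 4 (volume.restrict Ω) ≤ C * (A k + A l) := by
    intro k l
    refine (hS _ ((hφ k).sub (hφ l))).trans ?_
    gcongr
    rw [hA, ← Finset.sum_add_distrib]
    refine Finset.sum_le_sum fun j _ => ?_
    have : cpartial j (fun x => φ k x - φ l x) = fun x => cpartial j (φ k) x - cpartial j (φ l) x :=
      funext fun x => cpartial_sub (hφ k).1 (hφ l).1 j x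
    rw [this]
    exact TendstoLp.add_swap (F := fun k => cpartial j (φ k)) (by norm_num)
      (fun k => (((hφ k).cpartial j).memLp 2).1) (hg j) k l
  have hk : ∀ k, eLpNorm (fun x => φ k x - f x) 4 (volume.restrict Ω) ≤ C * A k := by
    intro k
    -- Fatou's lemma along the a.e. convergent subsequence turns the Cauchy bound into a bound for φ
    -- k − f; that f is in L⁴ need not be known.
    have := Lp.eLpNorm_lim_le_liminf_eLpNorm (p := 4) (μ := volume.restrict Ω)
      (f := fun l x => φ k x - φ (ns l) x) (fun l => (((hφ k).sub (hφ _)).memLp 2).1)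
      (fun x => φ k x - f x) (by
        filter_upwards [hae] with x hx
        exact tendsto_const_nhds.sub hx)
    refine this.trans ?_
    have hlim : Tendsto (fun l => C * (A k + A (ns l))) atTop (𝓝 (C * A k)) := by
      have h2 : Tendsto (fun l => A k + A (ns l)) atTop (𝓝 (A k + 0)) :=
        tendsto_const_nhds.add (hA0.comp hns.tendsto_atTop)
      rw [add_zero] at h2
      exact ENNReal.Tendsto.const_mul h2 (Or.inr hC)
    rw [← hlim.liminf_eq]
    exact liminf_le_liminf (Eventually.of_forall fun l => hkl k (ns l))
  refine tendsto_of_tendsto_of_tendsto_of_le_of_le tendsto_const_nhds ?_ (fun _ => zero_le) hk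
  simpa using ENNReal.Tendsto.const_mul hA0 (Or.inr hC)

theorem MemH10.exists_seq_four (hd : d = 2 ∨ d = 3) (hb : Bornology.IsBounded Ω)
    [IsFiniteMeasure (volume.restrict Ω)] {f : E d → ℝ} (h : MemH10 Ω f) : ∃ φ : ℕ → E d → ℝ,
    (∀ k, IsTest Ω (φ k)) ∧ TendstoLp 2 (volume.restrict Ω) φ f ∧
    (∀ j, TendstoLp 2 (volume.restrict Ω) (fun k => cpartial j (φ k)) (wd Ω j f)) ∧
    TendstoLp 4 (volume.restrict Ω) φ f := by
  obtain ⟨φ, h1, h2, h3⟩ := h.exists_seq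
  exact ⟨φ, h1, h2, h3, tendstoLp_four hd hb h1 h.1.1.1 (fun j => (h.1.2 j).2.1) h2 h3⟩

theorem MemH10.memLp_four (hd : d = 2 ∨ d = 3) (hb : Bornology.IsBounded Ω)
    [IsFiniteMeasure (volume.restrict Ω)] {f : E d → ℝ} (h : MemH10 Ω f) :
    MemLp f 4 (volume.restrict Ω) := by
  obtain ⟨φ, h1, -, -, h4⟩ := h.exists_seq_four hd hb
  obtain ⟨k, hk⟩ := (h4.eventually (gt_mem_nhds (show (0 : ℝ≥0∞) < 1 by simp))).exists
  have h5 : MemLp (fun x => φ k x - f x) 4 (volume.restrict Ω) :=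
    ⟨((h1 k).memLp 4).1.sub h.1.1.1, hk.trans ENNReal.one_lt_top⟩
  have := ((h1 k).memLp 4).sub h5
  convert! this using 1
  ext x; simp

/-! ### Product rules and integration by parts -/

/-- The product rule, for a bounded function with a square integrable weak derivative and a
function of `H¹₀`. -/
theorem HasWeakPartial.mul [IsFiniteMeasure (volume.restrict Ω)] {j : Fin d}
    {b c a : E d → ℝ} (hbc : HasWeakPartial Ω j b c) (hb : MemLp b ∞ (volume.restrict Ω))
    (hc : MemLp c 2 (volume.restrict Ω)) (ha : MemH10 Ω a) :
    HasWeakPartial Ω j (fun x => b x * a x) (fun x => c x * a x + b x * wd Ω j a x) := by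
  obtain ⟨φ, h1, h2, h3⟩ := ha.exists_seq
  have hba : MemLp (fun x => b x * a x) 2 (volume.restrict Ω) := memLp_mul hb ha.1.1
  have hca : MemLp (fun x => c x * a x) 1 (volume.restrict Ω) := memLp_mul hc ha.1.1
  have hbd : MemLp (fun x => b x * wd Ω j a x) 2 (volume.restrict Ω) := memLp_mul hb (ha.1.2 j).2
  refine ⟨locallyIntegrableOn_of_memLp (by norm_num) hba,
    (locallyIntegrableOn_of_memLp le_rfl hca).add (locallyIntegrableOn_of_memLp (by norm_num) hbd),
    fun ψ hψ => ?_⟩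
  have hb1 : MemLp (fun x => b x * cpartial j ψ x) 2 (volume.restrict Ω) :=
    memLp_mul hb ((hψ.cpartial j).memLp 2)
  have hb2 : MemLp (fun x => b x * ψ x) 2 (volume.restrict Ω) := memLp_mul hb (hψ.memLp 2)
  have hc1 : MemLp (fun x => c x * ψ x) 2 (volume.restrict Ω) := memLp_mul hc (hψ.memLp ∞)
  have l1 := TendstoLp.integral_mul (fun k => (h1 k).memLp 2) (fun _ => hb1) ha.1.1 hb1 h2
    (.const _ _)
  have l2 := TendstoLp.integral_mul (fun k => (h1 k).memLp 2) (fun _ => hc1) ha.1.1 hc1 h2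
    (.const _ _)
  have l3 := TendstoLp.integral_mul (fun k => ((h1 k).cpartial j).memLp 2) (fun _ => hb2)
    (ha.1.2 j).2 hb2 (h3 j) (.const _ _)
  -- The weak derivative of b is tested with φ k · ψ; boundedness of b and ψ makes L² convergence
  -- enough for the limit.
  have key : ∀ k, ∫ x in Ω, φ k x * (b x * cpartial j ψ x)
      = -(∫ x in Ω, φ k x * (c x * ψ x)) - ∫ x in Ω, cpartial j (φ k) x * (b x * ψ x) := by
    intro k
    have := hbc.2.2 _ (IsTest.mul_left (h1 k).1 hψ)
    simp_rw [cpartial_mul (h1 k).1 hψ.1] at this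
    have e1 : ∫ x in Ω, b x * (cpartial j (φ k) x * ψ x + φ k x * cpartial j ψ x)
        = (∫ x in Ω, cpartial j (φ k) x * (b x * ψ x))
          + ∫ x in Ω, φ k x * (b x * cpartial j ψ x) := by
      rw [← integral_add (integrable_mul_of_memLp (((h1 k).cpartial j).memLp 2) hb2)
        (integrable_mul_of_memLp ((h1 k).memLp 2) hb1)]
      congr 1; ext x; ring
    have e2 : ∫ x in Ω, c x * (φ k x * ψ x) = ∫ x in Ω, φ k x * (c x * ψ x) := by
      congr 1; ext x; ring
    rw [e1, e2] at this
    linarith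
  have hlim := tendsto_nhds_unique (l1.congr key) ((l2.neg).sub l3)
  have f1 : ∫ x in Ω, b x * a x * cpartial j ψ x = ∫ x in Ω, a x * (b x * cpartial j ψ x) := by
    congr 1; ext x; ring
  have f2 : ∫ x in Ω, (c x * a x + b x * wd Ω j a x) * ψ x
      = (∫ x in Ω, a x * (c x * ψ x)) + ∫ x in Ω, wd Ω j a x * (b x * ψ x) := by
    rw [← integral_add (integrable_mul_of_memLp ha.1.1 hc1)
      (integrable_mul_of_memLp (ha.1.2 j).2 hb2)]
    congr 1; ext x; ring
  rw [f1, f2, hlim]; ring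

/-- Integration by parts of the product of two functions of `H¹₀`. -/
theorem integral_mul_partial_mul (hd : d = 2 ∨ d = 3) (hbd : Bornology.IsBounded Ω)
    [IsFiniteMeasure (volume.restrict Ω)] {j : Fin d} {b c f g : E d → ℝ}
    (hbc : HasWeakPartial Ω j b c) (hb : MemLp b 4 (volume.restrict Ω))
    (hc : MemLp c 2 (volume.restrict Ω)) (hf : MemH10 Ω f) (hg : MemH10 Ω g) :
    ∫ x in Ω, b x * (wd Ω j f x * g x + f x * wd Ω j g x) = -∫ x in Ω, c x * (f x * g x) := by
  obtain ⟨φ, h1, h2, h3, h4⟩ := hf.exists_seq_four hd hbd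
  obtain ⟨ψ, k1, k2, k3, k4⟩ := hg.exists_seq_four hd hbd
  have hf4 := hf.memLp_four hd hbd
  have hg4 := hg.memLp_four hd hbd
  have m1 : ∀ k, MemLp (φ k) 4 (volume.restrict Ω) := fun k => (h1 k).memLp 4
  have m2 : ∀ k, MemLp (ψ k) 4 (volume.restrict Ω) := fun k => (k1 k).memLp 4
  -- Each term is a product of three factors of which one is a derivative in L²; the other two must
  -- converge in L⁴.
  have t1 : TendstoLp 2 (volume.restrict Ω) (fun k x => b x * φ k x) fun x => b x * f x :=
    TendstoLp.mul (by norm_num) (fun _ => hb.1) (fun k => (m1 k).1) hb hf4 (.const _ _) h4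
  have t2 : TendstoLp 2 (volume.restrict Ω) (fun k x => b x * ψ k x) fun x => b x * g x :=
    TendstoLp.mul (by norm_num) (fun _ => hb.1) (fun k => (m2 k).1) hb hg4 (.const _ _) k4
  have t3 : TendstoLp 2 (volume.restrict Ω) (fun k x => φ k x * ψ k x) fun x => f x * g x :=
    TendstoLp.mul (by norm_num) (fun k => (m1 k).1) (fun k => (m2 k).1) hf4 hg4 h4 k4
  have n1 : ∀ k, MemLp (fun x => b x * φ k x) 2 (volume.restrict Ω) := fun k => memLp_mul hb (m1 k)
  have n2 : ∀ k, MemLp (fun x => b x * ψ k x) 2 (volume.restrict Ω) := fun k => memLp_mul hb (m2 k)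
  have n3 : ∀ k, MemLp (fun x => φ k x * ψ k x) 2 (volume.restrict Ω) :=
    fun k => memLp_mul (m1 k) (m2 k)
  have n1' : MemLp (fun x => b x * f x) 2 (volume.restrict Ω) := memLp_mul hb hf4
  have n2' : MemLp (fun x => b x * g x) 2 (volume.restrict Ω) := memLp_mul hb hg4
  have n3' : MemLp (fun x => f x * g x) 2 (volume.restrict Ω) := memLp_mul hf4 hg4
  have p1 : ∀ k, MemLp (cpartial j (φ k)) 2 (volume.restrict Ω) :=
    fun k => ((h1 k).cpartial j).memLp 2
  have p2 : ∀ k, MemLp (cpartial j (ψ k)) 2 (volume.restrict Ω) :=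
    fun k => ((k1 k).cpartial j).memLp 2
  have l1 := TendstoLp.integral_mul n2 p1 n2' (hf.1.2 j).2 t2 (h3 j)
  have l2 := TendstoLp.integral_mul n1 p2 n1' (hg.1.2 j).2 t1 (k3 j)
  have l3 := TendstoLp.integral_mul (fun _ => hc) n3 hc n3' (.const _ _) t3
  have key : ∀ k, (∫ x in Ω, b x * ψ k x * cpartial j (φ k) x)
      + (∫ x in Ω, b x * φ k x * cpartial j (ψ k) x) = -∫ x in Ω, c x * (φ k x * ψ k x) := by
    intro k
    rw [← hbc.2.2 _ (IsTest.mul_left (h1 k).1 (k1 k)),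
      ← integral_add (integrable_mul_of_memLp (n2 k) (p1 k))
        (integrable_mul_of_memLp (n1 k) (p2 k))]
    congr 1; ext x
    rw [cpartial_mul (h1 k).1 (k1 k).1]; ring
  have := tendsto_nhds_unique ((l1.add l2).congr key) l3.neg
  rw [← this, ← integral_add (integrable_mul_of_memLp n2' (hf.1.2 j).2)
    (integrable_mul_of_memLp n1' (hg.1.2 j).2)]
  congr 1; ext x; ring

/-- A function of `H¹₀` can be integrated by parts against functions that do not vanish on the
boundary. -/
theorem MemH10.integral_mul_smooth [IsFiniteMeasure (volume.restrict Ω)] {f ψ : E d → ℝ}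
    (hf : MemH10 Ω f) (hψ : ContDiff ℝ ∞ ψ) (hc : HasCompactSupport ψ) (j : Fin d) :
    ∫ x in Ω, wd Ω j f x * ψ x = -∫ x in Ω, f x * cpartial j ψ x := by
  obtain ⟨φ, h1, h2, h3⟩ := hf.exists_seq
  have m1 : MemLp ψ 2 (volume.restrict Ω) := memLp_of_smooth hψ hc 2
  have m2 : MemLp (cpartial j ψ) 2 (volume.restrict Ω) :=
    memLp_of_smooth (contDiff_cpartial hψ j) (hasCompactSupport_cpartial hc j) 2
  have l1 := TendstoLp.integral_mul (fun k => ((h1 k).cpartial j).memLp 2) (fun _ => m1)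
    (hf.1.2 j).2 m1 (h3 j) (.const _ _)
  have l2 := TendstoLp.integral_mul (fun k => (h1 k).memLp 2) (fun _ => m2) hf.1.1 m2 h2
    (.const _ _)
  refine tendsto_nhds_unique (l1.congr fun k => ?_) l2.neg
  -- The support of φ k makes the product a test function, whatever ψ does at the boundary.
  have ht : IsTest Ω (fun x => ψ x * φ k x) := IsTest.mul_left hψ (h1 k)
  have h0 : ∫ x in Ω, cpartial j (fun x => ψ x * φ k x) x = 0 := by
    rw [setIntegral_eq_of_tsupport (ht.cpartial j).2.2, integral_cpartial ht.1 ht.2.1]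
  simp_rw [cpartial_mul hψ (h1 k).1] at h0
  rw [integral_add (integrable_mul_of_memLp m2 ((h1 k).memLp 2))
    (integrable_mul_of_memLp m1 (((h1 k).cpartial j).memLp 2))] at h0
  simp_rw [mul_comm (cpartial j (φ k) _), mul_comm (φ k _)]
  linarith

/-- `H¹₀` is closed in `H¹`. -/
theorem MemH10.of_forall_exists [IsFiniteMeasure (volume.restrict Ω)] {f : E d → ℝ}
    (hf : MemH1 Ω f)
    (h : ∀ ε : ℝ≥0∞, 0 < ε → ∃ φ, IsTest Ω φ ∧
      eLpNorm (fun x => φ x - f x) 2 (volume.restrict Ω) ≤ ε ∧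
      ∀ j, eLpNorm (fun x => cpartial j φ x - wd Ω j f x) 2 (volume.restrict Ω) ≤ ε) :
    MemH10 Ω f := by
  have hpos : ∀ k : ℕ, (0 : ℝ≥0∞) < ((k : ℝ≥0∞) + 1)⁻¹ := fun k =>
    ENNReal.inv_pos.2 (by finiteness)
  choose φ h1 h2 h3 using fun k : ℕ => h _ (hpos k)
  have h0 : Tendsto (fun k : ℕ => ((k : ℝ≥0∞) + 1)⁻¹) atTop (𝓝 0) := by
    have := (tendsto_add_atTop_iff_nat 1).2 ENNReal.tendsto_inv_nat_nhds_zero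
    simpa using this
  exact ⟨hf, φ, h1,
    tendsto_of_tendsto_of_tendsto_of_le_of_le tendsto_const_nhds h0 (fun _ => zero_le) h2,
    fun j => tendsto_of_tendsto_of_tendsto_of_le_of_le tendsto_const_nhds h0 (fun _ => zero_le)
      fun k => h3 k j⟩

/-- `H¹₀` is closed under limits of sequences. -/
theorem MemH10.of_tendsto [IsFiniteMeasure (volume.restrict Ω)] {f : E d → ℝ}
    {F : ℕ → E d → ℝ} (hf : MemH1 Ω f) (hF : ∀ k, MemH10 Ω (F k))
    (h0 : TendstoLp 2 (volume.restrict Ω) F f)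
    (h1 : ∀ j, TendstoLp 2 (volume.restrict Ω) (fun k => wd Ω j (F k)) (wd Ω j f)) :
    MemH10 Ω f := by
  refine .of_forall_exists hf fun ε hε => ?_
  have hε2 : 0 < ε / 2 := ENNReal.half_pos hε.ne'
  obtain ⟨k, hk0, hk1⟩ := ((h0.eventually (ge_mem_nhds hε2)).and
    (eventually_all.2 fun j => (h1 j).eventually (ge_mem_nhds hε2))).exists
  obtain ⟨φ, g0, g1, g2⟩ := (hF k).exists_seq
  obtain ⟨l, hl0, hl1⟩ := ((g1.eventually (ge_mem_nhds hε2)).and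
    (eventually_all.2 fun j => (g2 j).eventually (ge_mem_nhds hε2))).exists
  have tri : ∀ a b c : E d → ℝ, AEStronglyMeasurable a (volume.restrict Ω) →
      AEStronglyMeasurable b (volume.restrict Ω) → AEStronglyMeasurable c (volume.restrict Ω) →
      eLpNorm (fun x => a x - b x) 2 (volume.restrict Ω) ≤ ε / 2 →
      eLpNorm (fun x => b x - c x) 2 (volume.restrict Ω) ≤ ε / 2 →
      eLpNorm (fun x => a x - c x) 2 (volume.restrict Ω) ≤ ε := by
    intro a b c ha hb hc hab hbc
    have e : (fun x => a x - c x) = (fun x => a x - b x) + fun x => b x - c x := by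
      ext x; simp
    rw [e, ← ENNReal.add_halves ε]
    exact (eLpNorm_add_le (ha.sub hb) (hb.sub hc) (by norm_num)).trans (add_le_add hab hbc)
  exact ⟨φ l, g0 l, tri _ _ _ ((g0 l).memLp 2).1 (hF k).1.1.1 hf.1.1 hl0 hk0, fun j =>
    tri _ _ _ (((g0 l).cpartial j).memLp 2).1 ((hF k).1.2 j).2.1 (hf.2 j).2.1 (hl1 j) (hk1 j)⟩

theorem IsTest.memH10 (hΩ : IsOpen Ω) [IsFiniteMeasure (volume.restrict Ω)] {φ : E d → ℝ}
    (hφ : IsTest Ω φ) : MemH10 Ω φ := by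
  refine ⟨.of_hasWeakPartial hΩ (hφ.memLp 2) hφ.hasWeakPartial
    fun j => (hφ.cpartial j).memLp 2, fun _ => φ, fun _ => hφ, TendstoLp.const _ _, fun j => ?_⟩
  exact (TendstoLp.const 2 _).congr (fun _ => ae_eq_refl _)
    ((hφ.hasWeakPartial j).wd_ae_eq hΩ).symm

theorem IsTest.wd_ae_eq (hΩ : IsOpen Ω) [IsFiniteMeasure (volume.restrict Ω)] {φ : E d → ℝ}
    (hφ : IsTest Ω φ) (j : Fin d) : wd Ω j φ =ᵐ[volume.restrict Ω] ACM.cpartial j φ :=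
  (hφ.hasWeakPartial j).wd_ae_eq hΩ

/-- The product of a Lipschitz function that vanishes on the boundary and a function of `H¹₀`. -/
theorem MemH10.mul (hΩ : IsOpen Ω) [IsFiniteMeasure (volume.restrict Ω)] {u v : E d → ℝ}
    (hu : MemH10 Ω u) (hub : MemLp u ∞ (volume.restrict Ω))
    (hud : ∀ j, MemLp (wd Ω j u) ∞ (volume.restrict Ω)) (hv : MemH10 Ω v) :
    MemH10 Ω (fun x => u x * v x) ∧ ∀ j, wd Ω j (fun x => u x * v x) =ᵐ[volume.restrict Ω]
      fun x => wd Ω j u x * v x + u x * wd Ω j v x := by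
  have hw : ∀ a, MemH10 Ω a → ∀ j, HasWeakPartial Ω j (fun x => u x * a x)
      (fun x => wd Ω j u x * a x + u x * wd Ω j a x) := fun a ha j =>
    (hu.1.hasWeakPartial j).mul hub (hu.1.2 j).2 ha
  have hH1 : ∀ a, MemH10 Ω a → MemH1 Ω (fun x => u x * a x) := fun a ha =>
    .of_hasWeakPartial hΩ (memLp_mul hub ha.1.1) (hw a ha) fun j =>
      MemLp.add (memLp_mul (hud j) ha.1.1) (memLp_mul hub (ha.1.2 j).2)
  have hwd : ∀ a, MemH10 Ω a → ∀ j, wd Ω j (fun x => u x * a x) =ᵐ[volume.restrict Ω]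
      fun x => wd Ω j u x * a x + u x * wd Ω j a x := fun a ha j => (hw a ha j).wd_ae_eq hΩ
  -- Two stages: for a test function ψ the approximants of u are used; afterwards v is replaced by
  -- its own approximants, with u and its derivatives bounded.
  have htest : ∀ ψ, IsTest Ω ψ → MemH10 Ω (fun x => u x * ψ x) := by
    intro ψ hψ
    obtain ⟨φ, h1, h2, h3⟩ := hu.exists_seq
    have hφψ : ∀ k, IsTest Ω (fun x => φ k x * ψ x) := fun k => IsTest.mul_left (h1 k).1 hψ
    refine .of_tendsto (F := fun k x => φ k x * ψ x) (hH1 ψ (hψ.memH10 hΩ))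
      (fun k => (hφψ k).memH10 hΩ) ?_ fun j => ?_
    · exact TendstoLp.mul (by norm_num) (fun k => ((h1 k).memLp 2).1) (fun _ => (hψ.memLp 2).1)
        hu.1.1 (hψ.memLp ∞) h2 (.const _ _)
    · have t1 : TendstoLp 2 (volume.restrict Ω) (fun k x => cpartial j (φ k) x * ψ x)
          fun x => wd Ω j u x * ψ x :=
        TendstoLp.mul (by norm_num) (fun k => (((h1 k).cpartial j).memLp 2).1)
          (fun _ => (hψ.memLp 2).1) (hu.1.2 j).2 (hψ.memLp ∞) (h3 j) (.const _ _)
      have t2 : TendstoLp 2 (volume.restrict Ω) (fun k x => φ k x * cpartial j ψ x)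
          fun x => u x * cpartial j ψ x :=
        TendstoLp.mul (by norm_num) (fun k => ((h1 k).memLp 2).1)
          (fun _ => ((hψ.cpartial j).memLp 2).1) hu.1.1 ((hψ.cpartial j).memLp ∞) h2 (.const _ _)
      refine (t1.add (by norm_num)
        (fun k => (((h1 k).cpartial j).memLp 2).1.mul (hψ.memLp 2).1)
        (fun k => ((h1 k).memLp 2).1.mul ((hψ.cpartial j).memLp 2).1)
        ((hu.1.2 j).2.1.mul (hψ.memLp 2).1) (hu.1.1.1.mul ((hψ.cpartial j).memLp 2).1) t2).congr
        (fun k => ?_) ?_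
      · filter_upwards [(hφψ k).wd_ae_eq hΩ j] with x hx
        rw [hx, cpartial_mul (h1 k).1 hψ.1]; rfl
      · filter_upwards [hwd ψ (hψ.memH10 hΩ) j, hψ.wd_ae_eq hΩ j] with x hx hx'
        rw [hx, hx']; rfl
  refine ⟨?_, hwd v hv⟩
  obtain ⟨ψ, h1, h2, h3⟩ := hv.exists_seq
  refine .of_tendsto (hH1 v hv) (fun k => htest _ (h1 k)) ?_ fun j => ?_
  · exact TendstoLp.mul (by norm_num) (fun k => hu.1.1.1) (fun k => ((h1 k).memLp 2).1)
        hub hv.1.1 (.const _ _) h2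
  · have t1 : TendstoLp 2 (volume.restrict Ω) (fun k x => wd Ω j u x * ψ k x)
        fun x => wd Ω j u x * v x :=
      TendstoLp.mul (by norm_num) (fun k => (hud j).1) (fun k => ((h1 k).memLp 2).1)
        (hud j) hv.1.1 (.const _ _) h2
    have t2 : TendstoLp 2 (volume.restrict Ω) (fun k x => u x * cpartial j (ψ k) x)
        fun x => u x * wd Ω j v x :=
      TendstoLp.mul (by norm_num) (fun k => hub.1) (fun k => (((h1 k).cpartial j).memLp 2).1)
        hub (hv.1.2 j).2 (.const _ _) (h3 j)
    refine (t1.add (by norm_num)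
      (fun k => (hud j).1.mul ((h1 k).memLp 2).1)
      (fun k => hub.1.mul (((h1 k).cpartial j).memLp 2).1)
      ((hud j).1.mul hv.1.1.1) (hub.1.mul (hv.1.2 j).2.1) t2).congr (fun k => ?_) (hwd v hv j).symm
    filter_upwards [hwd (ψ k) ((h1 k).memH10 hΩ) j, (h1 k).wd_ae_eq hΩ j] with x hx hx'
    rw [hx, hx']; rfl

/-! ### Korn's inequality -/

/-- Approximating g by test functions moves both derivatives onto g, where the mixed second
derivatives commute. It serves to turn the integral of ∇v : ∇vᵀ into that of (div v)². -/
theorem integral_partial_mul_partial_comm [IsFiniteMeasure (volume.restrict Ω)]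
    {f g : E d → ℝ} (hf : MemH10 Ω f) (hg : MemH10 Ω g) (i j : Fin d) :
    ∫ x in Ω, wd Ω j f x * wd Ω i g x = ∫ x in Ω, wd Ω i f x * wd Ω j g x := by
  obtain ⟨ψ, k1, k2, k3⟩ := hg.exists_seq
  have hlim : ∀ i j, Tendsto (fun k => ∫ x in Ω, wd Ω j f x * cpartial i (ψ k) x) atTop
      (𝓝 (∫ x in Ω, wd Ω j f x * wd Ω i g x)) := fun i j =>
    TendstoLp.integral_mul (fun _ => (hf.1.2 j).2) (fun k => ((k1 k).cpartial i).memLp 2)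
      (hf.1.2 j).2 (hg.1.2 i).2 (.const _ _) (k3 i)
  refine tendsto_nhds_unique ((hlim i j).congr fun k => ?_) (hlim j i)
  have h1 := (hf.1.hasWeakPartial j).2.2 _ ((k1 k).cpartial i)
  have h2 := (hf.1.hasWeakPartial i).2.2 _ ((k1 k).cpartial j)
  have hcomm : ∀ x, cpartial j (cpartial i (ψ k)) x = cpartial i (cpartial j (ψ k)) x := by
    intro x
    have hs := (k1 k).1.contDiffAt (x := x) |>.isSymmSndFDerivAt (by simp only [minSmoothness_of_isRCLikeNormedField]; exact WithTop.coe_le_coe.2 (le_top (α := ℕ∞)))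
    have hdiff : DifferentiableAt ℝ (fderiv ℝ (ψ k)) x :=
      (((k1 k).1.fderiv_right (m := ∞) (by simp)).differentiable (by simp)) x
    have hc : ∀ a b : Fin d, cpartial a (cpartial b (ψ k)) x
        = fderiv ℝ (fderiv ℝ (ψ k)) x (EuclideanSpace.single a 1) (EuclideanSpace.single b 1) := by
      intro a b
      have : cpartial b (ψ k) = fun y => fderiv ℝ (ψ k) y (EuclideanSpace.single b 1) := rfl
      rw [this, cpartial, fderiv_clm_apply hdiff (by fun_prop)]
      simp
    rw [hc, hc]; exact hs _ _
  simp_rw [hcomm] at h1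
  linarith

end

section

variable {d : ℕ} {Ω : Set (E d)}

/-! ### Mollification -/

/-- The mollification of `f : Ω → ℝ`, extended by zero. -/
noncomputable def mollify (Ω : Set (E d)) (φ : ContDiffBump (0 : E d)) (f : E d → ℝ) : E d → ℝ :=
  convolution (φ.normed volume) (Ω.indicator f) (ContinuousLinearMap.lsmul ℝ ℝ) volume

theorem mollify_apply (φ : ContDiffBump (0 : E d)) (f : E d → ℝ) (x : E d) :
    mollify Ω φ f x = ∫ t, φ.normed volume t * Ω.indicator f (x - t) := by
  simp [mollify, convolution]

theorem integrable_indicator_of_memLp (hΩ : IsOpen Ω) [IsFiniteMeasure (volume.restrict Ω)]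
    {p : ℝ≥0∞} (hp : 1 ≤ p) {f : E d → ℝ}
    (hf : MemLp f p (volume.restrict Ω)) : Integrable (Ω.indicator f) :=
  (integrable_indicator_iff hΩ.measurableSet).2 (hf.integrable hp)

theorem contDiff_mollify (φ : ContDiffBump (0 : E d)) {f : E d → ℝ}
    (hf : Integrable (Ω.indicator f)) : ContDiff ℝ ∞ (mollify Ω φ f) :=
  (φ.hasCompactSupport_normed (μ := volume)).contDiff_convolution_left _ φ.contDiff_normed
    hf.locallyIntegrable

theorem integrable_mollify_aux (φ : ContDiffBump (0 : E d)) {f : E d → ℝ}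
    (hf : Integrable (Ω.indicator f)) (x : E d) :
    Integrable fun t => φ.normed volume t * Ω.indicator f (x - t) := by
  have := (φ.hasCompactSupport_normed (μ := volume)).convolutionExists_left
    (ContinuousLinearMap.lsmul ℝ ℝ)
    φ.continuous_normed hf.locallyIntegrable (μ := volume) x
  simpa [ConvolutionExistsAt] using this

/-- Mollification commutes with weak derivatives, away from the boundary. -/
theorem cpartial_mollify (hΩ : IsOpen Ω) (φ : ContDiffBump (0 : E d)) {j : Fin d}
    {f g : E d → ℝ} (hf : Integrable (Ω.indicator f)) (h : HasWeakPartial Ω j f g) {x : E d}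
    (hx : Metric.closedBall x φ.rOut ⊆ Ω) :
    cpartial j (mollify Ω φ f) x = mollify Ω φ g x := by
  set k : E d → ℝ := φ.normed volume with hk
  have hkc : ContDiff ℝ ∞ k := φ.contDiff_normed
  have hks : HasCompactSupport k := φ.hasCompactSupport_normed
  have h1 := hks.hasFDerivAt_convolution_left (ContinuousLinearMap.lsmul ℝ ℝ)
    (hkc.of_le (by simp)) hf.locallyIntegrable x (μ := volume)
  have hex := (hks.fderiv ℝ).convolutionExists_left
    ((ContinuousLinearMap.lsmul ℝ ℝ).precompL (E d)) (hkc.continuous_fderiv (by simp))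
    hf.locallyIntegrable (μ := volume) x
  have h2 : cpartial j (mollify Ω φ f) x = ∫ t, cpartial j k t * Ω.indicator f (x - t) := by
    have e1 : fderiv ℝ (mollify Ω φ f) x = _ := h1.fderiv
    rw [cpartial, e1, convolution, ContinuousLinearMap.integral_apply hex]
    congr 1
  -- The reflected kernel centred at x is admissible in the definition of the weak derivative
  -- exactly because the closed ball lies in Ω.
  have hψ : IsTest Ω (fun y => k (x - y)) := by
    refine ⟨hkc.comp (contDiff_const.sub contDiff_id),
      hks.comp_homeomorph (Homeomorph.subLeft x), ?_⟩
    have : tsupport (fun y => k (x - y)) ⊆ Metric.closedBall x φ.rOut := by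
      refine closure_minimal (fun y hy => ?_) Metric.isClosed_closedBall
      have hy' : x - y ∈ Function.support k := hy
      rw [hk, φ.support_normed_eq] at hy'
      rw [mem_ball_zero_iff] at hy'
      rw [Metric.mem_closedBall, dist_comm, dist_eq_norm]
      exact hy'.le
    exact this.trans hx
  have hcp : ∀ y, cpartial j (fun y => k (x - y)) y = -cpartial j k (x - y) := by
    intro y
    have hd : DifferentiableAt ℝ k (x - y) := hkc.differentiable (by simp) _
    have := (hd.hasFDerivAt.comp y ((hasFDerivAt_id y).const_sub x)).fderiv
    rw [cpartial, cpartial]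
    change fderiv ℝ (k ∘ fun y => x - y) y _ = _
    erw [this]
    simp
  have hsw : ∀ (a : E d → ℝ) (f : E d → ℝ), ∫ t, a t * Ω.indicator f (x - t)
      = ∫ y in Ω, f y * a (x - y) := by
    intro a f
    rw [← integral_sub_left_eq_self _ volume x, ← integral_indicator hΩ.measurableSet]
    congr 1; ext y
    by_cases hy : y ∈ Ω <;> simp [hy, mul_comm]
  have h3 := h.2.2 _ hψ
  simp_rw [hcp, mul_neg, integral_neg] at h3
  rw [h2, hsw, mollify_apply, hsw]
  linarith

/-- Jensen's inequality for mollifications. -/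
theorem mollify_sq_le (φ : ContDiffBump (0 : E d)) {g : E d → ℝ}
    (hg : Integrable (Ω.indicator g)) (hg2 : Integrable (Ω.indicator fun y => g y ^ 2)) (x : E d) :
    mollify Ω φ g x ^ 2 ≤ mollify Ω φ (fun y => g y ^ 2) x := by
  set c := mollify Ω φ g x with hc
  -- The variance about the mean c is non-negative; expanding the square and using that the kernel
  -- has integral one gives the claim.
  have h0 : 0 ≤ ∫ t, φ.normed volume t * (Ω.indicator g (x - t) - c) ^ 2 :=
    integral_nonneg fun t => mul_nonneg (φ.nonneg_normed t) (sq_nonneg _)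
  have i1 := integrable_mollify_aux φ hg x
  have i2 := integrable_mollify_aux φ hg2 x
  have i3 : Integrable fun t => φ.normed volume t := φ.integrable_normed
  have e : ∀ t, φ.normed volume t * (Ω.indicator g (x - t) - c) ^ 2
      = φ.normed volume t * Ω.indicator (fun y => g y ^ 2) (x - t)
        - (2 * c) * (φ.normed volume t * Ω.indicator g (x - t)) + c ^ 2 * φ.normed volume t := by
    intro t
    by_cases ht : x - t ∈ Ω <;> simp [ht] <;> ring
  simp_rw [e] at h0
  have i4 : Integrable fun t => φ.normed volume t * Ω.indicator (fun y => g y ^ 2) (x - t)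
      - (2 * c) * (φ.normed volume t * Ω.indicator g (x - t)) := i2.sub (i1.const_mul _)
  rw [integral_add i4 (i3.const_mul _), integral_sub i2 (i1.const_mul _),
    integral_const_mul, integral_const_mul, φ.integral_normed, ← mollify_apply, ← mollify_apply,
    ← hc] at h0
  nlinarith

theorem integral_mollify (φ : ContDiffBump (0 : E d)) {f : E d → ℝ}
    (hf : Integrable (Ω.indicator f)) :
    Integrable (mollify Ω φ f) ∧ ∫ x, mollify Ω φ f x = ∫ x, Ω.indicator f x := by
  refine ⟨φ.integrable_normed.integrable_convolution _ hf, ?_⟩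
  have := integral_convolution (ContinuousLinearMap.lsmul ℝ ℝ)
    (φ.integrable_normed (μ := (volume : Measure (E d)))) hf (μ := volume) (ν := volume)
  rw [φ.integral_normed] at this
  simpa [mollify] using this

/-- A sequence of bump functions that shrinks to the origin. -/
noncomputable def bumpSeq (d : ℕ) (n : ℕ) : ContDiffBump (0 : E d) where
  rIn := 1 / (n + 1) / 2
  rOut := 1 / (n + 1)
  rIn_pos := by positivity
  rIn_lt_rOut := half_lt_self (by positivity)

theorem tendsto_bumpSeq_rOut : Tendsto (fun n => (bumpSeq d n).rOut) atTop (𝓝 0) :=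
  tendsto_one_div_add_atTop_nhds_zero_nat

/-- The outer radius is always twice the inner one, which is the bounded ratio that Lebesgue
differentiation needs. -/
theorem ae_tendsto_mollify {f : E d → ℝ} (hf : Integrable (Ω.indicator f)) :
    ∀ᵐ x, Tendsto (fun n => mollify Ω (bumpSeq d n) f x) atTop (𝓝 (Ω.indicator f x)) :=
  ContDiffBump.ae_convolution_tendsto_right_of_locallyIntegrable (K := 2) tendsto_bumpSeq_rOut
    (Eventually.of_forall fun n => by simp only [bumpSeq]; linarith) hf.locallyIntegrable

/-! ### The essential range of an `H¹` function on a connected set is connected -/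

/-- A function whose weak derivatives vanish is locally constant. -/
theorem ae_eq_const_near (hΩ : IsOpen Ω) {χ : E d → ℝ} (hχ : Integrable (Ω.indicator χ))
    (h : ∀ j, HasWeakPartial Ω j χ 0) {x : E d} {r : ℝ} (hr : 0 < r)
    (hx : Metric.closedBall x (2 * r) ⊆ Ω) :
    ∃ c, ∀ᵐ y, y ∈ Metric.ball x r → χ y = c := by
  -- Once the mollification radius is below r, the gradient of the mollified function is the
  -- mollified zero gradient on the whole ball.
  have hconst : ∀ᶠ n in atTop, ∀ y ∈ Metric.ball x r, ∀ z ∈ Metric.ball x r,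
      mollify Ω (bumpSeq d n) χ y = mollify Ω (bumpSeq d n) χ z := by
    filter_upwards [tendsto_bumpSeq_rOut.eventually (gt_mem_nhds hr)] with n hn y hy z hz
    refine (convex_ball x r).is_const_of_fderivWithin_eq_zero (𝕜 := ℝ)
      ((contDiff_mollify _ hχ).differentiable (by simp)).differentiableOn (fun y hy => ?_) hy hz
    rw [fderivWithin_of_isOpen Metric.isOpen_ball hy, ← norm_le_zero_iff]
    refine (norm_fderiv_le_sum _ y).trans (le_of_eq (Finset.sum_eq_zero fun j _ => ?_))
    rw [cpartial_mollify hΩ _ hχ (h j) ((Metric.closedBall_subset_closedBall' ?_).trans hx)]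
    · simp [mollify_apply]
    · have := Metric.mem_ball.1 hy
      linarith
  have hae := ae_tendsto_mollify hχ
  by_cases hne : ∃ z, z ∈ Metric.ball x r ∧
      Tendsto (fun n => mollify Ω (bumpSeq d n) χ z) atTop (𝓝 (Ω.indicator χ z))
  · obtain ⟨z, hz, hzt⟩ := hne
    refine ⟨Ω.indicator χ z, ?_⟩
    filter_upwards [hae] with y hy hyb
    have hyΩ : y ∈ Ω := hx (Metric.ball_subset_closedBall (Metric.ball_subset_ball (by linarith) hyb))
    rw [← Set.indicator_of_mem hyΩ χ]
    refine tendsto_nhds_unique hy (hzt.congr' ?_)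
    filter_upwards [hconst] with n hn using hn z hz y hyb
  · refine ⟨0, ?_⟩
    filter_upwards [hae] with y hy hyb
    exact absurd ⟨y, hyb, hy⟩ hne

/-- If the values of an `H¹` function avoid an open interval, its smooth truncations across that
interval have vanishing weak derivatives. -/
theorem hasWeakPartial_comp_of_avoid (hΩ : IsOpen Ω) [IsFiniteMeasure (volume.restrict Ω)]
    {f : E d → ℝ} (hf : MemH1 Ω f) {θ : ℝ → ℝ} (hθ : ContDiff ℝ ∞ θ) {B C : ℝ}
    (hB : ∀ s, |θ s| ≤ B) (hC : ∀ s, |deriv θ s| ≤ C)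
    (h0 : ∀ᵐ x ∂(volume.restrict Ω), deriv θ (f x) = 0) (j : Fin d) :
    HasWeakPartial Ω j (fun x => θ (f x)) 0 := by
  have hm : MemLp (fun x => θ (f x)) ∞ (volume.restrict Ω) :=
    memLp_top_of_bound (hθ.continuous.comp_aestronglyMeasurable hf.1.1) B
      (Eventually.of_forall fun x => hB _)
  refine ⟨locallyIntegrableOn_of_memLp (by simp) hm, locallyIntegrableOn_zero, fun ψ hψ => ?_⟩
  set g := wd Ω j f with hg
  have hw := hf.hasWeakPartial j
  have hfi := integrable_indicator_of_memLp hΩ (by norm_num) hf.1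
  have hgi : Integrable (Ω.indicator g) := integrable_indicator_of_memLp hΩ (by norm_num) (hf.2 j).2
  have hg2i : Integrable (Ω.indicator fun y => g y ^ 2) :=
    (integrable_indicator_iff hΩ.measurableSet).2 (hf.2 j).2.integrable_sq
  set F : ℕ → E d → ℝ := fun n => mollify Ω (bumpSeq d n) f with hF
  set G : ℕ → E d → ℝ := fun n => mollify Ω (bumpSeq d n) g with hG
  have hFs : ∀ n, ContDiff ℝ ∞ (F n) := fun n => contDiff_mollify _ hfi
  have hGs : ∀ n, ContDiff ℝ ∞ (G n) := fun n => contDiff_mollify _ hgi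
  have hFae : ∀ᵐ x ∂(volume.restrict Ω), Tendsto (fun n => F n x) atTop (𝓝 (f x)) := by
    rw [ae_restrict_iff' hΩ.measurableSet]
    filter_upwards [ae_tendsto_mollify hfi] with x hx hxΩ
    simpa [Set.indicator_of_mem hxΩ] using hx
  have hθ' : Continuous (deriv θ) := hθ.continuous_deriv (by simp)
  -- the left-hand side is the limit of the mollified integrals
  have l1 : Tendsto (fun n => ∫ x in Ω, θ (F n x) * cpartial j ψ x) atTop
      (𝓝 (∫ x in Ω, θ (f x) * cpartial j ψ x)) := by
    refine tendsto_integral_of_dominated_convergence (fun x => B * |cpartial j ψ x|)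
      (fun n => ?_) ?_ (fun n => ?_) ?_
    · exact ((hθ.continuous.comp (hFs n).continuous).mul
        (hψ.cpartial j).1.continuous).aestronglyMeasurable
    · exact ((hψ.cpartial j).memLp 1 |>.integrable le_rfl).abs.const_mul _
    · refine Eventually.of_forall fun x => ?_
      rw [norm_mul]
      exact mul_le_mul_of_nonneg_right (hB _) (abs_nonneg _)
    · filter_upwards [hFae] with x hx
      exact ((hθ.continuous.tendsto _).comp hx).mul_const _
  -- integration by parts for the mollified functions
  obtain ⟨δ, hδ, hδK⟩ := hψ.2.1.exists_cthickening_subset_open hΩ hψ.2.2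
  have ibp : ∀ᶠ n in atTop, ∫ x in Ω, θ (F n x) * cpartial j ψ x
      = -∫ x in Ω, (deriv θ (F n x) * ψ x) * G n x := by
    filter_upwards [tendsto_bumpSeq_rOut.eventually (gt_mem_nhds hδ)] with n hn
    have hc : ContDiff ℝ ∞ fun x => θ (F n x) := hθ.comp (hFs n)
    have ht : IsTest Ω (fun x => θ (F n x) * ψ x) := IsTest.mul_left hc hψ
    have hz : ∫ x in Ω, cpartial j (fun x => θ (F n x) * ψ x) x = 0 := by
      rw [setIntegral_eq_of_tsupport (ht.cpartial j).2.2, integral_cpartial ht.1 ht.2.1]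
    have hpt : ∀ x, cpartial j (fun x => θ (F n x) * ψ x) x
        = (deriv θ (F n x) * ψ x) * G n x + θ (F n x) * cpartial j ψ x := by
      intro x
      rw [cpartial_mul hc hψ.1]
      -- Mollification commutes with the derivative only away from the boundary; off the support of
      -- ψ the term in question drops out.
      by_cases hxs : x ∈ tsupport ψ
      · have e1 : cpartial j (fun x => θ (F n x)) x = deriv θ (F n x) * cpartial j (F n) x := by
          have d1 : HasDerivAt θ (deriv θ (F n x)) (F n x) :=
            (hθ.differentiable (by simp) _).hasDerivAt
          have d2 := ((hFs n).differentiable (by simp) x).hasFDerivAt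
          have := (d1.comp_hasFDerivAt x d2).fderiv
          rw [cpartial]
          change fderiv ℝ (θ ∘ F n) x _ = _
          rw [this]; simp [cpartial]
        have e2 : cpartial j (F n) x = G n x := by
          refine cpartial_mollify hΩ _ hfi hw ?_
          exact ((Metric.closedBall_subset_closedBall hn.le).trans
            (Metric.closedBall_subset_cthickening hxs δ)).trans hδK
        rw [e1, e2]; ring
      · rw [image_eq_zero_of_notMem_tsupport hxs]; simp
    simp_rw [hpt] at hz
    have c1 : Integrable (fun x => deriv θ (F n x) * ψ x * G n x) (volume.restrict Ω) := by
      have hcont : Continuous fun x => (deriv θ (F n x) * G n x) * ψ x :=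
        ((hθ'.comp (hFs n).continuous).mul (hGs n).continuous).mul hψ.1.continuous
      have := (hcont.integrable_of_hasCompactSupport (μ := (volume : Measure (E d)))
        hψ.2.1.mul_left).restrict (s := Ω)
      refine this.congr (Eventually.of_forall fun x => ?_)
      simp only; ring
    have c2 : Integrable (fun x => θ (F n x) * cpartial j ψ x) (volume.restrict Ω) :=
      ((hc.continuous.mul (hψ.cpartial j).1.continuous).integrable_of_hasCompactSupport
        (hψ.cpartial j).2.1.mul_left).restrict
    rw [integral_add c1 c2] at hz
    linarith
  -- the right-hand side tends to zero
  have l2 : Tendsto (fun n => ∫ x in Ω, (deriv θ (F n x) * ψ x) ^ 2) atTop (𝓝 0) := by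
    have : ∫ x in Ω, (0 : ℝ) = 0 := by simp
    rw [← this]
    refine tendsto_integral_of_dominated_convergence (fun x => C ^ 2 * ψ x ^ 2)
      (fun n => ?_) ?_ (fun n => ?_) ?_
    · exact (((hθ'.comp (hFs n).continuous).mul hψ.1.continuous).pow 2).aestronglyMeasurable
    · exact (hψ.memLp 2).integrable_sq.const_mul _
    · refine Eventually.of_forall fun x => ?_
      rw [Real.norm_eq_abs, abs_of_nonneg (sq_nonneg _), mul_pow]
      exact mul_le_mul_of_nonneg_right (sq_le_sq' (by linarith [neg_abs_le (deriv θ (F n x)), hC (F n x)])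
        ((le_abs_self _).trans (hC _))) (sq_nonneg _)
    · filter_upwards [hFae, h0] with x hx hx0
      have := (((hθ'.tendsto _).comp hx).mul_const (ψ x)).pow 2
      simpa [hx0] using this
  have hGb : ∀ n, Integrable (fun x => G n x ^ 2) ∧ ∫ x, G n x ^ 2 ≤ ∫ x in Ω, g x ^ 2 := by
    intro n
    obtain ⟨m1, m2⟩ := integral_mollify (bumpSeq d n) hg2i
    have hle := mollify_sq_le (bumpSeq d n) hgi hg2i
    have hi : Integrable (fun x => G n x ^ 2) := m1.mono'
      ((hGs n).continuous.pow 2).aestronglyMeasurable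
      (Eventually.of_forall fun x => by
        rw [Real.norm_eq_abs, abs_of_nonneg (sq_nonneg _)]; exact hle x)
    refine ⟨hi, (integral_mono hi m1 hle).trans ?_⟩
    rw [m2, integral_indicator hΩ.measurableSet]
  have l3 : Tendsto (fun n => ∫ x in Ω, (deriv θ (F n x) * ψ x) * G n x) atTop (𝓝 0) := by
    rw [Metric.tendsto_atTop]
    intro ε hε
    set M := ∫ x in Ω, g x ^ 2
    have hM : 0 ≤ M := integral_nonneg fun x => sq_nonneg _
    -- The weight of Young's inequality: with s = ε/(M + 1) the bounded factor `G` contributes at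
    -- most ε/2, and the threshold εs/2 for the other factor contributes less than ε/4.
    have hs : 0 < ε / (M + 1) := by positivity
    have hε2 : 0 < ε * (ε / (M + 1)) / 2 := by positivity
    obtain ⟨n0, hn0⟩ := (l2.eventually (gt_mem_nhds hε2)).exists_forall_of_atTop
    refine ⟨n0, fun n hn => ?_⟩
    have hn1 := hn0 n hn
    have i1 : Integrable (fun x => (deriv θ (F n x) * ψ x) ^ 2) (volume.restrict Ω) := by
      refine ((hψ.memLp 2).integrable_sq.const_mul (C ^ 2)).mono'
        (((hθ'.comp (hFs n).continuous).mul hψ.1.continuous).pow 2).aestronglyMeasurable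
        (Eventually.of_forall fun x => ?_)
      rw [Real.norm_eq_abs, abs_of_nonneg (sq_nonneg _), mul_pow]
      exact mul_le_mul_of_nonneg_right (sq_le_sq' (by linarith [neg_abs_le (deriv θ (F n x)), hC (F n x)])
        ((le_abs_self _).trans (hC _))) (sq_nonneg _)
    have i2 : Integrable (fun x => G n x ^ 2) (volume.restrict Ω) := (hGb n).1.restrict
    have hG' : ∫ x in Ω, G n x ^ 2 ≤ M :=
      (setIntegral_le_integral (hGb n).1 (Eventually.of_forall fun x => sq_nonneg _)).trans
        (hGb n).2
    set s := ε / (M + 1) with hsdef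
    have hb : ‖∫ x in Ω, (deriv θ (F n x) * ψ x) * G n x‖
        ≤ ∫ x in Ω, (s⁻¹ / 2 * (deriv θ (F n x) * ψ x) ^ 2 + s / 2 * G n x ^ 2) := by
      refine norm_integral_le_of_norm_le ((i1.const_mul _).add (i2.const_mul _))
        (Eventually.of_forall fun x => ?_)
      rw [Real.norm_eq_abs]
      set a := deriv θ (F n x) * ψ x
      have hh : s⁻¹ / 2 * a ^ 2 + s / 2 * G n x ^ 2 - |a * G n x|
          = s⁻¹ / 2 * (|a| - s * |G n x|) ^ 2 := by
        rw [abs_mul, ← sq_abs a, ← sq_abs (G n x)]; field_simp; ring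
      have : 0 ≤ s⁻¹ / 2 * (|a| - s * |G n x|) ^ 2 := by positivity
      linarith
    rw [integral_add (i1.const_mul _) (i2.const_mul _), integral_const_mul,
      integral_const_mul] at hb
    rw [dist_zero_right]
    have e1 : s⁻¹ / 2 * ∫ x in Ω, (deriv θ (F n x) * ψ x) ^ 2 < s⁻¹ / 2 * (ε * s / 2) := by
      have : 0 < s⁻¹ / 2 := by positivity
      exact mul_lt_mul_of_pos_left hn1 this
    have e2 : s⁻¹ / 2 * (ε * s / 2) = ε / 4 := by field_simp; ring
    have e3 : s / 2 * ∫ x in Ω, G n x ^ 2 ≤ s / 2 * (M + 1) :=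
      mul_le_mul_of_nonneg_left (by linarith) (by positivity)
    have e4 : s / 2 * (M + 1) = ε / 2 := by rw [hsdef]; field_simp
    linarith
  have := tendsto_nhds_unique (l1.congr' ibp) l3.neg
  rw [this]; simp

/-- A smooth step across the gap, composed with f, has zero weak gradient, so it is locally constant
with value 0 or 1; connectedness of Ω leaves only one of the two values. -/
theorem ae_le_or_ae_ge_of_avoid (hΩ : IsOpen Ω) (hconn : IsConnected Ω)
    [IsFiniteMeasure (volume.restrict Ω)] {f : E d → ℝ} (hf : MemH1 Ω f) {a b : ℝ} (hab : a < b)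
    (h : ∀ᵐ x ∂(volume.restrict Ω), f x ≤ a ∨ b ≤ f x) :
    (∀ᵐ x ∂(volume.restrict Ω), f x ≤ a) ∨ ∀ᵐ x ∂(volume.restrict Ω), b ≤ f x := by
  -- The step is placed in the middle third of the gap, so θ is constant near every value that f
  -- takes, the end points included.
  set a' := a + (b - a) / 3 with ha'
  set b' := a + 2 * (b - a) / 3 with hb'
  have hab' : 0 < b' - a' := by rw [ha', hb']; linarith
  set θ : ℝ → ℝ := fun s => Real.smoothTransition ((s - a') / (b' - a')) with hθdef
  have hθ : ContDiff ℝ ∞ θ :=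
    Real.smoothTransition.contDiff.comp ((contDiff_id.sub contDiff_const).div_const _)
  have hθ0 : ∀ s, s ≤ a' → θ s = 0 := fun s hs =>
    Real.smoothTransition.zero_of_nonpos (div_nonpos_of_nonpos_of_nonneg (by linarith) hab'.le)
  have hθ1 : ∀ s, b' ≤ s → θ s = 1 := fun s hs =>
    Real.smoothTransition.one_of_one_le ((one_le_div hab').2 (by linarith))
  have hB : ∀ s, |θ s| ≤ 1 := fun s => by
    rw [abs_of_nonneg (Real.smoothTransition.nonneg _)]; exact Real.smoothTransition.le_one _
  have hd0 : ∀ s, s < a' → deriv θ s = 0 := by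
    intro s hs
    have : θ =ᶠ[𝓝 s] fun _ => 0 := by
      filter_upwards [gt_mem_nhds hs] with t ht using hθ0 t ht.le
    rw [this.deriv_eq]; simp
  have hd1 : ∀ s, b' < s → deriv θ s = 0 := by
    intro s hs
    have : θ =ᶠ[𝓝 s] fun _ => 1 := by
      filter_upwards [lt_mem_nhds hs] with t ht using hθ1 t ht.le
    rw [this.deriv_eq]; simp
  obtain ⟨C, hC⟩ : ∃ C, ∀ s, |deriv θ s| ≤ C := by
    obtain ⟨C, hC⟩ := (isCompact_Icc (a := a') (b := b')).exists_bound_of_continuousOn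
      (hθ.continuous_deriv (by simp)).continuousOn
    refine ⟨max C 0, fun s => ?_⟩
    by_cases h1 : s < a'
    · simp [hd0 s h1]
    by_cases h2 : b' < s
    · simp [hd1 s h2]
    exact (hC s ⟨not_lt.1 h1, not_lt.1 h2⟩).trans (le_max_left _ _)
  have hw := hasWeakPartial_comp_of_avoid hΩ hf hθ hB hC (by
    filter_upwards [h] with x hx
    rcases hx with hx | hx
    · exact hd0 _ (by rw [ha']; linarith)
    · exact hd1 _ (by rw [hb']; linarith))
  have hm : MemLp (fun x => θ (f x)) ∞ (volume.restrict Ω) :=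
    memLp_top_of_bound (hθ.continuous.comp_aestronglyMeasurable hf.1.1) 1
      (Eventually.of_forall fun x => hB _)
  have hχi := integrable_indicator_of_memLp hΩ (by simp) hm
  -- Points near which the step of f equals c almost everywhere. These sets are open by
  -- construction, and U 0, U 1 cannot meet because balls have positive measure.
  set U : ℝ → Set (E d) := fun c => {x | ∃ r > 0, ∀ᵐ y, y ∈ Metric.ball x r → θ (f y) = c}
  have hUo : ∀ c, IsOpen (U c) := by
    intro c
    rw [Metric.isOpen_iff]
    rintro x ⟨r, hr, hx⟩
    refine ⟨r / 2, by positivity, fun z hz => ⟨r / 2, by positivity, ?_⟩⟩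
    filter_upwards [hx] with y hy hyz
    refine hy ?_
    have h1 := Metric.mem_ball.1 hz
    have h2 := Metric.mem_ball.1 hyz
    exact Metric.mem_ball.2 ((dist_triangle y z x).trans_lt (by linarith))
  rw [ae_restrict_iff' hΩ.measurableSet] at h
  have hnull : ∀ (P : E d → Prop), (∀ᵐ y, P y) → ∀ (x : E d) (r : ℝ), 0 < r →
      ∃ y, y ∈ Metric.ball x r ∧ P y := by
    intro P hP x r hr
    by_contra hcon
    push Not at hcon
    have : volume (Metric.ball x r) = 0 :=
      measure_mono_null (fun y hy => hcon y hy) (ae_iff.1 hP)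
    exact (Metric.measure_ball_pos volume x hr).ne' this
  have hcover : Ω ⊆ U 0 ∪ U 1 := by
    intro x hx
    obtain ⟨r, hr, hrx⟩ := Metric.isOpen_iff.1 hΩ x hx
    have hsub : Metric.closedBall x (2 * (r / 4)) ⊆ Ω :=
      (Metric.closedBall_subset_ball (by linarith)).trans hrx
    obtain ⟨c, hc⟩ := ae_eq_const_near hΩ hχi hw (by positivity : 0 < r / 4) hsub
    obtain ⟨y, hyb, hy1, hy2⟩ := hnull _ (hc.and h) x (r / 4) (by positivity)
    have hyΩ : y ∈ Ω := hrx (Metric.ball_subset_ball (by linarith) hyb)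
    have hcy := hy1 hyb
    rcases hy2 hyΩ with h1 | h1
    · left
      rw [hθ0 _ (by rw [ha']; linarith)] at hcy
      exact ⟨r / 4, by positivity, by rwa [← hcy] at hc⟩
    · right
      rw [hθ1 _ (by rw [hb']; linarith)] at hcy
      exact ⟨r / 4, by positivity, by rwa [← hcy] at hc⟩
  have hdisj : Ω ∩ (U 0 ∩ U 1) = ∅ := by
    rw [Set.eq_empty_iff_forall_notMem]
    rintro x ⟨-, ⟨r, hr, h1⟩, ⟨s, hs, h2⟩⟩
    obtain ⟨y, hyb, hy1, hy2⟩ := hnull _ (h1.and h2) x (min r s) (lt_min hr hs)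
    have e1 := hy1 (Metric.ball_subset_ball (min_le_left _ _) hyb)
    have e2 := hy2 (Metric.ball_subset_ball (min_le_right _ _) hyb)
    rw [e1] at e2; norm_num at e2
  have hae : ∀ c, Ω ⊆ U c → ∀ᵐ x ∂(volume.restrict Ω), θ (f x) = c := by
    intro c hc
    rw [ae_restrict_iff' hΩ.measurableSet, ae_iff]
    refine measure_null_of_locally_null _ fun x hx => ?_
    obtain ⟨r, hr, hxr⟩ := hc (Classical.not_imp.1 hx).1
    refine ⟨_, inter_mem_nhdsWithin _ (Metric.ball_mem_nhds x hr), ?_⟩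
    refine measure_mono_null ?_ (ae_iff.1 hxr)
    rintro y ⟨hy1, hy2⟩ hy3
    exact (Classical.not_imp.1 hy1).2 (hy3 hy2)
  have hθ01 : ∀ x, (f x ≤ a ∨ b ≤ f x) → (θ (f x) = 0 → f x ≤ a) ∧ (θ (f x) = 1 → b ≤ f x) := by
    intro x hx
    rcases hx with hx | hx
    · refine ⟨fun _ => hx, fun h1 => ?_⟩
      rw [hθ0 _ (by rw [ha']; linarith)] at h1; norm_num at h1
    · refine ⟨fun h1 => ?_, fun _ => hx⟩
      rw [hθ1 _ (by rw [hb']; linarith)] at h1; norm_num at h1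
  have hor : Ω ⊆ U 0 ∨ Ω ⊆ U 1 := by
    rcases isPreconnected_iff_subset_of_disjoint.1 hconn.isPreconnected (U 0) (U 1) (hUo 0) (hUo 1)
      hcover hdisj with h1 | h1
    · exact Or.inl h1
    · exact Or.inr h1
  have h' : ∀ᵐ x ∂(volume.restrict Ω), f x ≤ a ∨ b ≤ f x := by
    rwa [ae_restrict_iff' hΩ.measurableSet]
  rcases hor with h1 | h1
  · left
    filter_upwards [hae 0 h1, h'] with x hx1 hx2 using (hθ01 x hx2).1 hx1
  · right
    filter_upwards [hae 1 h1, h'] with x hx1 hx2 using (hθ01 x hx2).2 hx1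

end

section

variable {d : ℕ} {Ω : Set (E d)}

/-! ### Bounded functions and the parameters of the scheme -/

theorem ae_abs_le_linf {f : E d → ℝ} (hf : MemLp f ∞ (volume.restrict Ω)) :
    ∀ᵐ x ∂(volume.restrict Ω), |f x| ≤ linf Ω f := by
  have h1 : eLpNormEssSup f (volume.restrict Ω) ≠ ⊤ := by
    have := hf.2.ne; rwa [eLpNorm_exponent_top] at this
  filter_upwards [ae_le_eLpNormEssSup (f := f) (μ := volume.restrict Ω)] with x hx
  rw [linf, eLpNorm_exponent_top, ← Real.norm_eq_abs, ← toReal_enorm]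
  exact ENNReal.toReal_mono h1 hx

theorem restrict_ne_zero (hΩ : IsOpen Ω) (hne : Ω.Nonempty) : (volume.restrict Ω) ≠ 0 := by
  rw [Ne, Measure.restrict_eq_zero]
  exact (hΩ.measure_pos volume hne).ne'

section EssRange

variable {f : E d → ℝ}

theorem isBoundedUnder_le_of_memLp_top (hf : MemLp f ∞ (volume.restrict Ω)) :
    IsBoundedUnder (· ≤ ·) (ae (volume.restrict Ω)) f :=
  ⟨linf Ω f, eventually_map.2 ((ae_abs_le_linf hf).mono fun _ h => (le_abs_self _).trans h)⟩

theorem isBoundedUnder_ge_of_memLp_top (hf : MemLp f ∞ (volume.restrict Ω)) :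
    IsBoundedUnder (· ≥ ·) (ae (volume.restrict Ω)) f :=
  ⟨-linf Ω f, eventually_map.2 ((ae_abs_le_linf hf).mono fun _ h => (abs_le.1 h).1)⟩

theorem ae_rhoMin_le (hf : MemLp f ∞ (volume.restrict Ω)) :
    ∀ᵐ x ∂(volume.restrict Ω), rhoMin Ω f ≤ f x :=
  ae_essInf_le (isBoundedUnder_ge_of_memLp_top hf)

theorem ae_le_rhoMax (hf : MemLp f ∞ (volume.restrict Ω)) :
    ∀ᵐ x ∂(volume.restrict Ω), f x ≤ rhoMax Ω f :=
  ae_le_essSup (isBoundedUnder_le_of_memLp_top hf)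

theorem le_rhoMin (hμ : (volume.restrict Ω) ≠ 0) (hf : MemLp f ∞ (volume.restrict Ω)) {c : ℝ}
    (h : ∀ᵐ x ∂(volume.restrict Ω), c ≤ f x) : c ≤ rhoMin Ω f := by
  have := ae_neBot.2 hμ
  exact le_essInf_of_ae_le c h (isBoundedUnder_le_of_memLp_top hf).isCoboundedUnder_ge

theorem rhoMax_le (hμ : (volume.restrict Ω) ≠ 0) (hf : MemLp f ∞ (volume.restrict Ω)) {c : ℝ}
    (h : ∀ᵐ x ∂(volume.restrict Ω), f x ≤ c) : rhoMax Ω f ≤ c := by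
  have := ae_neBot.2 hμ
  exact essSup_le_of_ae_le c h (isBoundedUnder_ge_of_memLp_top hf).isCoboundedUnder_le

theorem rhoMin_le_rhoMax (hμ : (volume.restrict Ω) ≠ 0) (hf : MemLp f ∞ (volume.restrict Ω)) :
    rhoMin Ω f ≤ rhoMax Ω f := by
  have := ae_neBot.2 hμ
  obtain ⟨x, h1, h2⟩ := ((ae_rhoMin_le hf).and (ae_le_rhoMax hf)).exists
  exact h1.trans h2

/-- Every value between the essential infimum and supremum of an `H¹` function on a connected set
is an essential value. -/
theorem frequently_abs_sub_lt (hΩ : IsOpen Ω) (hconn : IsConnected Ω)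
    [IsFiniteMeasure (volume.restrict Ω)] (hf : MemLp f ∞ (volume.restrict Ω)) (hH : MemH1 Ω f)
    {s : ℝ} (hs : s ∈ Icc (rhoMin Ω f) (rhoMax Ω f)) {δ : ℝ} (hδ : 0 < δ) :
    ∃ᶠ x in ae (volume.restrict Ω), |f x - s| < δ := by
  intro hcon
  have hμ := restrict_ne_zero hΩ hconn.nonempty
  have h : ∀ᵐ x ∂(volume.restrict Ω), f x ≤ s - δ ∨ s + δ ≤ f x := by
    filter_upwards [hcon] with x hx
    by_contra h'
    push Not at h'
    exact hx (abs_lt.2 ⟨by linarith, by linarith⟩)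
  rcases ae_le_or_ae_ge_of_avoid hΩ hconn hH (by linarith) h with h' | h'
  · have := rhoMax_le hμ hf h'
    linarith [hs.2]
  · have := le_rhoMin hμ hf h'
    linarith [hs.1]

/-- The bound `ν̄ s ≥ 1.1 η(s)`, for all `s` between the bounds of the density. -/
theorem eta_le_nuBar_mul (hΩ : IsOpen Ω) (hconn : IsConnected Ω)
    [IsFiniteMeasure (volume.restrict Ω)] (hf : MemLp f ∞ (volume.restrict Ω)) (hH : MemH1 Ω f)
    {η : ℝ → ℝ} (hη : Continuous η) (hpos : 0 < rhoMin Ω f)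
    {s : ℝ} (hs : s ∈ Icc (rhoMin Ω f) (rhoMax Ω f)) :
    11 / 10 * η s ≤ nuBar Ω η f * s := by
  have hs0 : 0 < s := hpos.trans_le hs.1
  obtain ⟨B, hB⟩ := (isCompact_Icc (a := rhoMin Ω f) (b := rhoMax Ω f)).exists_bound_of_continuousOn
    (f := fun s => η s / s) (hη.continuousOn.div continuousOn_id fun t ht => (hpos.trans_le ht.1).ne')
  have hm : MemLp (fun x => η (f x) / f x) ∞ (volume.restrict Ω) := by
    refine memLp_top_of_bound ((hη.comp_aestronglyMeasurable hf.1).aemeasurable.div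
      hf.1.aemeasurable).aestronglyMeasurable B ?_
    filter_upwards [ae_rhoMin_le hf, ae_le_rhoMax hf] with x h1 h2 using hB _ ⟨h1, h2⟩
  have hle := ae_abs_le_linf hm
  set L := linf Ω fun x => η (f x) / f x with hL
  -- The essential bound holds at almost every value of f. If it failed at s it would fail near s by
  -- continuity, hence on a set of positive measure, since s is an essential value.
  have key : η s / s ≤ L := by
    by_contra hcon
    push Not at hcon
    have hc : ContinuousAt (fun t => η t / t) s := hη.continuousAt.div continuousAt_id hs0.ne'
    obtain ⟨δ, hδ, hδ'⟩ := Metric.mem_nhds_iff.1 (hc.eventually (lt_mem_nhds hcon))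
    obtain ⟨x, hx1, hx2⟩ := ((frequently_abs_sub_lt hΩ hconn hf hH hs hδ).and_eventually hle).exists
    have h3 : L < η (f x) / f x := hδ' (by rw [Metric.mem_ball, Real.dist_eq]; exact hx1)
    linarith [le_abs_self (η (f x) / f x)]
  rw [div_le_iff₀ hs0] at key
  rw [nuBar, ← hL]; linarith

/-- Unlike η(s)/s, the quotient 1/s is decreasing, so its bound at ρ_min suffices and connectedness
plays no role. -/
theorem le_lamBar_mul (hμ : (volume.restrict Ω) ≠ 0) (hf : MemLp f ∞ (volume.restrict Ω))
    (hpos : 0 < rhoMin Ω f) {lam : ℝ} (hlam : 0 < lam) {s : ℝ} (hs : rhoMin Ω f ≤ s) :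
    11 / 10 * lam ≤ lamBar Ω lam f * s := by
  have := ae_neBot.2 hμ
  have hm : MemLp (fun x => 1 / f x) ∞ (volume.restrict Ω) := by
    refine memLp_top_of_bound (aemeasurable_const.div
      hf.1.aemeasurable).aestronglyMeasurable (1 / rhoMin Ω f) ?_
    filter_upwards [ae_rhoMin_le hf] with x h1
    have h2 := hpos.trans_le h1
    rw [Real.norm_eq_abs, abs_of_nonneg (by positivity)]
    exact one_div_le_one_div_of_le hpos h1
  have hle := ae_abs_le_linf hm
  set L := linf Ω fun x => 1 / f x with hL
  have hL0 : 0 < L := by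
    obtain ⟨x, h1, h2⟩ := (hle.and (ae_rhoMin_le hf)).exists
    have h3 := hpos.trans_le h2
    exact (show 0 < 1 / f x by positivity).trans_le ((le_abs_self _).trans h1)
  have h1 : 1 / L ≤ rhoMin Ω f := by
    refine le_rhoMin hμ hf ?_
    filter_upwards [hle, ae_rhoMin_le hf] with x h2 h3
    have h4 := hpos.trans_le h3
    rw [div_le_iff₀ hL0]
    have h5 := (le_abs_self _).trans h2
    rw [div_le_iff₀ h4] at h5; linarith
  have h2 : 1 ≤ L * s := by
    rw [div_le_iff₀ hL0] at h1
    nlinarith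
  have h3 : 11 / 10 * lam * 1 ≤ 11 / 10 * lam * (L * s) :=
    mul_le_mul_of_nonneg_left h2 (by positivity)
  rw [lamBar, ← hL]; linarith

theorem lamBar_pos (hμ : (volume.restrict Ω) ≠ 0) (hf : MemLp f ∞ (volume.restrict Ω))
    (hpos : 0 < rhoMin Ω f) {lam : ℝ} (hlam : 0 < lam) : 0 < lamBar Ω lam f := by
  have := le_lamBar_mul hμ hf hpos hlam le_rfl
  by_contra hcon
  push Not at hcon
  nlinarith

theorem nuBar_nonneg (η : ℝ → ℝ) : 0 ≤ nuBar Ω η f := by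
  rw [nuBar, linf]; positivity

theorem exists_eta_bounds {η : ℝ → ℝ} (hη : Continuous η) {a b : ℝ} (hab : a ≤ b)
    (hpos : ∀ s ∈ Icc a b, 0 < η s) :
    ∃ m M, 0 < m ∧ ∀ s ∈ Icc a b, m ≤ η s ∧ η s ≤ M := by
  obtain ⟨s, hs, hmin⟩ := isCompact_Icc.exists_isMinOn (nonempty_Icc.2 hab) hη.continuousOn
  obtain ⟨t, ht, hmax⟩ := isCompact_Icc.exists_isMaxOn (nonempty_Icc.2 hab) hη.continuousOn
  exact ⟨η s, η t, hpos s hs, fun r hr => ⟨hmin hr, hmax hr⟩⟩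

end EssRange

/-! ### Elements of `L^∞` -/

theorem ae_norm_le {F : Type} [NormedAddCommGroup F] (f : LpΩ F ∞ Ω) :
    ∀ᵐ x ∂(volume.restrict Ω), ‖f x‖ ≤ ‖f‖ := by
  have h1 : eLpNormEssSup f (volume.restrict Ω) ≠ ⊤ := by
    have := (Lp.memLp f).2.ne; rwa [eLpNorm_exponent_top] at this
  filter_upwards [ae_le_eLpNormEssSup (f := f) (μ := volume.restrict Ω)] with x hx
  rw [Lp.norm_def, eLpNorm_exponent_top, ← toReal_enorm]
  exact ENNReal.toReal_mono h1 hx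

theorem ae_norm_sub_le {F : Type} [NormedAddCommGroup F] (f g : LpΩ F ∞ Ω) :
    ∀ᵐ x ∂(volume.restrict Ω), ‖f x - g x‖ ≤ ‖f - g‖ := by
  filter_upwards [ae_norm_le (f - g), Lp.coeFn_sub f g] with x h1 h2
  rwa [h2] at h1

end

section

variable {d : ℕ} {Ω : Set (E d)}

/-! ### Integrability of vector and matrix valued expressions -/

/-- The components of a matrix field are in `L^p`. -/
def MatLp (Ω : Set (E d)) (p : ℝ≥0∞) (A : E d → Matrix (Fin d) (Fin d) ℝ) : Prop :=
  ∀ i j, MemLp (fun x => A x i j) p (volume.restrict Ω)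

theorem inner_eq_sum (a b : E d) : inner ℝ a b = ∑ i, a i * b i := by
  rw [PiLp.inner_apply]; exact Finset.sum_congr rfl fun i _ => by simp [mul_comm]

section Lp

variable {p q r : ℝ≥0∞}

theorem memLp_inner [ENNReal.HolderTriple p q r] {a b : E d → E d}
    (ha : MemLp a p (volume.restrict Ω)) (hb : MemLp b q (volume.restrict Ω)) :
    MemLp (fun x => inner ℝ (a x) (b x)) r (volume.restrict Ω) := by
  simp_rw [inner_eq_sum]
  exact memLp_finsetSum _ fun i _ => memLp_mul (ha.eval_piLp i) (hb.eval_piLp i)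

theorem integrable_inner {a b : E d → E d}
    (ha : MemLp a 2 (volume.restrict Ω)) (hb : MemLp b 2 (volume.restrict Ω)) :
    Integrable (fun x => inner ℝ (a x) (b x)) (volume.restrict Ω) :=
  memLp_one_iff_integrable.1 (memLp_inner ha hb)

theorem MatLp.ddot [ENNReal.HolderTriple p q r] {A B : E d → Matrix (Fin d) (Fin d) ℝ}
    (hA : MatLp Ω p A) (hB : MatLp Ω q B) :
    MemLp (fun x => ACM.ddot (A x) (B x)) r (volume.restrict Ω) :=
  memLp_finsetSum _ fun i _ => memLp_finsetSum _ fun j _ => memLp_mul (hA i j) (hB i j)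

theorem MatLp.integrable_ddot {A B : E d → Matrix (Fin d) (Fin d) ℝ}
    (hA : MatLp Ω 2 A) (hB : MatLp Ω 2 B) :
    Integrable (fun x => ACM.ddot (A x) (B x)) (volume.restrict Ω) :=
  memLp_one_iff_integrable.1 (hA.ddot hB)

theorem MatLp.tens [ENNReal.HolderTriple p q r] {a b : E d → E d}
    (ha : MemLp a p (volume.restrict Ω)) (hb : MemLp b q (volume.restrict Ω)) :
    MatLp Ω r (fun x => ACM.tens (a x) (b x)) := fun i j => by
  simp only [ACM.tens, Matrix.vecMulVec_apply]
  exact memLp_mul (ha.eval_piLp i) (hb.eval_piLp j)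

theorem MatLp.trace {A : E d → Matrix (Fin d) (Fin d) ℝ}
    (hA : MatLp Ω p A) : MemLp (fun x => (A x).trace) p (volume.restrict Ω) :=
  memLp_finsetSum _ fun i _ => hA i i

theorem MatLp.sub {A B : E d → Matrix (Fin d) (Fin d) ℝ}
    (hA : MatLp Ω p A) (hB : MatLp Ω p B) : MatLp Ω p (fun x => A x - B x) :=
  fun i j => (hA i j).sub (hB i j)

theorem MatLp.add {A B : E d → Matrix (Fin d) (Fin d) ℝ}
    (hA : MatLp Ω p A) (hB : MatLp Ω p B) : MatLp Ω p (fun x => A x + B x) :=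
  fun i j => (hA i j).add (hB i j)

theorem MatLp.smul [ENNReal.HolderTriple p q r] {c : E d → ℝ}
    {A : E d → Matrix (Fin d) (Fin d) ℝ} (hc : MemLp c p (volume.restrict Ω))
    (hA : MatLp Ω q A) : MatLp Ω r (fun x => c x • A x) :=
  fun i j => memLp_mul hc (hA i j)

theorem MatLp.congr {A B : E d → Matrix (Fin d) (Fin d) ℝ}
    (hA : MatLp Ω p A) (h : ∀ᵐ x ∂(volume.restrict Ω), A x = B x) : MatLp Ω p B :=
  fun i j => (memLp_congr_ae (h.mono fun x hx => by rw [hx])).1 (hA i j)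

/-- The symmetric part of a matrix. -/
noncomputable def msym (A : Matrix (Fin d) (Fin d) ℝ) : Matrix (Fin d) (Fin d) ℝ :=
  (1 / 2 : ℝ) • (A + A.transpose)

theorem strain_eq_msym (Ω : Set (E d)) (v : E d → E d) (x : E d) :
    strain Ω v x = msym (jac Ω v x) := rfl

theorem dvg_eq_trace (Ω : Set (E d)) (v : E d → E d) (x : E d) :
    dvg Ω v x = (jac Ω v x).trace := rfl

theorem msym_apply (A : Matrix (Fin d) (Fin d) ℝ) (i j : Fin d) :
    msym A i j = 1 / 2 * (A i j + A j i) := by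
  simp [msym]

theorem MatLp.msym {A : E d → Matrix (Fin d) (Fin d) ℝ}
    (hA : MatLp Ω p A) : MatLp Ω p (fun x => ACM.msym (A x)) := fun i j => by
  simp only [msym_apply]
  exact ((hA i j).add (hA j i)).const_mul _

end Lp

theorem MemH10v.memLp {v : E d → E d} (hv : MemH10v Ω v) : MemLp v 2 (volume.restrict Ω) :=
  MemLp.of_eval_piLp fun i => (hv i).1.1

theorem MemH10v.memLp_four (hd : d = 2 ∨ d = 3) (hb : Bornology.IsBounded Ω)
    [IsFiniteMeasure (volume.restrict Ω)] {v : E d → E d} (hv : MemH10v Ω v) :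
    MemLp v 4 (volume.restrict Ω) :=
  MemLp.of_eval_piLp fun i => (hv i).memLp_four hd hb

theorem MemH10v.jac {v : E d → E d} (hv : MemH10v Ω v) : MatLp Ω 2 (ACM.jac Ω v) :=
  fun i j => ((hv i).1.2 j).2

theorem MemH10v.strain {v : E d → E d} (hv : MemH10v Ω v) : MatLp Ω 2 (ACM.strain Ω v) :=
  hv.jac.msym

theorem MemH10v.dvg {v : E d → E d} (hv : MemH10v Ω v) :
    MemLp (ACM.dvg Ω v) 2 (volume.restrict Ω) := hv.jac.trace

theorem MemH10v.sub (hΩ : IsOpen Ω) {v w : E d → E d} (hv : MemH10v Ω v) (hw : MemH10v Ω w) :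
    MemH10v Ω (fun x => v x - w x) := fun i => (hv i).sub hΩ (hw i)

theorem MemH10v.jac_sub (hΩ : IsOpen Ω) {v w : E d → E d} (hv : MemH10v Ω v) (hw : MemH10v Ω w) :
    ∀ᵐ x ∂(volume.restrict Ω),
      ACM.jac Ω (fun y => v y - w y) x = ACM.jac Ω v x - ACM.jac Ω w x := by
  have h : ∀ i j, ∀ᵐ x ∂(volume.restrict Ω),
      wd Ω j (fun y => v y i - w y i) x = wd Ω j (fun y => v y i) x - wd Ω j (fun y => w y i) x :=
    fun i j => wd_sub hΩ (hv i).1 (hw i).1 j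
  have h' := eventually_all.2 fun i => eventually_all.2 fun j => h i j
  filter_upwards [h'] with x hx
  ext i j
  exact hx i j

/-! ### Functions that are Lipschitz in time, with values in `L^∞` -/

/-- `a` is bounded, and Lipschitz in time, with values in `L^∞(Ω)`. -/
structure TimeLip (Ω : Set (E d)) (T : ℝ) (a : ℝ → E d → ℝ) (K : ℝ) : Prop where
  meas : ∀ t ∈ Icc 0 T, AEStronglyMeasurable (a t) (volume.restrict Ω)
  bound : ∀ t ∈ Icc 0 T, ∀ᵐ x ∂(volume.restrict Ω), |a t x| ≤ K
  lip : ∀ s ∈ Icc 0 T, ∀ t ∈ Icc 0 T, ∀ᵐ x ∂(volume.restrict Ω), |a t x - a s x| ≤ K * |t - s|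

variable {T : ℝ}

theorem TimeLip.memLp {a : ℝ → E d → ℝ} {K : ℝ} (ha : TimeLip Ω T a K) {t : ℝ}
    (ht : t ∈ Icc 0 T) : MemLp (a t) ∞ (volume.restrict Ω) :=
  memLp_top_of_bound (ha.meas t ht) K (ha.bound t ht)

theorem TimeLip.mul {a b : ℝ → E d → ℝ} {K L : ℝ} (hK : 0 ≤ K) (hL : 0 ≤ L)
    (ha : TimeLip Ω T a K) (hb : TimeLip Ω T b L) :
    TimeLip Ω T (fun t x => a t x * b t x) (2 * K * L) where
  meas t ht := (ha.meas t ht).mul (hb.meas t ht)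
  bound t ht := by
    filter_upwards [ha.bound t ht, hb.bound t ht] with x h1 h2
    rw [abs_mul]
    have := mul_le_mul h1 h2 (abs_nonneg _) hK
    nlinarith [mul_nonneg hK hL]
  lip s hs t ht := by
    filter_upwards [ha.lip s hs t ht, hb.lip s hs t ht, ha.bound t ht, hb.bound s hs]
      with x h1 h2 h3 h4
    have e : a t x * b t x - a s x * b s x = (a t x - a s x) * b s x + a t x * (b t x - b s x) := by
      ring
    rw [e]
    refine (abs_add_le _ _).trans ?_
    rw [abs_mul, abs_mul]
    have h5 := mul_le_mul h1 h4 (abs_nonneg _) (by positivity)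
    have h6 := mul_le_mul h3 h2 (abs_nonneg _) hK
    linarith

/-- Integrals against a fixed integrable function depend continuously on time. -/
theorem TimeLip.continuousOn_integral {a : ℝ → E d → ℝ} {K : ℝ} (ha : TimeLip Ω T a K)
    {b : E d → ℝ} (hb : Integrable b (volume.restrict Ω)) :
    ContinuousOn (fun t => ∫ x in Ω, a t x * b x) (Icc 0 T) := by
  have hi : ∀ t ∈ Icc 0 T, Integrable (fun x => a t x * b x) (volume.restrict Ω) := fun t ht =>
    hb.bdd_mul (ha.meas t ht) (ha.bound t ht)
  set M := ∫ x in Ω, |b x|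
  have hlip : LipschitzOnWith (Real.toNNReal (|K| * M)) (fun t => ∫ x in Ω, a t x * b x)
      (Icc 0 T) := by
    refine LipschitzOnWith.of_dist_le_mul fun t ht s hs => ?_
    have hM : 0 ≤ M := integral_nonneg fun x => abs_nonneg _
    rw [Real.coe_toNNReal _ (by positivity), Real.dist_eq, Real.dist_eq,
      ← integral_sub (hi t ht) (hi s hs), ← Real.norm_eq_abs]
    have : |K| * M * |t - s| = ∫ x in Ω, (|K| * |t - s|) * |b x| := by
      rw [integral_const_mul]; ring
    rw [this]
    refine norm_integral_le_of_norm_le (hb.abs.const_mul _) ?_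
    filter_upwards [ha.lip s hs t ht] with x hx
    rw [← sub_mul, norm_mul]
    refine mul_le_mul_of_nonneg_right (hx.trans ?_) (abs_nonneg _)
    exact mul_le_mul_of_nonneg_right (le_abs_self _) (abs_nonneg _)
  exact hlip.continuousOn

/-- Weak continuity of the weak derivatives of a Lipschitz function of time, as long as they are
bounded. -/
theorem continuousOn_integral_wd [IsFiniteMeasure (volume.restrict Ω)]
    {u : ℝ → E d → ℝ} {K : ℝ} (hu : TimeLip Ω T u K) (hH : ∀ t ∈ Icc 0 T, MemH10 Ω (u t))
    (j : Fin d) (hj : ∀ t ∈ Icc 0 T, ∀ᵐ x ∂(volume.restrict Ω), |wd Ω j (u t) x| ≤ K)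
    {h : E d → ℝ} (hh : Integrable h (volume.restrict Ω)) :
    ContinuousOn (fun t => ∫ x in Ω, wd Ω j (u t) x * h x) (Icc 0 T) := by
  have hi : ∀ (g : E d → ℝ), Integrable g (volume.restrict Ω) → ∀ t ∈ Icc 0 T,
      Integrable (fun x => wd Ω j (u t) x * g x) (volume.restrict Ω) := fun g hg t ht =>
    hg.bdd_mul ((hH t ht).1.2 j).2.1 (hj t ht)
  -- approximate by smooth functions
  have happ : ∀ ε : ℝ, 0 < ε → ∃ ψ : E d → ℝ, HasCompactSupport ψ ∧ ContDiff ℝ ∞ ψ ∧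
      ∫ x in Ω, |h x - ψ x| ≤ ε := by
    intro ε hε
    obtain ⟨ψ, h1, h2, h3⟩ := (memLp_one_iff_integrable.2 hh).exist_eLpNorm_sub_le
      (by simp) le_rfl hε
    refine ⟨ψ, h1, h2, ?_⟩
    have hm : Integrable (h - ψ) (volume.restrict Ω) :=
      hh.sub ((memLp_of_smooth h2 h1 1).integrable le_rfl)
    rw [eLpNorm_one_eq_lintegral_enorm] at h3
    have := integral_norm_eq_lintegral_enorm hm.1
    simp only [Pi.sub_apply, Real.norm_eq_abs] at this h3 ⊢
    rw [this]
    exact ENNReal.toReal_le_of_le_ofReal hε.le h3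
  intro t ht
  rw [Metric.continuousWithinAt_iff]
  intro ε hε
  have hK1 : 0 < |K| + 1 := by positivity
  obtain ⟨ψ, h1, h2, h3⟩ := happ (ε / (4 * (|K| + 1))) (by positivity)
  have hψi : Integrable ψ (volume.restrict Ω) := (memLp_of_smooth h2 h1 1).integrable le_rfl
  -- Integration by parts moves the derivative to ψ, so only the Lipschitz continuity of u itself is
  -- used; ψ may be non-zero at the boundary because u(s) is in H¹₀.
  have hcont : ContinuousOn (fun s => ∫ x in Ω, wd Ω j (u s) x * ψ x) (Icc 0 T) := by
    refine (hu.continuousOn_integral (b := cpartial j ψ) ((memLp_of_smooth (contDiff_cpartial h2 j)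
      (hasCompactSupport_cpartial h1 j) 1).integrable le_rfl)).neg.congr fun s hs => ?_
    exact (hH s hs).integral_mul_smooth h2 h1 j
  obtain ⟨δ, hδ, hδ'⟩ := Metric.continuousWithinAt_iff.1 (hcont t ht) (ε / 2) (by positivity)
  refine ⟨δ, hδ, fun s hs hst => ?_⟩
  have h4 := hδ' hs hst
  have hdiff : ∀ r ∈ Icc 0 T,
      |(∫ x in Ω, wd Ω j (u r) x * h x) - ∫ x in Ω, wd Ω j (u r) x * ψ x| ≤ ε / 4 := by
    intro r hr
    rw [← integral_sub (hi h hh r hr) (hi ψ hψi r hr), ← Real.norm_eq_abs]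
    have e1 : (|K| + 1) * ∫ x in Ω, |h x - ψ x| ≤ ε / 4 := by
      refine (mul_le_mul_of_nonneg_left h3 hK1.le).trans (le_of_eq ?_)
      field_simp
    refine le_trans ?_ e1
    rw [← integral_const_mul]
    refine norm_integral_le_of_norm_le ((hh.sub hψi).abs.const_mul _) ?_
    filter_upwards [hj r hr] with x hx
    rw [← mul_sub, norm_mul]
    refine mul_le_mul_of_nonneg_right ?_ (abs_nonneg _)
    rw [Real.norm_eq_abs]; linarith [le_abs_self K]
  have h5 := hdiff s hs
  have h6 := hdiff t ht
  rw [Real.dist_eq] at h4 ⊢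
  rw [abs_le] at h5 h6
  rw [abs_lt] at h4 ⊢
  constructor <;> linarith

/-- The same, with a further Lipschitz coefficient. -/
theorem continuousOn_integral_mul_wd [IsFiniteMeasure (volume.restrict Ω)]
    {u a : ℝ → E d → ℝ} {K L : ℝ} (hu : TimeLip Ω T u K) (ha : TimeLip Ω T a L)
    (hH : ∀ t ∈ Icc 0 T, MemH10 Ω (u t))
    (j : Fin d) (hj : ∀ t ∈ Icc 0 T, ∀ᵐ x ∂(volume.restrict Ω), |wd Ω j (u t) x| ≤ K)
    {h : E d → ℝ} (hh : Integrable h (volume.restrict Ω)) :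
    ContinuousOn (fun t => ∫ x in Ω, a t x * wd Ω j (u t) x * h x) (Icc 0 T) := by
  intro t ht
  have hah : ∀ s ∈ Icc 0 T, Integrable (fun x => a s x * h x) (volume.restrict Ω) := fun s hs =>
    hh.bdd_mul (ha.meas s hs) (ha.bound s hs)
  have hi : ∀ r ∈ Icc 0 T, ∀ s ∈ Icc 0 T,
      Integrable (fun x => wd Ω j (u r) x * (a s x * h x)) (volume.restrict Ω) := fun r hr s hs =>
    (hah s hs).bdd_mul ((hH r hr).1.2 j).2.1 (hj r hr)
  have h1 := continuousOn_integral_wd hu hH j hj (hah t ht) t ht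
  set M := ∫ x in Ω, |h x|
  -- Freezing the coefficient at time t costs at most a multiple of |s − t|, since the derivatives
  -- are uniformly bounded.
  have h2 : Tendsto (fun s => (∫ x in Ω, a s x * wd Ω j (u s) x * h x)
      - ∫ x in Ω, wd Ω j (u s) x * (a t x * h x)) (𝓝[Icc 0 T] t) (𝓝 0) := by
    have hb : Tendsto (fun s => |K| * (L * |s - t|) * M) (𝓝[Icc 0 T] t) (𝓝 0) := by
      have : Continuous fun s => |K| * (L * |s - t|) * M := by fun_prop
      simpa using (this.tendsto t).mono_left nhdsWithin_le_nhds
    refine squeeze_zero_norm' ?_ hb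
    filter_upwards [self_mem_nhdsWithin] with s hs
    have e : ∀ x, a s x * wd Ω j (u s) x * h x = wd Ω j (u s) x * (a s x * h x) := fun x => by ring
    simp_rw [e]
    rw [← integral_sub (hi s hs s hs) (hi s hs t ht), ← integral_const_mul]
    refine norm_integral_le_of_norm_le (hh.abs.const_mul _) ?_
    filter_upwards [hj s hs, ha.lip t ht s hs] with x hx1 hx2
    rw [← mul_sub, ← sub_mul, ← mul_assoc, norm_mul, norm_mul]
    refine mul_le_mul_of_nonneg_right ?_ (abs_nonneg _)
    exact mul_le_mul (hx1.trans (le_abs_self _)) hx2 (abs_nonneg _) (abs_nonneg _)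
  have h3 := h2.add h1
  rw [ContinuousWithinAt]
  have e : ∫ x in Ω, a t x * wd Ω j (u t) x * h x = ∫ x in Ω, wd Ω j (u t) x * (a t x * h x) := by
    congr 1; ext x; ring
  rw [e]
  simpa using h3

/-! ### Derivatives on a closed interval -/

/-- Extending the integrand by its end values makes it continuous on the line, so the fundamental
theorem of calculus holds at the end points too. -/
theorem hasDerivWithinAt_integral_Icc {F : ℝ → ℝ} (hT : 0 < T) (hF : ContinuousOn F (Icc 0 T))
    {t : ℝ} (ht : t ∈ Icc 0 T) :
    HasDerivWithinAt (fun s => ∫ r in (0 : ℝ)..s, F r) (F t) (Icc 0 T) t := by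
  set G := IccExtend hT.le ((Icc 0 T).domRestrict F) with hG
  have hGc : Continuous G := (continuousOn_iff_continuous_domRestrict.1 hF).Icc_extend'
  have hGF : ∀ s ∈ Icc 0 T, G s = F s := fun s hs => by
    rw [hG, IccExtend_of_mem hT.le _ hs]; rfl
  have h1 := (hGc.integral_hasStrictDerivAt 0 t).hasDerivAt.hasDerivWithinAt (s := Icc 0 T)
  rw [hGF t ht] at h1
  refine h1.congr (fun s hs => ?_) ?_
  · refine intervalIntegral.integral_congr fun r hr => ?_
    rw [uIcc_of_le hs.1] at hr
    exact (hGF r ⟨hr.1, hr.2.trans hs.2⟩).symm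
  · refine intervalIntegral.integral_congr fun r hr => ?_
    rw [uIcc_of_le ht.1] at hr
    exact (hGF r ⟨hr.1, hr.2.trans ht.2⟩).symm

theorem hasDerivWithinAt_of_sq_bound {g : ℝ → ℝ} {D K : ℝ} {s : Set ℝ} {t : ℝ}
    (h : ∀ r ∈ s, |g r - g t - (r - t) * D| ≤ K * (r - t) ^ 2) : HasDerivWithinAt g D s t := by
  rw [hasDerivWithinAt_iff_isLittleO]
  have h1 : (fun r => g r - g t - (r - t) • D) =O[𝓝[s] t] fun r => (r - t) ^ 2 := by
    refine Asymptotics.IsBigO.of_bound K ?_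
    filter_upwards [self_mem_nhdsWithin] with r hr
    rw [smul_eq_mul, Real.norm_eq_abs, Real.norm_eq_abs, abs_of_nonneg (sq_nonneg (r - t))]
    exact h r hr
  refine h1.trans_isLittleO ?_
  have h2 : (fun x : ℝ => x ^ 2) =o[𝓝 0] fun x => x := by
    simpa using Asymptotics.isLittleO_pow_pow (𝕜 := ℝ) (show 1 < 2 by norm_num)
  have h3 : Tendsto (fun r => r - t) (𝓝[s] t) (𝓝 0) := by
    have : Continuous fun r : ℝ => r - t := by fun_prop
    simpa using (this.tendsto t).mono_left nhdsWithin_le_nhds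
  exact h2.comp_tendsto h3

end

section

variable {d : ℕ} {Ω : Set (E d)}

/-! ### Bounds on the exact solution -/

/-- The bounds on the exact solution that follow from its regularity, with one constant `K`. -/
structure ExactBounds (Ω : Set (E d)) (T K : ℝ) (f : ℝ → LpΩ (E d) 2 Ω)
    (ρ : ℝ → LpΩ ℝ ∞ Ω) (u u' : ℝ → LpΩ (E d) ∞ Ω) (p : ℝ → LpΩ ℝ ∞ Ω) : Prop where
  pos : 0 < K
  rho_bound : ∀ t ∈ Icc 0 T, ∀ᵐ x ∂(volume.restrict Ω), |ρ t x| ≤ K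
  rho_lip : ∀ s ∈ Icc 0 T, ∀ t ∈ Icc 0 T, ∀ᵐ x ∂(volume.restrict Ω), |ρ t x - ρ s x| ≤ K * |t - s|
  u_bound : ∀ t ∈ Icc 0 T, ∀ᵐ x ∂(volume.restrict Ω), ‖u t x‖ ≤ K
  u_lip : ∀ s ∈ Icc 0 T, ∀ t ∈ Icc 0 T, ∀ᵐ x ∂(volume.restrict Ω), ‖u t x - u s x‖ ≤ K * |t - s|
  u_taylor : ∀ s ∈ Icc 0 T, ∀ t ∈ Icc 0 T, ∀ᵐ x ∂(volume.restrict Ω),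
    ‖u t x - u s x - (t - s) • u' s x‖ ≤ K * (t - s) ^ 2
  du_bound : ∀ t ∈ Icc 0 T, ∀ᵐ x ∂(volume.restrict Ω), ‖u' t x‖ ≤ K
  p_bound : ∀ t ∈ Icc 0 T, ∀ᵐ x ∂(volume.restrict Ω), |p t x| ≤ K
  p_lip : ∀ s ∈ Icc 0 T, ∀ t ∈ Icc 0 T, ∀ᵐ x ∂(volume.restrict Ω), |p t x - p s x| ≤ K * |t - s|
  jac_bound : ∀ t ∈ Icc 0 T, ∀ᵐ x ∂(volume.restrict Ω), ∀ i j, |jac Ω (u t) x i j| ≤ K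
  f_bound : ∀ t ∈ Icc 0 T, ∫ x in Ω, ‖f t x‖ ^ 2 ≤ K

theorem norm_le_of_lipschitzOn {X : Type*} [NormedAddCommGroup X] {T : ℝ} (hT : 0 < T)
    {φ : ℝ → X} {K : ℝ≥0} (h : LipschitzOnWith K φ (Icc 0 T)) {t : ℝ} (ht : t ∈ Icc 0 T) :
    ‖φ t‖ ≤ ‖φ 0‖ + K * T := by
  have h0 : (0 : ℝ) ∈ Icc 0 T := ⟨le_rfl, hT.le⟩
  have h1 := h.dist_le_mul t ht 0 h0
  rw [dist_eq_norm, Real.dist_eq, sub_zero, abs_of_nonneg ht.1] at h1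
  have h2 : (K : ℝ) * t ≤ K * T := mul_le_mul_of_nonneg_left ht.2 K.2
  have h3 := norm_sub_norm_le (φ t) (φ 0)
  linarith

/-- The mean value inequality for r ↦ φ(r) − r φ'(s), whose derivative is at most K|t − s| between s
and t. -/
theorem norm_taylor_le {X : Type*} [NormedAddCommGroup X] [NormedSpace ℝ X] {T : ℝ}
    {φ φ' : ℝ → X} {K : ℝ≥0}
    (hd : ∀ t ∈ Icc 0 T, HasDerivWithinAt φ (φ' t) (Icc 0 T) t)
    (h : LipschitzOnWith K φ' (Icc 0 T)) {s t : ℝ} (hs : s ∈ Icc 0 T) (ht : t ∈ Icc 0 T) :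
    ‖φ t - φ s - (t - s) • φ' s‖ ≤ K * (t - s) ^ 2 := by
  have hsub : uIcc s t ⊆ Icc 0 T := by
    intro r hr
    rw [mem_uIcc] at hr
    rcases hr with hr | hr
    · exact ⟨hs.1.trans hr.1, hr.2.trans ht.2⟩
    · exact ⟨ht.1.trans hr.1, hr.2.trans hs.2⟩
  have h1 : ∀ r ∈ uIcc s t, HasDerivWithinAt (fun r => φ r - r • φ' s) (φ' r - (1 : ℝ) • φ' s)
      (uIcc s t) r := fun r hr =>
    ((hd r (hsub hr)).mono hsub).sub ((hasDerivWithinAt_id r _).smul_const _)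
  have h2 : ∀ r ∈ uIcc s t, ‖φ' r - (1 : ℝ) • φ' s‖ ≤ K * |t - s| := by
    intro r hr
    rw [one_smul, ← dist_eq_norm]
    refine (h.dist_le_mul r (hsub hr) s hs).trans ?_
    refine mul_le_mul_of_nonneg_left ?_ K.2
    rw [Real.dist_eq]
    exact abs_sub_left_of_mem_uIcc hr
  have h3 := (convex_uIcc s t).norm_image_sub_le_of_norm_hasDerivWithin_le h1 h2
    left_mem_uIcc right_mem_uIcc
  have e1 : φ t - t • φ' s - (φ s - s • φ' s) = φ t - φ s - (t - s) • φ' s := by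
    rw [sub_smul]; abel
  have e2 : (K : ℝ) * |t - s| * ‖t - s‖ = K * (t - s) ^ 2 := by
    rw [Real.norm_eq_abs, mul_assoc, abs_mul_abs_self]; ring
  rwa [e1, e2] at h3

theorem IsExact.exists_bounds {T : ℝ} (hT : 0 < T) {η : ℝ → ℝ} {f : ℝ → LpΩ (E d) 2 Ω}
    (hf : ContinuousOn f (Icc 0 T)) {ρ : ℝ → LpΩ ℝ ∞ Ω} {u : ℝ → LpΩ (E d) ∞ Ω}
    {p : ℝ → LpΩ ℝ ∞ Ω} (h : IsExact Ω T η f ρ u p) :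
    ∃ K u', ExactBounds Ω T K f ρ u u' p := by
  obtain ⟨Kρ, hρ⟩ := h.rho_reg
  obtain ⟨u', hu, Ku, hu'⟩ := h.u_reg_time
  obtain ⟨Kp, hp⟩ := h.p_reg
  obtain ⟨Kj, hj⟩ := h.u_reg_space
  obtain ⟨Kf, hKf⟩ := isCompact_Icc.exists_bound_of_continuousOn hf
  have hf0 : 0 ≤ Kf := (norm_nonneg _).trans (hKf 0 ⟨le_rfl, hT.le⟩)
  set B := ‖u' 0‖ + Ku * T with hB
  have hB0 : 0 ≤ B := by positivity
  have hub : ∀ t ∈ Icc 0 T, ‖u' t‖ ≤ B := fun t ht => norm_le_of_lipschitzOn hT hu' ht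
  have hul : ∀ s ∈ Icc 0 T, ∀ t ∈ Icc 0 T, ‖u t - u s‖ ≤ B * |t - s| := fun s hs t ht =>
    (convex_Icc 0 T).norm_image_sub_le_of_norm_hasDerivWithin_le hu hub hs ht
  have hulip : LipschitzOnWith ⟨B, hB0⟩ u (Icc 0 T) := LipschitzOnWith.of_dist_le_mul
    fun t ht s hs => by rw [dist_eq_norm, Real.dist_eq]; exact hul s hs t ht
  set K := 1 + Kρ + (‖ρ 0‖ + Kρ * T) + B + (‖u 0‖ + B * T) + Ku + Kp + (‖p 0‖ + Kp * T) + |Kj|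
    + Kf ^ 2 with hK
  have n1 : (0 : ℝ) ≤ Kρ := Kρ.2
  have n2 : (0 : ℝ) ≤ Ku := Ku.2
  have n3 : (0 : ℝ) ≤ Kp := Kp.2
  have n4 : 0 ≤ Kρ * T := by positivity
  have n5 : 0 ≤ B * T := by positivity
  have n6 : 0 ≤ Kp * T := by positivity
  have n7 := norm_nonneg (ρ 0)
  have n8 := norm_nonneg (u 0)
  have n9 := norm_nonneg (p 0)
  have n10 := abs_nonneg Kj
  have n11 := sq_nonneg Kf
  refine ⟨K, u', by positivity, ?_, ?_, ?_, ?_, ?_, ?_, ?_, ?_, ?_, ?_⟩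
  · intro t ht
    filter_upwards [ae_norm_le (ρ t)] with x hx
    have := norm_le_of_lipschitzOn hT hρ ht
    rw [Real.norm_eq_abs] at hx; linarith
  · intro s hs t ht
    filter_upwards [ae_norm_sub_le (ρ t) (ρ s)] with x hx
    have := hρ.dist_le_mul t ht s hs
    rw [dist_eq_norm, Real.dist_eq] at this
    exact (hx.trans this).trans (mul_le_mul_of_nonneg_right (by linarith) (abs_nonneg _))
  · intro t ht
    filter_upwards [ae_norm_le (u t)] with x hx
    have := norm_le_of_lipschitzOn hT hulip ht
    change _ ≤ ‖u 0‖ + B * T at this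
    linarith
  · intro s hs t ht
    filter_upwards [ae_norm_sub_le (u t) (u s)] with x hx
    exact (hx.trans (hul s hs t ht)).trans
      (mul_le_mul_of_nonneg_right (by linarith) (abs_nonneg _))
  · intro s hs t ht
    filter_upwards [ae_norm_le (u t - u s - (t - s) • u' s), Lp.coeFn_sub (u t - u s)
      ((t - s) • u' s), Lp.coeFn_sub (u t) (u s), Lp.coeFn_smul (t - s) (u' s)] with x h1 h2 h3 h4
    have := norm_taylor_le hu hu' hs ht
    rw [h2, Pi.sub_apply, h3, h4] at h1
    exact (h1.trans this).trans (mul_le_mul_of_nonneg_right (by linarith) (sq_nonneg _))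
  · intro t ht
    filter_upwards [ae_norm_le (u' t)] with x hx
    have := hub t ht
    linarith
  · intro t ht
    filter_upwards [ae_norm_le (p t)] with x hx
    have := norm_le_of_lipschitzOn hT hp ht
    rw [Real.norm_eq_abs] at hx; linarith
  · intro s hs t ht
    filter_upwards [ae_norm_sub_le (p t) (p s)] with x hx
    have := hp.dist_le_mul t ht s hs
    rw [dist_eq_norm, Real.dist_eq] at this
    exact (hx.trans this).trans (mul_le_mul_of_nonneg_right (by linarith) (abs_nonneg _))
  · intro t ht
    filter_upwards [eventually_all.2 fun i => eventually_all.2 fun j => hj t ht i j] with x hx i j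
    have := hx i j
    linarith [le_abs_self Kj]
  · intro t ht
    have h1 : ∫ x in Ω, ‖f t x‖ ^ 2 = ‖f t‖ ^ 2 := by
      rw [← real_inner_self_eq_norm_sq, L2.inner_def]
      congr 1; ext x; rw [real_inner_self_eq_norm_sq]
    rw [h1]
    have := pow_le_pow_left₀ (norm_nonneg _) (hKf t ht) 2
    linarith

section Fields

variable {T K : ℝ} {f : ℝ → LpΩ (E d) 2 Ω} {ρ : ℝ → LpΩ ℝ ∞ Ω} {u u' : ℝ → LpΩ (E d) ∞ Ω}
  {p : ℝ → LpΩ ℝ ∞ Ω}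

theorem ExactBounds.timeLip_rho (h : ExactBounds Ω T K f ρ u u' p) :
    TimeLip Ω T (fun t => ρ t) K where
  meas t _ := (Lp.memLp (ρ t)).1
  bound := h.rho_bound
  lip := h.rho_lip

theorem ExactBounds.timeLip_p (h : ExactBounds Ω T K f ρ u u' p) :
    TimeLip Ω T (fun t => p t) K where
  meas t _ := (Lp.memLp (p t)).1
  bound := h.p_bound
  lip := h.p_lip

theorem ExactBounds.timeLip_u (h : ExactBounds Ω T K f ρ u u' p) (i : Fin d) :
    TimeLip Ω T (fun t x => u t x i) K where
  meas t _ := ((Lp.memLp (u t)).eval_piLp i).1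
  bound t ht := (h.u_bound t ht).mono fun x hx => (PiLp.norm_apply_le (u t x) i).trans hx
  lip s hs t ht := (h.u_lip s hs t ht).mono fun x hx =>
    (PiLp.norm_apply_le (u t x - u s x) i).trans hx

theorem ExactBounds.timeLip_eta (h : ExactBounds Ω T K f ρ u u' p) {α : ℝ≥0} {η : ℝ → ℝ}
    (hη : LipschitzWith α η) : TimeLip Ω T (fun t x => η (ρ t x)) (|η 0| + α * K) where
  meas t _ := hη.continuous.comp_aestronglyMeasurable (Lp.memLp (ρ t)).1
  bound t ht := (h.rho_bound t ht).mono fun x hx => by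
    have h1 := hη.dist_le_mul (ρ t x) 0
    rw [Real.dist_eq, Real.dist_eq, sub_zero] at h1
    have h2 : (α : ℝ) * |ρ t x| ≤ α * K := mul_le_mul_of_nonneg_left hx α.2
    have h3 := abs_sub_abs_le_abs_sub (η (ρ t x)) (η 0)
    linarith
  lip s hs t ht := (h.rho_lip s hs t ht).mono fun x hx => by
    have h1 := hη.dist_le_mul (ρ t x) (ρ s x)
    rw [Real.dist_eq, Real.dist_eq] at h1
    have h2 : (α : ℝ) * |ρ t x - ρ s x| ≤ α * (K * |t - s|) := mul_le_mul_of_nonneg_left hx α.2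
    have h3 : 0 ≤ |η 0| * |t - s| := by positivity
    linarith

theorem ExactBounds.jac_memLp (h : ExactBounds Ω T K f ρ u u' p) {t : ℝ} (ht : t ∈ Icc 0 T)
    (hv : MemH10v Ω (u t)) : MatLp Ω ∞ (jac Ω (u t)) := fun i j =>
  memLp_top_of_bound (hv.jac i j).1 K ((h.jac_bound t ht).mono fun _ hx => hx i j)

theorem integral_ddot {A B : E d → Matrix (Fin d) (Fin d) ℝ}
    (hA : MatLp Ω 2 A) (hB : MatLp Ω 2 B) :
    ∫ x in Ω, ddot (A x) (B x) = ∑ i, ∑ j, ∫ x in Ω, A x i j * B x i j := by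
  simp only [ddot]
  rw [integral_finsetSum _ fun i _ => integrable_finsetSum _ fun j _ =>
    integrable_mul_of_memLp (hA i j) (hB i j)]
  exact Finset.sum_congr rfl fun i _ => integral_finsetSum _ fun j _ =>
    integrable_mul_of_memLp (hA i j) (hB i j)

theorem memLp_two_of_top [IsFiniteMeasure (volume.restrict Ω)] {F : Type*} [NormedAddCommGroup F]
    {g : E d → F} (h : MemLp g ∞ (volume.restrict Ω)) : MemLp g 2 (volume.restrict Ω) :=
  h.mono_exponent le_top

theorem MatLp.two_of_top [IsFiniteMeasure (volume.restrict Ω)]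
    {A : E d → Matrix (Fin d) (Fin d) ℝ} (h : MatLp Ω ∞ A) : MatLp Ω 2 A :=
  fun i j => memLp_two_of_top (h i j)

/-! ### The momentum equation at a fixed time -/

/-- The terms of the integrated momentum equation depend continuously on time. -/
theorem ExactBounds.continuousOn_momentum [IsFiniteMeasure (volume.restrict Ω)]
    {α : ℝ≥0} {η : ℝ → ℝ} (hη : LipschitzWith α η)
    (hf : ContinuousOn f (Icc 0 T)) (h : ExactBounds Ω T K f ρ u u' p)
    (hu : ∀ t ∈ Icc 0 T, MemH10v Ω (u t)) {v : E d → E d} (hv : MemH10v Ω v) :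
    ContinuousOn (fun s => ∫ x in Ω, (ddot (tens (ρ s x • u s x) (u s x)) (jac Ω v x)
            - 2 * (η (ρ s x) * ddot (strain Ω (u s) x) (strain Ω v x))
            + p s x * dvg Ω v x + inner ℝ (f s x) (v x))) (Icc 0 T) := by
  have hK := h.pos.le
  have hηr := h.timeLip_eta hη
  have hv1 : ∀ i j, Integrable (fun x => jac Ω v x i j) (volume.restrict Ω) := fun i j =>
    (hv.jac i j).integrable (by norm_num)
  have hs1 : ∀ i j, Integrable (fun x => strain Ω v x i j) (volume.restrict Ω) := fun i j =>
    (hv.strain i j).integrable (by norm_num)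
  have c1 : ContinuousOn (fun s => ∑ i, ∑ j, ∫ x in Ω, (ρ s x * u s x i * u s x j)
      * jac Ω v x i j) (Icc 0 T) := by
    refine continuousOn_finsetSum _ fun i _ => continuousOn_finsetSum _ fun j _ => ?_
    exact (((h.timeLip_rho.mul hK hK (h.timeLip_u i)).mul (by positivity) hK
      (h.timeLip_u j)).continuousOn_integral (hv1 i j))
  -- The viscous term is the one containing ∇u, which is only weakly continuous in time; the
  -- Lipschitz coefficient η(ρ) rides along.
  have c2 : ContinuousOn (fun s => ∑ i, ∑ j, 1 / 2 *
      ((∫ x in Ω, η (ρ s x) * wd Ω j (fun y => u s y i) x * strain Ω v x i j)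
      + ∫ x in Ω, η (ρ s x) * wd Ω i (fun y => u s y j) x * strain Ω v x i j)) (Icc 0 T) := by
    refine continuousOn_finsetSum _ fun i _ => continuousOn_finsetSum _ fun j _ => ?_
    refine continuousOn_const.mul (ContinuousOn.add ?_ ?_)
    · exact continuousOn_integral_mul_wd (h.timeLip_u i) hηr (fun t ht => hu t ht i) j
        (fun t ht => (h.jac_bound t ht).mono fun x hx => hx i j) (hs1 i j)
    · exact continuousOn_integral_mul_wd (h.timeLip_u j) hηr (fun t ht => hu t ht j) i
        (fun t ht => (h.jac_bound t ht).mono fun x hx => hx j i) (hs1 i j)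
  have c3 : ContinuousOn (fun s => ∫ x in Ω, p s x * dvg Ω v x) (Icc 0 T) :=
    h.timeLip_p.continuousOn_integral (hv.dvg.integrable (by norm_num))
  have c4 : ContinuousOn (fun s => ∫ x in Ω, inner ℝ (f s x) (v x)) (Icc 0 T) := by
    have : ContinuousOn (fun s => inner ℝ (f s) (hv.memLp.toLp v)) (Icc 0 T) :=
      hf.inner continuousOn_const
    refine this.congr fun s _ => ?_
    change _ = inner ℝ (f s) (hv.memLp.toLp v)
    rw [L2.inner_def]
    refine integral_congr_ae ?_
    filter_upwards [hv.memLp.coeFn_toLp] with x hx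
    rw [hx]
  refine (((c1.sub (c2.const_mul 2)).add c3).add c4).congr fun s hs => ?_
  have hρ2 : MemLp (ρ s) ∞ (volume.restrict Ω) := Lp.memLp _
  have hus : MemLp (u s) ∞ (volume.restrict Ω) := Lp.memLp _
  have hρu : MemLp (fun x => ρ s x • u s x) ∞ (volume.restrict Ω) :=
    MemLp.of_eval_piLp fun i => memLp_mul hρ2 (hus.eval_piLp i)
  have hA : MatLp Ω 2 (fun x => tens (ρ s x • u s x) (u s x)) :=
    MatLp.two_of_top (MatLp.tens hρu hus)
  have hB : MatLp Ω 2 (fun x => η (ρ s x) • strain Ω (u s) x) :=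
    MatLp.two_of_top (MatLp.smul (hηr.memLp hs) (h.jac_memLp hs (hu s hs)).msym)
  have e0 : ∀ x, η (ρ s x) * ddot (strain Ω (u s) x) (strain Ω v x)
      = ddot (η (ρ s x) • strain Ω (u s) x) (strain Ω v x) := by
    intro x
    simp only [ddot, Finset.mul_sum, Matrix.smul_apply, smul_eq_mul, mul_assoc]
  have i1 := hA.integrable_ddot hv.jac
  have i2 := hB.integrable_ddot hv.strain
  have i3 : Integrable (fun x => p s x * dvg Ω v x) (volume.restrict Ω) :=
    integrable_mul_of_memLp (memLp_two_of_top (Lp.memLp _)) hv.dvg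
  have i4 : Integrable (fun x => inner ℝ (f s x) (v x)) (volume.restrict Ω) :=
    integrable_inner (Lp.memLp _) hv.memLp
  simp_rw [e0]
  rw [integral_add (by fun_prop) i4, integral_add (by fun_prop) i3, integral_sub i1 (by fun_prop),
    integral_const_mul, integral_ddot hA hv.jac, integral_ddot hB hv.strain]
  have e1 : ∑ i, ∑ j, ∫ x in Ω, tens (ρ s x • u s x) (u s x) i j * jac Ω v x i j
      = ∑ i, ∑ j, ∫ x in Ω, (ρ s x * u s x i * u s x j) * jac Ω v x i j := by
    refine Finset.sum_congr rfl fun i _ => Finset.sum_congr rfl fun j _ => ?_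
    rfl
  have e2 : ∑ i, ∑ j, ∫ x in Ω, (η (ρ s x) • strain Ω (u s) x) i j * strain Ω v x i j
      = ∑ i, ∑ j, 1 / 2 *
      ((∫ x in Ω, η (ρ s x) * wd Ω j (fun y => u s y i) x * strain Ω v x i j)
      + ∫ x in Ω, η (ρ s x) * wd Ω i (fun y => u s y j) x * strain Ω v x i j) := by
    refine Finset.sum_congr rfl fun i _ => Finset.sum_congr rfl fun j _ => ?_
    have k1 : ∀ a b, Integrable (fun x => η (ρ s x) * wd Ω b (fun y => u s y a) x
        * strain Ω v x i j) (volume.restrict Ω) := fun a b => by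
      refine integrable_mul_of_memLp (memLp_two_of_top ?_) (hv.strain i j)
      exact memLp_mul (hηr.memLp hs) (h.jac_memLp hs (hu s hs) a b)
    rw [← integral_add (k1 i j) (k1 j i), ← integral_const_mul]
    congr 1; ext x
    simp only [strain_eq_msym, Matrix.smul_apply, smul_eq_mul, msym_apply]
    simp only [jac, Matrix.of_apply]
    ring
  rw [e1, e2]
  rfl

end Fields

end

/-! ### The exact momentum equation in non-conservative form, at each time -/

section

variable {d : ℕ} {Ω : Set (E d)} {T K : ℝ} {f : ℝ → LpΩ (E d) 2 Ω} {ρ : ℝ → LpΩ ℝ ∞ Ω}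
  {u u' : ℝ → LpΩ (E d) ∞ Ω} {p : ℝ → LpΩ ℝ ∞ Ω}

theorem ddot_eq_sum (A B : Matrix (Fin d) (Fin d) ℝ) : ddot A B = ∑ i, ∑ j, A i j * B i j := rfl

theorem tens_apply (a b : E d) (i j : Fin d) : tens a b i j = a i * b j := rfl

/-- The mass equation tested with `u(t) · v`. -/
theorem ExactBounds.hasDerivWithinAt_mass (hΩ : IsOpen Ω) [IsFiniteMeasure (volume.restrict Ω)]
    (hT : 0 < T) {η : ℝ → ℝ} (hex : IsExact Ω T η f ρ u p) (h : ExactBounds Ω T K f ρ u u' p)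
    {v : E d → E d} (hv : MemH10v Ω v) {t : ℝ} (ht : t ∈ Icc 0 T) :
    HasDerivWithinAt (fun s => ∑ i, ∫ x in Ω, ρ s x * (u t x i * v x i))
      (∫ x in Ω, ρ t x * (ddot (tens (v x) (u t x)) (jac Ω (u t) x)
        + ddot (tens (u t x) (u t x)) (jac Ω v x))) (Icc 0 T) t := by
  have hK := h.pos.le
  have hut := hex.u_dirichlet t ht
  have hus : ∀ s, MemLp (u s) ∞ (volume.restrict Ω) := fun s => Lp.memLp _
  have hJ := h.jac_memLp ht hut
  -- The products uᵢ(t)vᵢ are admissible in the mass equation because u(t) and its gradient are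
  -- bounded.
  have hφ := fun i => MemH10.mul hΩ (hut i) ((hus t).eval_piLp i) (fun j => hJ i j) (hv i)
  have hgr : ∀ i, MemLp (grad Ω fun x => u t x i * v x i) 2 (volume.restrict Ω) := fun i =>
    MemLp.of_eval_piLp fun j => ((hφ i).1.1.2 j).2
  have hcont : ∀ i, ContinuousOn (fun s => ∫ x in Ω, ρ s x * inner ℝ (u s x)
      (grad Ω (fun x => u t x i * v x i) x)) (Icc 0 T) := by
    intro i
    have hc : ContinuousOn (fun s => ∑ j, ∫ x in Ω, (ρ s x * u s x j)
        * grad Ω (fun x => u t x i * v x i) x j) (Icc 0 T) :=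
      continuousOn_finsetSum _ fun j _ =>
        (h.timeLip_rho.mul hK hK (h.timeLip_u j)).continuousOn_integral
          (((hgr i).eval_piLp j).integrable (by norm_num))
    refine hc.congr fun s hs => ?_
    simp only [inner_eq_sum, Finset.mul_sum]
    rw [integral_finsetSum]
    · refine Finset.sum_congr rfl fun j _ => ?_
      congr 1; ext x; ring
    · intro j _
      refine (integrable_mul_of_memLp (memLp_two_of_top (memLp_mul (r := ∞) (Lp.memLp (ρ s))
        ((hus s).eval_piLp j))) ((hgr i).eval_piLp j)).congr (Eventually.of_forall fun x => ?_)
      simp only; ring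
  have hder : ∀ i, HasDerivWithinAt (fun s => ∫ x in Ω, ρ s x * (u t x i * v x i))
      (∫ x in Ω, ρ t x * inner ℝ (u t x) (grad Ω (fun x => u t x i * v x i) x)) (Icc 0 T) t := by
    intro i
    have h1 := (hasDerivWithinAt_integral_Icc hT (hcont i) ht).const_add
      (∫ x in Ω, ρ 0 x * (u t x i * v x i))
    refine h1.congr (fun s hs => ?_) ?_
    · have := hex.mass _ (hφ i).1 s hs
      linarith
    · have := hex.mass _ (hφ i).1 t ht
      linarith
  have hsum := HasDerivWithinAt.fun_sum (u := Finset.univ) fun i _ => hder i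
  convert! hsum using 1
  rw [← integral_finsetSum]
  · refine integral_congr_ae ?_
    filter_upwards [eventually_all.2 fun i => eventually_all.2 fun j => (hφ i).2 j] with x hx
    simp only [inner_eq_sum, grad, hx, ddot_eq_sum, tens_apply, ← Finset.mul_sum,
      ← Finset.sum_add_distrib]
    congr 1
    refine Finset.sum_congr rfl fun i _ => Finset.sum_congr rfl fun j _ => ?_
    simp only [jac, Matrix.of_apply]
    ring
  · intro i _
    exact integrable_mul_of_memLp (memLp_two_of_top (Lp.memLp (ρ t)))
      (memLp_inner (hus t) (hgr i))

/-- The increment u(s) − u(t) vanishes at s = t, so the density is never differentiated: Taylor's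
remainder and the Lipschitz bound on ρ leave an error quadratic in s − t. -/
theorem ExactBounds.hasDerivWithinAt_velocity [IsFiniteMeasure (volume.restrict Ω)]
    (h : ExactBounds Ω T K f ρ u u' p)
    {v : E d → E d} (hv : MemLp v 2 (volume.restrict Ω)) {t : ℝ} (ht : t ∈ Icc 0 T) :
    HasDerivWithinAt (fun s => ∫ x in Ω, ρ s x * inner ℝ (u s x - u t x) (v x))
      (∫ x in Ω, ρ t x * inner ℝ (u' t x) (v x)) (Icc 0 T) t := by
  have hK := h.pos.le
  have hρs : ∀ s, MemLp (ρ s) ∞ (volume.restrict Ω) := fun s => Lp.memLp _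
  have hvi : ∀ a : ℝ → LpΩ (E d) ∞ Ω, ∀ r s, Integrable (fun x => ρ r x * inner ℝ (a s x) (v x))
      (volume.restrict Ω) := fun a r s =>
    integrable_mul_of_memLp (memLp_two_of_top (hρs r)) (memLp_inner (Lp.memLp (a s)) hv)
  have i1 := hvi u' t t
  set M := ∫ x in Ω, ‖v x‖ with hMdef
  have hvn : Integrable (fun x => ‖v x‖) (volume.restrict Ω) := (hv.integrable (by norm_num)).norm
  have hgi : ∀ s, Integrable (fun x => ρ s x * inner ℝ (u s x - u t x) (v x))
      (volume.restrict Ω) := fun s => by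
    refine ((hvi u s s).sub (hvi u s t)).congr (Eventually.of_forall fun x => ?_)
    simp only [Pi.sub_apply, inner_sub_left]; ring
  refine hasDerivWithinAt_of_sq_bound (K := 2 * K ^ 2 * M) fun s hs => ?_
  have e : (∫ x in Ω, ρ s x * inner ℝ (u s x - u t x) (v x))
      - (∫ x in Ω, ρ t x * inner ℝ (u t x - u t x) (v x))
      - (s - t) * ∫ x in Ω, ρ t x * inner ℝ (u' t x) (v x)
      = ∫ x in Ω, (ρ s x * inner ℝ (u s x - u t x) (v x)
        - (s - t) * (ρ t x * inner ℝ (u' t x) (v x))) := by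
    rw [integral_sub (hgi s) (i1.const_mul _), integral_const_mul]
    simp
  rw [e, ← Real.norm_eq_abs]
  have e2 : 2 * K ^ 2 * M * (s - t) ^ 2 = ∫ x in Ω, (2 * K ^ 2 * (s - t) ^ 2) * ‖v x‖ := by
    rw [integral_const_mul]; ring
  rw [e2]
  refine norm_integral_le_of_norm_le (hvn.const_mul _) ?_
  filter_upwards [h.u_taylor t ht s hs, h.rho_bound s hs, h.rho_lip t ht s hs, h.du_bound t ht]
    with x h1 h2 h3 h4
  have e3 : ρ s x * inner ℝ (u s x - u t x) (v x) - (s - t) * (ρ t x * inner ℝ (u' t x) (v x))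
      = ρ s x * inner ℝ (u s x - u t x - (s - t) • u' t x) (v x)
        + (s - t) * ((ρ s x - ρ t x) * inner ℝ (u' t x) (v x)) := by
    rw [inner_sub_left (u s x - u t x), real_inner_smul_left]; ring
  rw [e3, Real.norm_eq_abs]
  refine (abs_add_le _ _).trans ?_
  rw [abs_mul, abs_mul, abs_mul]
  have b1 := (abs_real_inner_le_norm (u s x - u t x - (s - t) • u' t x) (v x)).trans
    (mul_le_mul_of_nonneg_right h1 (norm_nonneg _))
  have b2 := (abs_real_inner_le_norm (u' t x) (v x)).trans
    (mul_le_mul_of_nonneg_right h4 (norm_nonneg _))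
  have b3 := mul_le_mul h2 b1 (abs_nonneg _) hK
  have b4 := mul_le_mul h3 b2 (abs_nonneg _) (by positivity)
  have b5 := mul_le_mul_of_nonneg_left b4 (abs_nonneg (s - t))
  have e4 : |s - t| * (K * |s - t| * (K * ‖v x‖)) = K ^ 2 * (s - t) ^ 2 * ‖v x‖ := by
    rw [← sq_abs (s - t)]; ring
  rw [e4] at b5
  nlinarith

/-- With b = u(t) frozen, the first part is differentiated through the mass equation and the second
through the regularity of the velocity. -/
theorem integral_momentum_split [IsFiniteMeasure (volume.restrict Ω)] {r : E d → ℝ}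
    {a b v : E d → E d} (hr : MemLp r ∞ (volume.restrict Ω)) (ha : MemLp a ∞ (volume.restrict Ω))
    (hb : MemLp b ∞ (volume.restrict Ω)) (hv : MemLp v 2 (volume.restrict Ω)) :
    ∫ x in Ω, inner ℝ (r x • a x) (v x)
      = (∑ i, ∫ x in Ω, r x * (b x i * v x i)) + ∫ x in Ω, r x * inner ℝ (a x - b x) (v x) := by
  have h1 : ∀ i, Integrable (fun x => r x * (b x i * v x i)) (volume.restrict Ω) := fun i =>
    integrable_mul_of_memLp (memLp_two_of_top hr) (memLp_mul (hb.eval_piLp i) (hv.eval_piLp i))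
  have h2 : Integrable (fun x => r x * inner ℝ (a x - b x) (v x)) (volume.restrict Ω) :=
    integrable_mul_of_memLp (memLp_two_of_top hr) (memLp_inner (ha.sub hb) hv)
  rw [← integral_finsetSum _ fun i _ => h1 i, ← integral_add (integrable_finsetSum _ fun i _ => h1 i) h2]
  congr 1
  ext x
  rw [real_inner_smul_left, ← Finset.mul_sum, ← inner_eq_sum, inner_sub_left]
  ring

theorem ddot_tens_smul_left (c : ℝ) (a b : E d) (B : Matrix (Fin d) (Fin d) ℝ) :
    ddot (tens (c • a) b) B = c * ddot (tens a b) B := by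
  simp only [ddot_eq_sum, tens_apply, Finset.mul_sum, PiLp.smul_apply, smul_eq_mul]
  exact Finset.sum_congr rfl fun i _ => Finset.sum_congr rfl fun j _ => by ring

/-- Here `k` is ρ u ⊗ u : ∇v. It occurs both in the momentum flux and in the mass equation tested
with u · v, and its cancellation is the passage to the non-conservative form. -/
theorem integral_eq_zero_of_balance {X : Type*} [MeasurableSpace X] {μ : Measure X}
    {a b c e g k : X → ℝ} (ha : Integrable a μ) (hb : Integrable b μ) (hc : Integrable c μ)
    (he : Integrable e μ) (hg : Integrable g μ) (hk : Integrable k μ)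
    (h : ∫ x, (k x - c x + e x + g x) ∂μ = ∫ x, (b x + k x) ∂μ + ∫ x, a x ∂μ) :
    ∫ x, (a x + b x + c x - e x - g x) ∂μ = 0 := by
  rw [integral_add (by fun_prop) hg, integral_add (by fun_prop) he, integral_sub hk hc,
    integral_add hb hk] at h
  rw [integral_sub (by fun_prop) hg, integral_sub (by fun_prop) he,
    integral_add (by fun_prop) hc, integral_add ha hb]
  linarith

/-- The momentum equation in non-conservative form, at a fixed time. -/
theorem ExactBounds.momentum_at (hΩ : IsOpen Ω) [IsFiniteMeasure (volume.restrict Ω)]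
    (hT : 0 < T) {α : ℝ≥0} {η : ℝ → ℝ} (hη : LipschitzWith α η)
    (hf : ContinuousOn f (Icc 0 T)) (hex : IsExact Ω T η f ρ u p)
    (h : ExactBounds Ω T K f ρ u u' p)
    {v : E d → E d} (hv : MemH10v Ω v) {t : ℝ} (ht : t ∈ Icc 0 T) :
    Integrable (fun x => ρ t x * inner ℝ (u' t x) (v x)
      + ρ t x * ddot (tens (v x) (u t x)) (jac Ω (u t) x)
      + 2 * (η (ρ t x) * ddot (strain Ω (u t) x) (strain Ω v x)) - p t x * dvg Ω v x
      - inner ℝ (f t x) (v x)) (volume.restrict Ω) ∧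
    ∫ x in Ω, (ρ t x * inner ℝ (u' t x) (v x)
      + ρ t x * ddot (tens (v x) (u t x)) (jac Ω (u t) x)
      + 2 * (η (ρ t x) * ddot (strain Ω (u t) x) (strain Ω v x)) - p t x * dvg Ω v x
      - inner ℝ (f t x) (v x)) = 0 := by
  have hK := h.pos.le
  have hut := hex.u_dirichlet t ht
  have hus : ∀ s, MemLp (u s) ∞ (volume.restrict Ω) := fun s => Lp.memLp _
  have hus' : ∀ s, MemLp (u' s) ∞ (volume.restrict Ω) := fun s => Lp.memLp _
  have hρs : ∀ s, MemLp (ρ s) ∞ (volume.restrict Ω) := fun s => Lp.memLp _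
  have hJ := h.jac_memLp ht hut
  have hηr := h.timeLip_eta hη
  -- integrability
  have hvi : ∀ a : ℝ → LpΩ (E d) ∞ Ω, ∀ r s, Integrable (fun x => ρ r x * inner ℝ (a s x) (v x))
      (volume.restrict Ω) := fun a r s =>
    integrable_mul_of_memLp (memLp_two_of_top (hρs r)) (memLp_inner (Lp.memLp (a s)) hv.memLp)
  have i2 : Integrable (fun x => ρ t x * ddot (tens (v x) (u t x)) (jac Ω (u t) x))
      (volume.restrict Ω) := by
    refine integrable_mul_of_memLp (memLp_two_of_top (hρs t)) ?_
    exact MatLp.ddot (r := 2) (MatLp.tens (r := 2) hv.memLp (hus t)) hJ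
  have i3 : Integrable (fun x => η (ρ t x) * ddot (strain Ω (u t) x) (strain Ω v x))
      (volume.restrict Ω) :=
    integrable_mul_of_memLp (memLp_two_of_top (hηr.memLp ht)) (MatLp.ddot hJ.msym hv.strain)
  have i4 : Integrable (fun x => p t x * dvg Ω v x) (volume.restrict Ω) :=
    integrable_mul_of_memLp (memLp_two_of_top (Lp.memLp _)) hv.dvg
  have i5 : Integrable (fun x => inner ℝ (f t x) (v x)) (volume.restrict Ω) :=
    integrable_inner (Lp.memLp _) hv.memLp
  have i6 : Integrable (fun x => ρ t x * ddot (tens (u t x) (u t x)) (jac Ω v x))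
      (volume.restrict Ω) :=
    integrable_mul_of_memLp (memLp_two_of_top (hρs t))
      (MatLp.ddot (MatLp.tens (r := ∞) (hus t) (hus t)) hv.jac)
  have i1 := hvi u' t t
  refine ⟨(((i1.add i2).add (i3.const_mul 2)).sub i4).sub i5, ?_⟩
  -- the derivative of the momentum, from the momentum equation
  have hM := (hasDerivWithinAt_integral_Icc hT
    (h.continuousOn_momentum hη hf hex.u_dirichlet hv) ht).const_add
    (∫ x in Ω, inner ℝ (ρ 0 x • u 0 x) (v x))
  have hM' : HasDerivWithinAt (fun s => ∫ x in Ω, inner ℝ (ρ s x • u s x) (v x))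
      (∫ x in Ω, (ddot (tens (ρ t x • u t x) (u t x)) (jac Ω v x)
            - 2 * (η (ρ t x) * ddot (strain Ω (u t) x) (strain Ω v x))
            + p t x * dvg Ω v x + inner ℝ (f t x) (v x))) (Icc 0 T) t := by
    refine hM.congr (fun s hs => ?_) ?_
    · have := hex.momentum v hv s hs
      linarith
    · have := hex.momentum v hv t ht
      linarith
  -- the part of the derivative due to the velocity
  have hG := h.hasDerivWithinAt_velocity hv.memLp ht
  have hA := h.hasDerivWithinAt_mass hΩ hT hex hv ht
  have hsum := hA.add hG
  have hMeq : ∀ s ∈ Icc 0 T, _ := fun s _ =>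
    integral_momentum_split (hρs s) (hus s) (hus t) hv.memLp
  have hM'' := hsum.congr hMeq (hMeq t ht)
  -- The momentum has been differentiated in two ways; one-sided derivatives are still unique at the
  -- ends of the interval.
  have huniq := (uniqueDiffOn_Icc hT t ht).eq_deriv _ hM' hM''
  have j3 := i3.const_mul 2
  simp_rw [ddot_tens_smul_left, mul_add] at huniq
  exact integral_eq_zero_of_balance i1 i2 j3 i4 i5 i6 huniq

end

/-! ### Skew symmetry of the convection, Jacobians of products, and Korn's inequality -/

section

variable {d : ℕ} {Ω : Set (E d)}

theorem ddot_tens (a b : E d) (A : Matrix (Fin d) (Fin d) ℝ) :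
    ddot (tens a b) A = ∑ j, ∑ i, b j * (A i j * a i) := by
  rw [ddot_eq_sum, Finset.sum_comm]
  exact Finset.sum_congr rfl fun j _ => Finset.sum_congr rfl fun i _ => by
    rw [tens_apply]; ring

/-- The convective form is skew symmetric up to the divergence of the transporting momentum. -/
theorem integral_convection_skew (hd : d = 2 ∨ d = 3) (hbd : Bornology.IsBounded Ω)
    [IsFiniteMeasure (volume.restrict Ω)] {q : E d → ℝ} {a v w : E d → E d}
    (hq : MemH1 Ω q) (hq' : MemLp q ∞ (volume.restrict Ω)) (ha : MemH10v Ω a)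
    (hqa : ∀ j, MemLp (fun x => wd Ω j q x * a x j) 2 (volume.restrict Ω))
    (hv : MemH10v Ω v) (hw : MemH10v Ω w) :
    Integrable (fun x => q x * (ddot (tens (v x) (a x)) (jac Ω w x)
      + ddot (tens (w x) (a x)) (jac Ω v x))
      + (inner ℝ (a x) (grad Ω q x) + q x * dvg Ω a x) * inner ℝ (w x) (v x))
      (volume.restrict Ω) ∧
    ∫ x in Ω, (q x * (ddot (tens (v x) (a x)) (jac Ω w x)
      + ddot (tens (w x) (a x)) (jac Ω v x))
      + (inner ℝ (a x) (grad Ω q x) + q x * dvg Ω a x) * inner ℝ (w x) (v x)) = 0 := by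
  have := holderTriple_four
  have hb : ∀ j, MemLp (fun x => q x * a x j) 4 (volume.restrict Ω) := fun j =>
    memLp_mul hq' ((ha j).memLp_four hd hbd)
  -- The weak derivative of q aⱼ is square integrable only through the hypothesis on ∂ⱼq · aⱼ, as ∇q
  -- alone is merely in L².
  have hc : ∀ j, MemLp (fun x => wd Ω j q x * a x j + q x * jac Ω a x j j) 2
      (volume.restrict Ω) := fun j => (hqa j).add (memLp_mul hq' (ha.jac j j))
  have hvi := fun i => (hv i).memLp_four hd hbd
  have hwi := fun i => (hw i).memLp_four hd hbd
  have h1 : ∀ j i, Integrable (fun x => (q x * a x j) * (jac Ω w x i j * v x i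
      + w x i * jac Ω v x i j)) (volume.restrict Ω) := fun j i => by
    have e1 := integrable_mul_of_memLp (memLp_mul (r := 2) (hb j) (hvi i)) (hw.jac i j)
    have e2 := integrable_mul_of_memLp (memLp_mul (r := 2) (hb j) (hwi i)) (hv.jac i j)
    refine (e1.add e2).congr (Eventually.of_forall fun x => ?_)
    simp only [Pi.add_apply]; ring
  have h2 : ∀ j i, Integrable (fun x => (wd Ω j q x * a x j + q x * jac Ω a x j j)
      * (w x i * v x i)) (volume.restrict Ω) := fun j i =>
    integrable_mul_of_memLp (hc j) (memLp_mul (hwi i) (hvi i))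
  have h3 : ∀ j i, ∫ x in Ω, ((q x * a x j) * (jac Ω w x i j * v x i + w x i * jac Ω v x i j)
      + (wd Ω j q x * a x j + q x * jac Ω a x j j) * (w x i * v x i)) = 0 := fun j i => by
    rw [integral_add (h1 j i) (h2 j i)]
    have := integral_mul_partial_mul hd hbd ((hq.hasWeakPartial j).mul hq' (hq.2 j).2 (ha j))
      (hb j) (hc j) (hw i) (hv i)
    simp only [jac, Matrix.of_apply] at this ⊢
    linarith
  have e : ∀ x, q x * (ddot (tens (v x) (a x)) (jac Ω w x)
      + ddot (tens (w x) (a x)) (jac Ω v x))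
      + (inner ℝ (a x) (grad Ω q x) + q x * dvg Ω a x) * inner ℝ (w x) (v x)
      = ∑ j, ∑ i, ((q x * a x j) * (jac Ω w x i j * v x i + w x i * jac Ω v x i j)
        + (wd Ω j q x * a x j + q x * jac Ω a x j j) * (w x i * v x i)) := fun x => by
    have e1 : inner ℝ (a x) (grad Ω q x) + q x * dvg Ω a x
        = ∑ j, (wd Ω j q x * a x j + q x * jac Ω a x j j) := by
      rw [inner_eq_sum, dvg, Matrix.trace, Finset.mul_sum, ← Finset.sum_add_distrib]
      exact Finset.sum_congr rfl fun j _ => by rw [grad, Matrix.diag_apply]; ring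
    rw [e1, inner_eq_sum, Finset.sum_mul_sum, ddot_tens, ddot_tens, ← Finset.sum_add_distrib,
      Finset.mul_sum, ← Finset.sum_add_distrib]
    refine Finset.sum_congr rfl fun j _ => ?_
    rw [← Finset.sum_add_distrib, Finset.mul_sum, ← Finset.sum_add_distrib]
    exact Finset.sum_congr rfl fun i _ => by ring
  simp only [e]
  have hi : ∀ j i, Integrable (fun x => (q x * a x j) * (jac Ω w x i j * v x i
      + w x i * jac Ω v x i j) + (wd Ω j q x * a x j + q x * jac Ω a x j j) * (w x i * v x i))
      (volume.restrict Ω) := fun j i => (h1 j i).add (h2 j i)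
  refine ⟨integrable_finsetSum _ fun j _ => integrable_finsetSum _ fun i _ => hi j i, ?_⟩
  rw [integral_finsetSum _ fun j _ => integrable_finsetSum _ fun i _ => hi j i]
  refine Finset.sum_eq_zero fun j _ => ?_
  rw [integral_finsetSum _ fun i _ => hi j i]
  exact Finset.sum_eq_zero fun i _ => h3 j i

theorem jac_smul_ae_eq (hΩ : IsOpen Ω) [IsFiniteMeasure (volume.restrict Ω)] {r : E d → ℝ}
    {v m : E d → E d} (hr : MemH1 Ω r) (hr' : MemLp r ∞ (volume.restrict Ω)) (hv : MemH10v Ω v)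
    (hm : ∀ᵐ x ∂(volume.restrict Ω), m x = r x • v x) :
    ∀ᵐ x ∂(volume.restrict Ω), jac Ω m x = r x • jac Ω v x + tens (v x) (grad Ω r x) := by
  have h : ∀ i j, ∀ᵐ x ∂(volume.restrict Ω), wd Ω j (fun y => m y i) x
      = wd Ω j r x * v x i + r x * wd Ω j (fun y => v y i) x := fun i j => by
    have h1 := (hr.hasWeakPartial j).mul hr' (hr.2 j).2 (hv i)
    refine (h1.congr hΩ ?_ (EventuallyEq.refl _ _)).wd_ae_eq hΩ
    filter_upwards [hm] with x hx
    simp [hx]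
  filter_upwards [eventually_all.2 fun i => eventually_all.2 fun j => h i j] with x hx
  ext i j
  simp only [jac, Matrix.of_apply, Matrix.add_apply, Matrix.smul_apply, tens_apply, grad, hx,
    smul_eq_mul]
  ring

/-- Korn's inequality for fields that vanish on the boundary. -/
theorem korn_inequality {v : E d → E d} [IsFiniteMeasure (volume.restrict Ω)] (hv : MemH10v Ω v) :
    ∫ x in Ω, ddot (jac Ω v x) (jac Ω v x)
      ≤ 2 * ∫ x in Ω, ddot (strain Ω v x) (strain Ω v x) := by
  have hJ := hv.jac
  have hi : ∀ a b i j, Integrable (fun x => jac Ω v x a b * jac Ω v x i j) (volume.restrict Ω) :=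
    fun a b i j => integrable_mul_of_memLp (hJ a b) (hJ i j)
  -- Since 2|ε(v)|² = |∇v|² + ∇v : ∇vᵀ, it is enough that the last term has the non-negative
  -- integral of (div v)².
  have hT : ∫ x in Ω, ∑ i, ∑ j, jac Ω v x i j * jac Ω v x j i = ∫ x in Ω, dvg Ω v x ^ 2 := by
    have e : ∀ x, dvg Ω v x ^ 2 = ∑ i, ∑ j, jac Ω v x i i * jac Ω v x j j := fun x => by
      rw [sq, dvg, Matrix.trace, Finset.sum_mul_sum]; rfl
    simp only [e]
    rw [integral_finsetSum _ fun i _ => integrable_finsetSum _ fun j _ => hi _ _ _ _,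
      integral_finsetSum _ fun i _ => integrable_finsetSum _ fun j _ => hi _ _ _ _]
    refine Finset.sum_congr rfl fun i _ => ?_
    rw [integral_finsetSum _ fun j _ => hi _ _ _ _, integral_finsetSum _ fun j _ => hi _ _ _ _]
    refine Finset.sum_congr rfl fun j _ => ?_
    have := integral_partial_mul_partial_comm (hv i) (hv j) i j
    simpa only [jac, Matrix.of_apply] using this
  have hTi : Integrable (fun x => ∑ i, ∑ j, jac Ω v x i j * jac Ω v x j i) (volume.restrict Ω) :=
    integrable_finsetSum _ fun i _ => integrable_finsetSum _ fun j _ => hi _ _ _ _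
  have hD : Integrable (fun x => ddot (jac Ω v x) (jac Ω v x)) (volume.restrict Ω) :=
    hJ.integrable_ddot hJ
  have e2 : ∀ x, 2 * ddot (strain Ω v x) (strain Ω v x)
      = ddot (jac Ω v x) (jac Ω v x) + ∑ i, ∑ j, jac Ω v x i j * jac Ω v x j i := fun x => by
    have h1 : ddot (jac Ω v x) (jac Ω v x) = ∑ i, ∑ j, jac Ω v x j i * jac Ω v x j i :=
      Finset.sum_comm
    have h2 : ddot (strain Ω v x) (strain Ω v x) = ∑ i, ∑ j, (1 / 4) *
        (jac Ω v x i j * jac Ω v x i j + jac Ω v x j i * jac Ω v x j i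
          + 2 * (jac Ω v x i j * jac Ω v x j i)) := by
      simp only [ddot_eq_sum, strain_eq_msym, msym_apply]
      exact Finset.sum_congr rfl fun i _ => Finset.sum_congr rfl fun j _ => by ring
    rw [h2]
    simp only [← Finset.mul_sum, Finset.sum_add_distrib]
    rw [← h1, ← ddot_eq_sum]
    ring
  rw [← integral_const_mul]
  simp only [e2]
  rw [integral_add hD hTi, hT]
  have : 0 ≤ ∫ x in Ω, dvg Ω v x ^ 2 := integral_nonneg fun x => sq_nonneg _
  linarith

end

/-! ### Matrix algebra and the error identity of one time step -/

section

variable {d : ℕ}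

section Frobenius

variable (A B C : Matrix (Fin d) (Fin d) ℝ) (a b c : E d)

theorem ddot_comm : ddot A B = ddot B A := by
  simp only [ddot_eq_sum, mul_comm]

theorem ddot_add_left : ddot (A + B) C = ddot A C + ddot B C := by
  simp only [ddot_eq_sum, Matrix.add_apply, add_mul, Finset.sum_add_distrib]

theorem ddot_sub_left : ddot (A - B) C = ddot A C - ddot B C := by
  simp only [ddot_eq_sum, Matrix.sub_apply, sub_mul, Finset.sum_sub_distrib]

theorem ddot_smul_left (s : ℝ) : ddot (s • A) C = s * ddot A C := by
  simp only [ddot_eq_sum, Matrix.smul_apply, smul_eq_mul, mul_assoc, Finset.mul_sum]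

theorem ddot_sub_right : ddot A (B - C) = ddot A B - ddot A C := by
  rw [ddot_comm, ddot_sub_left, ddot_comm B, ddot_comm C]

theorem msym_sub : msym (A - B) = msym A - msym B := by
  ext i j
  simp only [msym_apply, Matrix.sub_apply]
  ring

theorem ddot_msym_msym : ddot (msym A) (msym B) = ddot A (msym B) := by
  have h1 : ddot A (msym B) = ∑ i, ∑ j, A j i * msym B i j := by
    rw [ddot_eq_sum, Finset.sum_comm]
    refine Finset.sum_congr rfl fun i _ => Finset.sum_congr rfl fun j _ => ?_
    rw [msym_apply, msym_apply]; ring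
  have h2 : ddot (msym A) (msym B) = (1 / 2) * (ddot A (msym B) + ∑ i, ∑ j, A j i * msym B i j) := by
    simp only [ddot_eq_sum, Finset.mul_sum, ← Finset.sum_add_distrib]
    refine Finset.sum_congr rfl fun i _ => Finset.sum_congr rfl fun j _ => ?_
    rw [msym_apply A]; ring
  rw [h2, ← h1]; ring

theorem trace_msym : (msym A).trace = A.trace := by
  simp only [Matrix.trace, Matrix.diag_apply, msym_apply]
  exact Finset.sum_congr rfl fun i _ => by ring

theorem trace_tens : (tens a b).trace = inner ℝ a b := by
  simp only [Matrix.trace, Matrix.diag_apply, tens_apply, inner_eq_sum]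

theorem tens_sub_left : tens (a - b) c = tens a c - tens b c := by
  ext i j
  simp only [tens_apply, Matrix.sub_apply, PiLp.sub_apply, sub_mul]

theorem tens_sub_right : tens a (b - c) = tens a b - tens a c := by
  ext i j
  simp only [tens_apply, Matrix.sub_apply, PiLp.sub_apply, mul_sub]

theorem tens_smul_right (s : ℝ) : tens a (s • b) = s • tens a b := by
  ext i j
  simp only [tens_apply, Matrix.smul_apply, PiLp.smul_apply, smul_eq_mul]
  ring

/-- The Frobenius norm. -/
noncomputable def frob : ℝ := √(ddot A A)

theorem ddot_self_nonneg : 0 ≤ ddot A A :=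
  Finset.sum_nonneg fun _ _ => Finset.sum_nonneg fun _ _ => mul_self_nonneg _

theorem frob_nonneg : 0 ≤ frob A := Real.sqrt_nonneg _

theorem sq_frob : frob A ^ 2 = ddot A A := Real.sq_sqrt (ddot_self_nonneg A)

theorem abs_ddot_le : |ddot A B| ≤ frob A * frob B := by
  have h := Finset.sum_mul_sq_le_sq_mul_sq (Finset.univ : Finset (Fin d × Fin d))
    (fun x => A x.1 x.2) (fun x => B x.1 x.2)
  simp only [Fintype.sum_prod_type, sq] at h
  rw [frob, frob, ← Real.sqrt_mul (ddot_self_nonneg A)]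
  refine Real.abs_le_sqrt ?_
  simpa only [ddot_eq_sum, sq] using h

theorem frob_tens : frob (tens a b) = ‖a‖ * ‖b‖ := by
  rw [frob, ddot_tens]
  have : ∑ j, ∑ i, b j * (tens a b i j * a i) = (‖a‖ * ‖b‖) ^ 2 := by
    rw [mul_pow, ← real_inner_self_eq_norm_sq, ← real_inner_self_eq_norm_sq, inner_eq_sum,
      inner_eq_sum, mul_comm, Finset.sum_mul_sum]
    refine Finset.sum_congr rfl fun j _ => Finset.sum_congr rfl fun i _ => ?_
    rw [tens_apply]; ring
  rw [this, Real.sqrt_sq (by positivity)]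

/-- The trace only sees the symmetric part, and Cauchy–Schwarz over at most three diagonal entries
gives √3. -/
theorem abs_trace_le (hd : d ≤ 3) : |A.trace| ≤ √3 * frob (msym A) := by
  rw [← trace_msym, frob, ← Real.sqrt_mul (by norm_num)]
  refine Real.abs_le_sqrt ?_
  have h1 := Finset.sum_mul_sq_le_sq_mul_sq Finset.univ (fun _ : Fin d => (1 : ℝ))
    (fun i => msym A i i)
  have h2 : ∑ i, msym A i i ^ 2 ≤ ddot (msym A) (msym A) := by
    refine Finset.sum_le_sum fun i _ => ?_
    rw [sq]
    exact Finset.single_le_sum (f := fun j => msym A i j * msym A i j)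
      (fun j _ => mul_self_nonneg _) (Finset.mem_univ i)
  have h3 : (d : ℝ) ≤ 3 := by exact_mod_cast hd
  have h4 : 0 ≤ ∑ i, msym A i i ^ 2 := Finset.sum_nonneg fun i _ => sq_nonneg _
  simp only [one_mul, one_pow, Finset.sum_const, Finset.card_univ, Fintype.card_fin,
    nsmul_eq_mul, mul_one] at h1
  refine h1.trans ?_
  nlinarith

theorem frob_le_of_entries {K : ℝ} (hd : d ≤ 3) (h : ∀ i j, |A i j| ≤ K) : frob A ≤ 3 * |K| := by
  rw [frob]
  refine Real.sqrt_le_iff.2 ⟨by positivity, ?_⟩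
  have h1 : ddot A A ≤ ∑ _i : Fin d, ∑ _j : Fin d, K ^ 2 := by
    refine Finset.sum_le_sum fun i _ => Finset.sum_le_sum fun j _ => ?_
    have := h i j
    rw [← sq]
    exact sq_le_sq' (neg_le_of_abs_le this) (le_of_abs_le this)
  have h3 : (d : ℝ) ≤ 3 := by exact_mod_cast hd
  have h4 : (d : ℝ) * d ≤ 3 * 3 := mul_le_mul h3 h3 (by positivity) (by norm_num)
  simp only [Finset.sum_const, Finset.card_univ, Fintype.card_fin, nsmul_eq_mul] at h1
  rw [mul_pow, sq_abs]
  nlinarith [sq_nonneg K]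

theorem frob_msym_le : frob (msym A) ≤ frob A := by
  have h := abs_ddot_le A (msym A)
  rw [← ddot_msym_msym, ← sq_frob, abs_of_nonneg (sq_nonneg _), sq] at h
  rcases (frob_nonneg (msym A)).eq_or_lt with h0 | h0
  · rw [← h0]; exact frob_nonneg A
  · exact le_of_mul_le_mul_right h h0

end Frobenius

/-- The integrand that remains when the scheme is subtracted from the momentum equation, both
tested with the velocity error, and the skew-symmetric form of the convection is inserted. -/
noncomputable def stepResidual (τ ν μ lam q r P h k R s p : ℝ) (a b U V g : E d)
    (A B J : Matrix (Fin d) (Fin d) ℝ) : ℝ :=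
  P * inner ℝ V (U - b) + P * ddot (tens (U - b) U) J
  + 2 * (k * ddot (msym J) (msym (J - B))) - s * (J - B).trace
  - inner ℝ (τ⁻¹ • (r • b - q • a)) (U - b)
  - 2 * ν * ddot (msym (r • (B - A) + tens (b - a) g)) (msym (J - B))
  - 2 * (h * ddot (msym A) (msym (J - B)))
  - μ * ((r • (B - A) + tens (b - a) g).trace * (J - B).trace)
  - lam * (A.trace * (J - B).trace) + p * (J - B).trace
  + 1 / 2 * (q * A.trace * inner ℝ b (U - b)) + 1 / 2 * (R * inner ℝ b (U - b))
  - q * ddot (tens (U - b) a) J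
  - (R - (r - q) / τ + q * A.trace) * inner ℝ U (U - b)
  + 1 / 2 * ((R - (r - q) / τ + q * A.trace) * inner ℝ (U - b) (U - b))

/-- The algebraic core. Polarisation of the implicit and explicit viscous terms, and likewise of the
grad-div terms, produces differences of squares of old and new errors. The pressure is completed to
a square through s − p' = s − p − λ tr W, which holds because tr J = 0; the resulting −(λ/2)(tr W)²
cancels against the explicit grad-div term. The last bracket, of eleven terms, contains the
consistency errors, the density errors and the remaining convection. -/
theorem stepResidual_eq {τ ν μ lam q r P h k R s s0 p p' : ℝ} {a b U U0 V g e w : E d}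
    {A B J J0 X W : Matrix (Fin d) (Fin d) ℝ} (hτ : τ ≠ 0) (hlam : lam ≠ 0)
    (he : e = U0 - a) (hw : w = U - b) (hX : X = J0 - A) (hW : W = J - B)
    (hJ0 : J0.trace = 0) (hJ : J.trace = 0) (hp' : p' = p - lam * B.trace) :
    τ * stepResidual τ ν μ lam q r P h k R s p a b U V g A B J
      = 1 / 2 * r * ‖w‖ ^ 2 - 1 / 2 * q * ‖e‖ ^ 2 + 1 / 2 * q * ‖w - e‖ ^ 2
        + τ * ((ν * r + h) * frob (msym W) ^ 2 - (ν * r - h) * frob (msym X) ^ 2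
          + (ν * r - h) * frob (msym (W - X)) ^ 2 + 2 * ν * ddot (tens (w - e) g) (msym W))
        + τ * (μ * r / 2 * W.trace ^ 2 - (μ * r - lam) / 2 * X.trace ^ 2
          + (μ * r - lam) / 2 * (W.trace - X.trace) ^ 2 + μ * (inner ℝ (w - e) g * W.trace)
          + (s - p') ^ 2 / (2 * lam) - (s0 - p) ^ 2 / (2 * lam))
        + ((P - q) * inner ℝ (U - U0) w + P * inner ℝ (τ • V - (U - U0)) w
          + τ * ddot (tens w (P • U - q • a)) J - τ * (1 / 2 * (R * inner ℝ U w))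
          + τ * (1 / 2 * (q * X.trace * inner ℝ U w))
          + τ * (2 * ((k - h) * ddot (msym J) (msym W)))
          + τ * (2 * ((h - ν * r) * ddot (msym (J - J0)) (msym W)))
          - τ * (2 * ν * ddot (tens (U - U0) g) (msym W))
          - τ * (μ * (inner ℝ (U - U0) g * W.trace))
          - τ * ((s - s0) ^ 2 / (2 * lam)) - τ * ((s0 - p) * (s - s0) / lam)) := by
  obtain rfl : a = U0 - e := by rw [he]; abel
  obtain rfl : b = U - w := by rw [hw]; abel
  obtain rfl : A = J0 - X := by rw [hX]; abel
  obtain rfl : B = J - W := by rw [hW]; abel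
  rw [hp', stepResidual]
  simp only [sub_sub_cancel, ddot_msym_msym, sq_frob, msym_sub, ← real_inner_self_eq_norm_sq]
  simp only [ddot_sub_right, ddot_add_left, ddot_sub_left, ddot_smul_left, tens_sub_left,
    tens_sub_right, tens_smul_right, inner_sub_left, inner_sub_right, real_inner_smul_left,
    Matrix.trace_sub, Matrix.trace_add, Matrix.trace_smul, trace_tens, smul_eq_mul, hJ, hJ0,
    ddot_msym_msym]
  have c : ddot W (msym X) = ddot X (msym W) := by
    rw [← ddot_msym_msym, ddot_comm, ddot_msym_msym]
  rw [c, real_inner_comm w e, real_inner_comm w U, real_inner_comm w U0]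
  field_simp
  ring

end

/-! ### The pointwise energy inequality of one time step -/

section

variable {d : ℕ}

/-- The constant in the local energy inequality. -/
noncomputable def stepConst (L m : ℝ) : ℝ := 2 * (8 * L ^ 3) + 6 * (8 * L ^ 3) ^ 2 / m

/-- x stands for |ε(w)| and y for |ε(e)|. Three products with x cost m/24 each, hence m/8 in total;
the single product with y costs m/16, half of that, so that summation over the steps can absorb it.
-/
theorem young_collect {M m τ x y D w e a b R c : ℝ} (hM : 0 ≤ M) (hm : 0 < m) (hτ : 0 ≤ τ)
    (hτ1 : τ ≤ 1) :
    M * (w * τ + w * a + w * e + R * w + y * w + b * x + D * x + √τ * x + τ ^ 2 + τ * c)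
      ≤ m / 8 * x ^ 2 + m / 16 * y ^ 2
        + (2 * M + 6 * M ^ 2 / m) * (e ^ 2 + w ^ 2 + a ^ 2 + b ^ 2 + R ^ 2 + D ^ 2 + τ
          + τ * c ^ 2) := by
  have hs := Real.sq_sqrt hτ
  set σ := √τ
  set N := M ^ 2 / m with hN
  have hN0 : 0 ≤ N := by positivity
  have key : ∀ s t : ℝ, M * (s * t) ≤ m / 24 * t ^ 2 + 6 * N * s ^ 2 := fun s t => by
    have h : m / 24 * t ^ 2 + 6 * N * s ^ 2 - M * (s * t) = (m * t - 12 * M * s) ^ 2 / (24 * m) := by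
      rw [hN]; field_simp; ring
    have : 0 ≤ (m * t - 12 * M * s) ^ 2 / (24 * m) := by positivity
    linarith
  have key2 : M * (y * w) ≤ m / 16 * y ^ 2 + 4 * N * w ^ 2 := by
    have h : m / 16 * y ^ 2 + 4 * N * w ^ 2 - M * (y * w) = (m * y - 8 * M * w) ^ 2 / (16 * m) := by
      rw [hN]; field_simp; ring
    have : 0 ≤ (m * y - 8 * M * w) ^ 2 / (16 * m) := by positivity
    linarith
  have k1 := key b x
  have k2 := key D x
  have k3 := key σ x
  have yo : ∀ s t : ℝ, M * (s * t) ≤ M * (1 / 2 * s ^ 2 + 1 / 2 * t ^ 2) := fun s t =>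
    mul_le_mul_of_nonneg_left (by nlinarith [sq_nonneg (s - t)]) hM
  have y1 := yo w τ
  have y2 := yo w a
  have y3 := yo w e
  have y4 := yo R w
  have hτ2 : τ ^ 2 ≤ τ := by nlinarith
  have y5 : M * (τ * c) ≤ M * (1 / 2 * τ + 1 / 2 * (τ * c ^ 2)) :=
    mul_le_mul_of_nonneg_left (by nlinarith [mul_nonneg hτ (sq_nonneg (1 - c))]) hM
  have hMτ := mul_le_mul_of_nonneg_left hτ2 hM
  have e1 : 6 * M ^ 2 / m = 6 * N := by rw [hN]; ring
  rw [e1]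
  rw [hs] at k3
  have p1 : 0 ≤ M * τ := by positivity
  have p2 : 0 ≤ M * e ^ 2 := by positivity
  have p3 : 0 ≤ M * a ^ 2 := by positivity
  have p4 : 0 ≤ M * R ^ 2 := by positivity
  have p5 : 0 ≤ M * b ^ 2 := by positivity
  have p6 : 0 ≤ M * D ^ 2 := by positivity
  have p7 : 0 ≤ M * (τ * c ^ 2) := by positivity
  have q1 : 0 ≤ N * e ^ 2 := by positivity
  have q2 : 0 ≤ N * a ^ 2 := by positivity
  have q3 : 0 ≤ N * R ^ 2 := by positivity
  have q4 : 0 ≤ N * w ^ 2 := by positivity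
  have q5 : 0 ≤ N * (τ * c ^ 2) := by positivity
  linarith

theorem abs_le_sum_eleven {t₁ t₂ t₃ t₄ t₅ t₆ t₇ t₈ t₉ t₁₀ t₁₁ b₁ b₂ b₃ b₄ b₅ b₆ b₇ b₈ b₉ b₁₀ b₁₁ : ℝ}
    (h₁ : |t₁| ≤ b₁) (h₂ : |t₂| ≤ b₂) (h₃ : |t₃| ≤ b₃) (h₄ : |t₄| ≤ b₄) (h₅ : |t₅| ≤ b₅)
    (h₆ : |t₆| ≤ b₆) (h₇ : |t₇| ≤ b₇) (h₈ : |t₈| ≤ b₈) (h₉ : |t₉| ≤ b₉) (h₁₀ : |t₁₀| ≤ b₁₀)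
    (h₁₁ : |t₁₁| ≤ b₁₁) :
    |t₁ + t₂ + t₃ - t₄ + t₅ + t₆ + t₇ - t₈ - t₉ - t₁₀ - t₁₁|
      ≤ b₁ + b₂ + b₃ + b₄ + b₅ + b₆ + b₇ + b₈ + b₉ + b₁₀ + b₁₁ := by
  rw [abs_le] at *
  constructor <;> linarith

/-- The bounds at a point that the local energy inequality uses. -/
structure StepBounds (L m τ ν μ lam q r P P0 h k s s0 : ℝ) (U U0 V g : E d)
    (J : Matrix (Fin d) (Fin d) ℝ) : Prop where
  one_le : 1 ≤ L
  m_pos : 0 < m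
  tau_pos : 0 < τ
  tau_le : τ ≤ 1
  nu_nonneg : 0 ≤ ν
  nu_le : ν ≤ L
  mu_nonneg : 0 ≤ μ
  lam_pos : 0 < lam
  inv_lam_le : lam⁻¹ ≤ L
  q_nonneg : 0 ≤ q
  q_le : q ≤ L
  r_nonneg : 0 ≤ r
  r_le : r ≤ L
  P_le : |P| ≤ L
  P_sub_le : |P - P0| ≤ L * τ
  m_le : m ≤ h
  h_le : h ≤ L
  k_sub_le : |k - h| ≤ L * |P - r|
  s_sub_le : |s - s0| ≤ L * τ
  U_le : ‖U‖ ≤ L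
  U_sub_le : ‖U - U0‖ ≤ L * τ
  taylor : ‖τ • V - (U - U0)‖ ≤ L * τ ^ 2
  J_le : frob J ≤ L
  nu_r : h ≤ ν * r
  mu_r : lam ≤ μ * r
  nu_incr : ν * (r - q) ≤ h
  mu_incr : μ * (r - q) ≤ lam
  nu_grad : √τ * (2 * ν * ‖g‖) ≤ 1 / 4 * √(q * h)
  mu_grad : √τ * (μ * ‖g‖) ≤ 1 / 2 * √(q * h)

/-- The density of the discrete energy. -/
noncomputable def energyDensity (τ ν μ lam q c : ℝ) (e : E d) (X : Matrix (Fin d) (Fin d) ℝ) : ℝ :=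
  1 / 2 * q * ‖e‖ ^ 2
    + τ * (ν * q * frob (msym X) ^ 2 + μ * q / 2 * X.trace ^ 2 + c ^ 2 / (2 * lam))

section

variable {L m τ ν μ lam q r P P0 h k s s0 R p p' : ℝ} {a b U V g U0 e w z : E d}
  {A B J J0 X W : Matrix (Fin d) (Fin d) ℝ}

/-- In these terms ∇ρⁿ⁺¹, of size τ^(-1/2), multiplies the increment z of the error. One factor √τ
tames the gradient, the other goes with |ε(w)|, and ½ q|z|² comes from the implicit time derivative.
-/
theorem StepBounds.cross_le (H : StepBounds L m τ ν μ lam q r P P0 h k s s0 U U0 V g J)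
    (hd : d ≤ 3) :
    τ * (2 * ν * |ddot (tens z g) (msym W)|) + τ * (μ * |inner ℝ z g * W.trace|)
      ≤ 1 / 2 * q * ‖z‖ ^ 2 + τ * (3 / 4 * (h * frob (msym W) ^ 2)) := by
  have hν := H.nu_nonneg
  have hμ := H.mu_nonneg
  have hq := H.q_nonneg
  have hτ := H.tau_pos.le
  have hh : 0 ≤ h := H.m_pos.le.trans H.m_le
  set x := frob (msym W)
  have hx : 0 ≤ x := frob_nonneg _
  have h1 : |ddot (tens z g) (msym W)| ≤ ‖z‖ * ‖g‖ * x := by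
    rw [← frob_tens]; exact abs_ddot_le _ _
  have h2 : |inner ℝ z g * W.trace| ≤ (‖z‖ * ‖g‖) * (√3 * x) := by
    rw [abs_mul]
    exact mul_le_mul (abs_real_inner_le_norm _ _) (abs_trace_le W hd) (abs_nonneg _) (by positivity)
  have h3 : √3 ≤ 1733 / 1000 := Real.sqrt_le_iff.2 ⟨by norm_num, by norm_num⟩
  have hσ := Real.sq_sqrt hτ
  have hS := Real.sq_sqrt (mul_nonneg hq hh)
  have gν := H.nu_grad
  have gμ := H.mu_grad
  have hσ0 := Real.sqrt_nonneg τ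
  have hS0 := Real.sqrt_nonneg (q * h)
  set σ := √τ
  set S := √(q * h)
  have a1 : τ * (2 * ν * |ddot (tens z g) (msym W)|) ≤ σ * (‖z‖ * x) * (1 / 4 * S) := by
    calc τ * (2 * ν * |ddot (tens z g) (msym W)|) ≤ τ * (2 * ν * (‖z‖ * ‖g‖ * x)) := by gcongr
      _ = σ * (‖z‖ * x) * (σ * (2 * ν * ‖g‖)) := by rw [← hσ]; ring
      _ ≤ _ := by gcongr
  have a2 : τ * (μ * |inner ℝ z g * W.trace|) ≤ σ * (‖z‖ * x) * (1733 / 2000 * S) := by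
    calc τ * (μ * |inner ℝ z g * W.trace|) ≤ τ * (μ * (‖z‖ * ‖g‖ * (√3 * x))) := by gcongr
      _ = σ * (‖z‖ * x) * (√3 * (σ * (μ * ‖g‖))) := by rw [← hσ]; ring
      _ ≤ σ * (‖z‖ * x) * (1733 / 1000 * (1 / 2 * S)) := by gcongr
      _ = _ := by ring
  have a3 : σ * (‖z‖ * x) * (2233 / 2000 * S)
      ≤ 1 / 2 * q * ‖z‖ ^ 2 + τ * (3 / 4 * (h * x ^ 2)) := by
    have hq' := Real.sq_sqrt hq
    have hh' := Real.sq_sqrt hh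
    have hSe : S = √q * √h := Real.sqrt_mul hq h
    -- 2233/2000 = 1/4 + 1733/2000 dominates 1/4 + √3/2, and its square is below 4 · ½ · ¾, so
    -- Young's inequality applies.
    have key : ∀ s t : ℝ, 2233 / 2000 * (s * t) ≤ 1 / 2 * s ^ 2 + 3 / 4 * t ^ 2 := fun s t => by
      nlinarith [sq_nonneg (s - 1.2 * t), sq_nonneg t]
    calc σ * (‖z‖ * x) * (2233 / 2000 * S)
        = 2233 / 2000 * ((√q * ‖z‖) * (σ * √h * x)) := by rw [hSe]; ring
      _ ≤ 1 / 2 * (√q * ‖z‖) ^ 2 + 3 / 4 * (σ * √h * x) ^ 2 := key _ _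
      _ = _ := by rw [mul_pow, mul_pow, mul_pow, hq', hh', hσ]; ring
  linarith

/-- The squares of W − X have the sign of νr − h and μr − λ and are dropped. The increment bounds
replace r by q in the coefficients of X, so that the old energy appears. Of the dissipation
h|ε(w)|², three quarters go to the gradient terms and m/4 survives. -/
theorem StepBounds.energy_le (H : StepBounds L m τ ν μ lam q r P P0 h k s s0 U U0 V g J)
    (hd : d ≤ 3) :
    energyDensity τ ν μ lam r (s - p') w W - energyDensity τ ν μ lam q (s0 - p) e X
      + τ * (m / 4 * frob (msym W) ^ 2)
    ≤ 1 / 2 * r * ‖w‖ ^ 2 - 1 / 2 * q * ‖e‖ ^ 2 + 1 / 2 * q * ‖w - e‖ ^ 2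
        + τ * ((ν * r + h) * frob (msym W) ^ 2 - (ν * r - h) * frob (msym X) ^ 2
          + (ν * r - h) * frob (msym (W - X)) ^ 2 + 2 * ν * ddot (tens (w - e) g) (msym W))
        + τ * (μ * r / 2 * W.trace ^ 2 - (μ * r - lam) / 2 * X.trace ^ 2
          + (μ * r - lam) / 2 * (W.trace - X.trace) ^ 2 + μ * (inner ℝ (w - e) g * W.trace)
          + (s - p') ^ 2 / (2 * lam) - (s0 - p) ^ 2 / (2 * lam)) := by
  have hc := H.cross_le (z := w - e) (W := W) hd
  have hν := H.nu_nonneg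
  have hμ := H.mu_nonneg
  have hτ := H.tau_pos.le
  have c1 := mul_le_mul_of_nonneg_left (neg_abs_le (ddot (tens (w - e) g) (msym W)))
    (by positivity : 0 ≤ τ * (2 * ν))
  have c2 := mul_le_mul_of_nonneg_left (neg_abs_le (inner ℝ (w - e) g * W.trace))
    (by positivity : 0 ≤ τ * μ)
  have b1 := mul_nonneg (mul_nonneg hτ (sub_nonneg.2 H.nu_r)) (sq_nonneg (frob (msym (W - X))))
  have b2 := mul_nonneg (mul_nonneg hτ (sub_nonneg.2 H.mu_r)) (sq_nonneg (W.trace - X.trace))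
  have b3 := mul_nonneg (mul_nonneg hτ (sub_nonneg.2 H.nu_incr)) (sq_nonneg (frob (msym X)))
  have b4 := mul_nonneg (mul_nonneg hτ (sub_nonneg.2 H.mu_incr)) (sq_nonneg (X.trace))
  have b5 := mul_nonneg (mul_nonneg hτ (sub_nonneg.2 H.m_le)) (sq_nonneg (frob (msym W)))
  simp only [energyDensity]
  linarith

/-- Every term carries a factor τ once the increments of U, s and P, which are of size Lτ, are
inserted; the powers of L are rounded up to L³. -/
theorem StepBounds.error_le (H : StepBounds L m τ ν μ lam q r P P0 h k s s0 U U0 V g J)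
    (hd : d ≤ 3) (he : e = U0 - a) :
    |(P - q) * inner ℝ (U - U0) w + P * inner ℝ (τ • V - (U - U0)) w
      + τ * ddot (tens w (P • U - q • a)) J - τ * (1 / 2 * (R * inner ℝ U w))
      + τ * (1 / 2 * (q * X.trace * inner ℝ U w))
      + τ * (2 * ((k - h) * ddot (msym J) (msym W)))
      + τ * (2 * ((h - ν * r) * ddot (msym (J - J0)) (msym W)))
      - τ * (2 * ν * ddot (tens (U - U0) g) (msym W))
      - τ * (μ * (inner ℝ (U - U0) g * W.trace))
      - τ * ((s - s0) ^ 2 / (2 * lam)) - τ * ((s0 - p) * (s - s0) / lam)|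
    ≤ τ * (8 * L ^ 3 * (‖w‖ * τ + ‖w‖ * |P0 - q| + ‖w‖ * ‖e‖ + |R| * ‖w‖ + frob (msym X) * ‖w‖
        + |P - r| * frob (msym W) + frob (msym (J - J0)) * frob (msym W) + √τ * frob (msym W)
        + τ ^ 2 + τ * |s0 - p|)) := by
  have hL := H.one_le
  have hL0 : 0 ≤ L := by linarith
  have hτ := H.tau_pos.le
  have hν := H.nu_nonneg
  have hμ := H.mu_nonneg
  have hq0 := H.q_nonneg
  have hq := H.q_le
  have hτ1 := H.tau_le
  have hlam := H.lam_pos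
  have hw0 := norm_nonneg w
  have he0 := norm_nonneg e
  have hx0 := frob_nonneg (msym W)
  have hy0 := frob_nonneg (msym X)
  have hD0 := frob_nonneg (msym (J - J0))
  have ha0 := abs_nonneg (P0 - q)
  have hb0 := abs_nonneg (P - r)
  have hc0 := abs_nonneg (s0 - p)
  have hR0 := abs_nonneg R
  have hσ := Real.sq_sqrt hτ
  have hσ0 := Real.sqrt_nonneg τ
  have h3 : √3 ≤ 2 := Real.sqrt_le_iff.2 ⟨by norm_num, by norm_num⟩
  have htX : |X.trace| ≤ 2 * frob (msym X) := (abs_trace_le X hd).trans (by gcongr)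
  have htW : |W.trace| ≤ 2 * frob (msym W) := (abs_trace_le W hd).trans (by gcongr)
  have hPq : |P - q| ≤ L * τ + |P0 - q| := by
    have : P - q = (P - P0) + (P0 - q) := by ring
    rw [this]; exact (abs_add_le _ _).trans (by gcongr; exact H.P_sub_le)
  have hUw : |inner ℝ U w| ≤ L * ‖w‖ := (abs_real_inner_le_norm _ _).trans
    (by gcongr; exact H.U_le)
  have hS : √(q * h) ≤ L := by
    refine Real.sqrt_le_iff.2 ⟨hL0, ?_⟩
    rw [sq]
    exact mul_le_mul hq H.h_le (H.m_pos.le.trans H.m_le) hL0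
  have hJ0 := frob_nonneg J
  have gν : √τ * (2 * ν * ‖g‖) ≤ 1 / 4 * L := H.nu_grad.trans (by gcongr)
  have gμ : √τ * (μ * ‖g‖) ≤ 1 / 2 * L := H.mu_grad.trans (by gcongr)
  set x := frob (msym W)
  set y := frob (msym X)
  set D := frob (msym (J - J0))
  set σ := √τ
  have t1 : |(P - q) * inner ℝ (U - U0) w| ≤ τ * ((L * τ + |P0 - q|) * (L * ‖w‖)) := by
    rw [abs_mul]
    calc |P - q| * |inner ℝ (U - U0) w| ≤ (L * τ + |P0 - q|) * (‖U - U0‖ * ‖w‖) := by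
          gcongr; exact abs_real_inner_le_norm _ _
      _ ≤ (L * τ + |P0 - q|) * (L * τ * ‖w‖) := by gcongr; exact H.U_sub_le
      _ = _ := by ring
  have t2 : |P * inner ℝ (τ • V - (U - U0)) w| ≤ τ * (L * (L * τ * ‖w‖)) := by
    rw [abs_mul]
    calc |P| * |inner ℝ (τ • V - (U - U0)) w| ≤ L * (‖τ • V - (U - U0)‖ * ‖w‖) := by
          gcongr
          · exact H.P_le
          · exact abs_real_inner_le_norm _ _
      _ ≤ L * (L * τ ^ 2 * ‖w‖) := by gcongr; exact H.taylor
      _ = _ := by ring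
  have t3 : |τ * ddot (tens w (P • U - q • a)) J|
      ≤ τ * (‖w‖ * ((L * τ + |P0 - q|) * L + L * (L * τ + ‖e‖)) * L) := by
    -- The difference of transporting momenta splits into a density error, a time increment and the
    -- velocity error.
    have e1 : P • U - q • a = (P - q) • U + q • ((U - U0) + e) := by rw [he]; module
    have e2 : ‖P • U - q • a‖ ≤ (L * τ + |P0 - q|) * L + L * (L * τ + ‖e‖) := by
      rw [e1]
      refine (norm_add_le _ _).trans ?_
      rw [norm_smul, norm_smul, Real.norm_eq_abs, Real.norm_eq_abs, abs_of_nonneg hq0]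
      gcongr
      · exact H.U_le
      · exact (norm_add_le _ _).trans (by gcongr; exact H.U_sub_le)
    rw [abs_mul, abs_of_nonneg hτ]
    gcongr
    refine (abs_ddot_le _ _).trans ?_
    rw [frob_tens]
    gcongr
    exact H.J_le
  have t4 : |τ * (1 / 2 * (R * inner ℝ U w))| ≤ τ * (1 / 2 * (|R| * (L * ‖w‖))) := by
    rw [abs_mul, abs_mul, abs_mul, abs_of_nonneg hτ, abs_of_pos (by norm_num : (0 : ℝ) < 1 / 2)]
    gcongr
  have t5 : |τ * (1 / 2 * (q * X.trace * inner ℝ U w))|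
      ≤ τ * (1 / 2 * (L * (2 * y) * (L * ‖w‖))) := by
    rw [abs_mul, abs_mul, abs_mul, abs_mul, abs_of_nonneg hτ, abs_of_nonneg hq0,
      abs_of_pos (by norm_num : (0 : ℝ) < 1 / 2)]
    gcongr
  have t6 : |τ * (2 * ((k - h) * ddot (msym J) (msym W)))|
      ≤ τ * (2 * (L * |P - r| * (L * x))) := by
    rw [abs_mul, abs_mul, abs_mul, abs_of_nonneg hτ, abs_of_pos (by norm_num : (0 : ℝ) < 2)]
    gcongr
    · exact H.k_sub_le
    · exact (abs_ddot_le _ _).trans (by gcongr; exact (frob_msym_le J).trans H.J_le)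
  have t7 : |τ * (2 * ((h - ν * r) * ddot (msym (J - J0)) (msym W)))|
      ≤ τ * (2 * ((L * L) * (D * x))) := by
    rw [abs_mul, abs_mul, abs_mul, abs_of_nonneg hτ, abs_of_pos (by norm_num : (0 : ℝ) < 2)]
    gcongr
    · rw [abs_sub_comm, abs_of_nonneg (sub_nonneg.2 H.nu_r)]
      have := mul_le_mul H.nu_le H.r_le H.r_nonneg hL0
      linarith [H.m_pos, H.m_le]
    · exact abs_ddot_le _ _
  -- The increment τ of the velocity meets a gradient of size τ^(-1/2), and only √τ remains; this
  -- term limits the rate.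
  have t8 : |τ * (2 * ν * ddot (tens (U - U0) g) (msym W))| ≤ τ * (σ * (1 / 4 * L) * L * x) := by
    rw [abs_mul, abs_mul, abs_of_nonneg hτ, abs_of_nonneg (by positivity : 0 ≤ 2 * ν)]
    refine mul_le_mul_of_nonneg_left ?_ hτ
    calc 2 * ν * |ddot (tens (U - U0) g) (msym W)| ≤ 2 * ν * (‖U - U0‖ * ‖g‖ * x) := by
          gcongr
          rw [← frob_tens]; exact abs_ddot_le _ _
      _ ≤ 2 * ν * (L * τ * ‖g‖ * x) := by gcongr; exact H.U_sub_le
      _ = σ * (σ * (2 * ν * ‖g‖)) * L * x := by rw [← hσ]; ring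
      _ ≤ σ * (1 / 4 * L) * L * x := by
          gcongr
  have t9 : |τ * (μ * (inner ℝ (U - U0) g * W.trace))| ≤ τ * (σ * (1 / 2 * L) * L * (2 * x)) := by
    rw [abs_mul, abs_mul, abs_mul, abs_of_nonneg hτ, abs_of_nonneg hμ]
    refine mul_le_mul_of_nonneg_left ?_ hτ
    calc μ * (|inner ℝ (U - U0) g| * |W.trace|) ≤ μ * ((‖U - U0‖ * ‖g‖) * (2 * x)) := by
          gcongr
          exact abs_real_inner_le_norm _ _
      _ ≤ μ * ((L * τ * ‖g‖) * (2 * x)) := by gcongr; exact H.U_sub_le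
      _ = σ * (σ * (μ * ‖g‖)) * L * (2 * x) := by rw [← hσ]; ring
      _ ≤ σ * (1 / 2 * L) * L * (2 * x) := by
          gcongr
  have t10 : |τ * ((s - s0) ^ 2 / (2 * lam))| ≤ τ * (1 / 2 * L * (L * τ) ^ 2) := by
    rw [abs_mul, abs_of_nonneg hτ, abs_of_nonneg (by positivity)]
    gcongr
    calc (s - s0) ^ 2 / (2 * lam) = 1 / 2 * lam⁻¹ * |s - s0| ^ 2 := by
          rw [sq_abs]; field_simp
      _ ≤ _ := by gcongr; exacts [H.inv_lam_le, H.s_sub_le]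
  have t11 : |τ * ((s0 - p) * (s - s0) / lam)| ≤ τ * (|s0 - p| * (L * τ) * L) := by
    rw [div_eq_mul_inv, abs_mul, abs_mul, abs_mul, abs_of_nonneg hτ,
      abs_of_pos (inv_pos.2 hlam)]
    gcongr
    exacts [H.s_sub_le, H.inv_lam_le]
  have hL2 : L ≤ L ^ 3 := le_self_pow₀ hL (by norm_num)
  have hL3 : L ^ 2 ≤ L ^ 3 := pow_le_pow_right₀ hL (by norm_num)
  refine (abs_le_sum_eleven t1 t2 t3 t4 t5 t6 t7 t8 t9 t10 t11).trans ?_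
  simp only [← mul_add]
  refine mul_le_mul_of_nonneg_left ?_ hτ
  have m1 : ∀ z, 0 ≤ z → L * z ≤ L ^ 3 * z := fun z hz => mul_le_mul_of_nonneg_right hL2 hz
  have m2 : ∀ z, 0 ≤ z → L ^ 2 * z ≤ L ^ 3 * z := fun z hz => mul_le_mul_of_nonneg_right hL3 hz
  have m3 : ∀ z, 0 ≤ z → 0 ≤ L ^ 3 * z := fun z hz => by positivity
  have w1 := m2 (‖w‖ * τ) (by positivity)
  have w2 := m1 (‖w‖ * |P0 - q|) (by positivity)
  have w3 := m2 (‖w‖ * |P0 - q|) (by positivity)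
  have w19 := m3 (‖w‖ * |P0 - q|) (by positivity)
  have w20 := m2 (‖w‖ * ‖e‖) (by positivity)
  have w4 := m3 (‖w‖ * ‖e‖) (by positivity)
  have w5 := m1 (|R| * ‖w‖) (by positivity)
  have w6 := m2 (y * ‖w‖) (by positivity)
  have w7 := m2 (|P - r| * x) (by positivity)
  have w8 := m2 (D * x) (by positivity)
  have w9 := m2 (σ * x) (by positivity)
  have w10 := m3 (τ ^ 2) (by positivity)
  have w11 := m2 (τ * |s0 - p|) (by positivity)
  have w12 := m3 (|R| * ‖w‖) (by positivity)
  have w13 := m3 (‖w‖ * τ) (by positivity)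
  have w14 := m3 (y * ‖w‖) (by positivity)
  have w15 := m3 (|P - r| * x) (by positivity)
  have w16 := m3 (D * x) (by positivity)
  have w17 := m3 (σ * x) (by positivity)
  have w18 := m3 (τ * |s0 - p|) (by positivity)
  linarith

/-- Half of the surviving dissipation m/4 pays for the products with |ε(w)|. What remains, m/8, is
twice the m/16 lost on |ε(e)| of the previous step. -/
theorem StepBounds.le_stepResidual (H : StepBounds L m τ ν μ lam q r P P0 h k s s0 U U0 V g J)
    (hd : d ≤ 3) (he : e = U0 - a) (hw : w = U - b) (hX : X = J0 - A) (hW : W = J - B)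
    (hJ0 : J0.trace = 0) (hJ : J.trace = 0) (hp' : p' = p - lam * B.trace) :
    energyDensity τ ν μ lam r (s - p') w W - energyDensity τ ν μ lam q (s0 - p) e X
      + τ * (m / 8 * frob (msym W) ^ 2 - m / 16 * frob (msym X) ^ 2
        - stepConst L m * (‖e‖ ^ 2 + ‖w‖ ^ 2 + (P0 - q) ^ 2 + (P - r) ^ 2 + R ^ 2
          + frob (msym (J - J0)) ^ 2 + τ + τ * (s0 - p) ^ 2))
    ≤ τ * stepResidual τ ν μ lam q r P h k R s p a b U V g A B J := by
  rw [stepResidual_eq (s0 := s0) H.tau_pos.ne' H.lam_pos.ne' he hw hX hW hJ0 hJ hp']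
  have h1 := H.energy_le (p := p) (p' := p') (e := e) (w := w) (X := X) (W := W) hd
  have h2 := neg_le_of_abs_le (H.error_le (w := w) (X := X) (W := W) (J0 := J0) (R := R)
    (p := p) hd he)
  have h3 := mul_le_mul_of_nonneg_left (young_collect (M := 8 * L ^ 3) (m := m) (τ := τ)
    (x := frob (msym W)) (y := frob (msym X)) (D := frob (msym (J - J0))) (w := ‖w‖) (e := ‖e‖)
    (a := |P0 - q|) (b := |P - r|) (R := |R|) (c := |s0 - p|)
    (by have := H.one_le; positivity) H.m_pos H.tau_pos.le H.tau_le) H.tau_pos.le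
  simp only [sq_abs] at h3
  rw [stepConst]
  linarith

end

end

/-! ### The strain rate of time increments of the exact velocity -/

section

variable {d : ℕ} {Ω : Set (E d)} {T K : ℝ} {f : ℝ → LpΩ (E d) 2 Ω} {ρ : ℝ → LpΩ ℝ ∞ Ω}
  {u u' : ℝ → LpΩ (E d) ∞ Ω} {p : ℝ → LpΩ ℝ ∞ Ω}

/-- Two integrands of the momentum equation, at times t and s, tested with v = u(t) − u(s) and
subtracted. All terms without strain are bounded times |v| ≤ Lτ, and the pressure drops out because
v is divergence free. Coercivity comes from the discrete viscosity h ≥ m, since no lower bound on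
the exact viscosity k is available; replacing k by h costs the density error P − r. -/
theorem strain_sub_sq_le {L m τ P P0 r h k k0 s s0 : ℝ} {U U0 V V0 F F0 v : E d}
    {J J0 X : Matrix (Fin d) (Fin d) ℝ} (hL : 1 ≤ L) (hm : 0 < m) (hτ : 0 ≤ τ)
    (hP : |P| ≤ L) (hP0 : |P0| ≤ L) (hV : ‖V‖ ≤ L) (hV0 : ‖V0‖ ≤ L) (hU : ‖U‖ ≤ L)
    (hU0 : ‖U0‖ ≤ L) (hv : ‖v‖ ≤ L * τ) (hJ : frob J ≤ L) (hJ0 : frob J0 ≤ L)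
    (hk : |k - h| ≤ L * |P - r|) (hk0 : |k - k0| ≤ L * τ) (hmh : m ≤ h)
    (hX : X = J - J0) (htr : X.trace = 0) :
    m * frob (msym X) ^ 2 ≤
      ((P * inner ℝ V v + P * ddot (tens v U) J + 2 * (k * ddot (msym J) (msym X))
        - s * X.trace - inner ℝ F v)
      - (P0 * inner ℝ V0 v + P0 * ddot (tens v U0) J0 + 2 * (k0 * ddot (msym J0) (msym X))
        - s0 * X.trace - inner ℝ F0 v))
      + (4 * L ^ 4 / m * (P - r) ^ 2 + 10 * L ^ 4 * τ + L * τ * (‖F‖ ^ 2 + ‖F0‖ ^ 2)) := by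
  have hL0 : 0 ≤ L := by linarith
  have hy0 := frob_nonneg (msym X)
  have hy : frob (msym X) ≤ 2 * L := by
    refine (frob_msym_le X).trans ?_
    have h1 : frob X ^ 2 ≤ 2 * L * frob X := by
      have e : frob X ^ 2 = ddot J X - ddot J0 X := by rw [sq_frob, ← ddot_sub_left, ← hX]
      have h1 := (le_abs_self _).trans (abs_ddot_le J X)
      have h2 := (neg_le_abs _).trans (abs_ddot_le J0 X)
      have h3 := mul_le_mul_of_nonneg_right hJ (frob_nonneg X)
      have h4 := mul_le_mul_of_nonneg_right hJ0 (frob_nonneg X)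
      linarith
    rcases (frob_nonneg X).eq_or_lt with h0 | h0
    · rw [← h0]; positivity
    · rw [sq] at h1; exact le_of_mul_le_mul_right h1 h0
  have e : k * ddot (msym J) (msym X) - k0 * ddot (msym J0) (msym X)
      = h * frob (msym X) ^ 2 + (k - h) * frob (msym X) ^ 2
        + (k - k0) * ddot (msym J0) (msym X) := by
    have : ddot (msym X) (msym X) = ddot (msym J) (msym X) - ddot (msym J0) (msym X) := by
      rw [← ddot_sub_left, ← msym_sub, ← hX]
    rw [sq_frob, this]; ring
  have i1 : ∀ a : E d, ‖a‖ ≤ L → ∀ c, |c| ≤ L → |c * inner ℝ a v| ≤ L ^ 3 * τ := by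
    intro a ha c hc
    rw [abs_mul]
    calc |c| * |inner ℝ a v| ≤ L * (‖a‖ * ‖v‖) := by
          gcongr; exact abs_real_inner_le_norm _ _
      _ ≤ L * (L * (L * τ)) := by gcongr
      _ = _ := by ring
  have i2 : ∀ (a : E d) (A : Matrix (Fin d) (Fin d) ℝ), ‖a‖ ≤ L → frob A ≤ L → ∀ c, |c| ≤ L →
      |c * ddot (tens v a) A| ≤ L ^ 4 * τ := by
    intro a A ha hA c hc
    rw [abs_mul]
    calc |c| * |ddot (tens v a) A| ≤ L * (‖v‖ * ‖a‖ * frob A) := by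
          gcongr; rw [← frob_tens]; exact abs_ddot_le _ _
      _ ≤ L * (L * τ * L * L) := by
          gcongr
          exact frob_nonneg A
      _ = _ := by ring
  have i3 : ∀ a : E d, |inner ℝ a v| ≤ L * τ * (1 + ‖a‖ ^ 2) := by
    intro a
    calc |inner ℝ a v| ≤ ‖a‖ * ‖v‖ := abs_real_inner_le_norm _ _
      _ ≤ (1 + ‖a‖ ^ 2) * (L * τ) := by
          gcongr; nlinarith [sq_nonneg (‖a‖ - 1)]
      _ = _ := by ring
  have i4 : |(k - h) * frob (msym X) ^ 2| ≤ 2 * L ^ 2 * |P - r| * frob (msym X) := by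
    rw [abs_mul, abs_of_nonneg (sq_nonneg (frob (msym X))), sq]
    calc |k - h| * (frob (msym X) * frob (msym X))
        ≤ (L * |P - r|) * ((2 * L) * frob (msym X)) := by gcongr
      _ = _ := by ring
  have i5 : |(k - k0) * ddot (msym J0) (msym X)| ≤ 2 * L ^ 3 * τ := by
    rw [abs_mul]
    calc |k - k0| * |ddot (msym J0) (msym X)| ≤ (L * τ) * (L * (2 * L)) := by
          gcongr
          refine (abs_ddot_le _ _).trans ?_
          gcongr
          exact (frob_msym_le _).trans hJ0
      _ = _ := by ring
  -- The viscous term supplies 2m times the square of the strain; half of it absorbs the density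
  -- error.
  have i6 : 4 * L ^ 2 * |P - r| * frob (msym X)
      ≤ m * frob (msym X) ^ 2 + 4 * L ^ 4 / m * (P - r) ^ 2 := by
    rw [← sq_abs (P - r)]
    have h : m * frob (msym X) ^ 2 + 4 * L ^ 4 / m * |P - r| ^ 2
        - 4 * L ^ 2 * |P - r| * frob (msym X)
        = (m * frob (msym X) - 2 * L ^ 2 * |P - r|) ^ 2 / m := by field_simp; ring
    have : 0 ≤ (m * frob (msym X) - 2 * L ^ 2 * |P - r|) ^ 2 / m := by positivity
    linarith
  have j1 := neg_le_of_abs_le (i1 V hV P hP)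
  have j2 := le_of_abs_le (i1 V0 hV0 P0 hP0)
  have j3 := neg_le_of_abs_le (i2 U J hU hJ P hP)
  have j4 := le_of_abs_le (i2 U0 J0 hU0 hJ0 P0 hP0)
  have j5 := le_of_abs_le (i3 F)
  have j6 := neg_le_of_abs_le (i3 F0)
  have j7 := neg_le_of_abs_le i4
  have j8 := neg_le_of_abs_le i5
  have j9 := mul_le_mul_of_nonneg_right hmh (sq_nonneg (frob (msym X)))
  have l1 : L * τ ≤ L ^ 4 * τ := by gcongr; exact le_self_pow₀ hL (by norm_num)
  have l2 : L ^ 3 * τ ≤ L ^ 4 * τ :=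
    mul_le_mul_of_nonneg_right (pow_le_pow_right₀ hL (by norm_num)) hτ
  rw [htr]
  linarith

theorem integrable_frob_sq {A : E d → Matrix (Fin d) (Fin d) ℝ} (hA : MatLp Ω 2 A) :
    Integrable (fun x => frob (A x) ^ 2) (volume.restrict Ω) := by
  simp only [sq_frob]
  exact hA.integrable_ddot hA

theorem integrable_norm_sq {F : Type*} [NormedAddCommGroup F] {g : E d → F}
    (hg : MemLp g 2 (volume.restrict Ω)) :
    Integrable (fun x => ‖g x‖ ^ 2) (volume.restrict Ω) := hg.integrable_norm_pow (by norm_num)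

theorem integral_le_of_le_sub_add {X : Type*} [MeasurableSpace X] {μ : Measure X}
    {y a b g : X → ℝ} (hy : Integrable y μ) (ha : Integrable a μ) (hb : Integrable b μ)
    (ha0 : ∫ x, a x ∂μ = 0) (hb0 : ∫ x, b x ∂μ = 0) (hg : Integrable g μ)
    (h : ∀ᵐ x ∂μ, y x ≤ (a x - b x) + g x) : ∫ x, y x ∂μ ≤ ∫ x, g x ∂μ := by
  refine (integral_mono_ae hy ((ha.sub hb).add hg) h).trans ?_
  rw [integral_add' (ha.sub hb) hg, integral_sub' ha hb, ha0, hb0]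
  simp

theorem integral_affine_add {X : Type*} [MeasurableSpace X] {μ : Measure X} [IsFiniteMeasure μ]
    {a b c : X → ℝ} (ha : Integrable a μ) (hb : Integrable b μ) (hc : Integrable c μ)
    (r s t : ℝ) :
    ∫ x, (r * a x + s + t * (b x + c x)) ∂μ
      = r * ∫ x, a x ∂μ + s * μ.real univ + t * (∫ x, b x ∂μ + ∫ x, c x ∂μ) := by
  rw [integral_add (by fun_prop) (by fun_prop), integral_add (by fun_prop) (by fun_prop),
    integral_const_mul, integral_const_mul, integral_add hb hc, integral_const, smul_eq_mul,
    mul_comm s]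

/-- The strain rate of a time increment of the velocity. -/
theorem ExactBounds.integral_strain_sub_le (hd : d ≤ 3) (hΩ : IsOpen Ω)
    [IsFiniteMeasure (volume.restrict Ω)]
    (hT : 0 < T) {α : ℝ≥0} {η : ℝ → ℝ} (hη : LipschitzWith α η)
    (hf : ContinuousOn f (Icc 0 T)) (hex : IsExact Ω T η f ρ u p)
    (h : ExactBounds Ω T K f ρ u u' p) {L m : ℝ} (hm : 0 < m) (hL : 1 ≤ L) (hKL : 3 * K ≤ L)
    (hαL : α ≤ L) (hαK : α * K ≤ L)
    {r : E d → ℝ} (hr : MemLp r ∞ (volume.restrict Ω))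
    (hmr : ∀ᵐ x ∂(volume.restrict Ω), m ≤ η (r x)) {s t : ℝ} (hs : s ∈ Icc 0 T)
    (ht : t ∈ Icc 0 T) (hst : s ≤ t) :
    m * ∫ x in Ω, frob (msym (jac Ω (u t) x - jac Ω (u s) x)) ^ 2
      ≤ 4 * L ^ 4 / m * (∫ x in Ω, (ρ t x - r x) ^ 2)
        + (10 * L ^ 4 * (volume.restrict Ω).real univ + 2 * L ^ 2) * (t - s) := by
  have hK := h.pos
  have hKL' : K ≤ L := by linarith
  have hvt := hex.u_dirichlet t ht
  have hvs := hex.u_dirichlet s hs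
  have hv := hvt.sub hΩ hvs
  obtain ⟨it, et⟩ := h.momentum_at hΩ hT hη hf hex hv ht
  obtain ⟨is, es⟩ := h.momentum_at hΩ hT hη hf hex hv hs
  have hρr : MemLp (fun x => ρ t x - r x) 2 (volume.restrict Ω) :=
    memLp_two_of_top ((Lp.memLp (ρ t)).sub hr)
  have ib : Integrable (fun x => (ρ t x - r x) ^ 2) (volume.restrict Ω) := by
    simpa using integrable_norm_sq hρr
  have iF := fun τ : ℝ => integrable_norm_sq (Lp.memLp (f τ))
  have iy := integrable_frob_sq (hvt.jac.sub hvs.jac).msym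
  rw [← integral_const_mul]
  have hb : ∫ x in Ω, (4 * L ^ 4 / m * (ρ t x - r x) ^ 2 + 10 * L ^ 4 * (t - s)
      + L * (t - s) * (‖f t x‖ ^ 2 + ‖f s x‖ ^ 2))
      ≤ 4 * L ^ 4 / m * (∫ x in Ω, (ρ t x - r x) ^ 2)
        + (10 * L ^ 4 * (volume.restrict Ω).real univ + 2 * L ^ 2) * (t - s) := by
    rw [integral_affine_add ib (iF t) (iF s)]
    have h1 := h.f_bound t ht
    have h2 := h.f_bound s hs
    have h3 : L * (t - s) * ((∫ x in Ω, ‖f t x‖ ^ 2) + ∫ x in Ω, ‖f s x‖ ^ 2)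
        ≤ L * (t - s) * (L + L) := by
      have : 0 ≤ t - s := by linarith
      gcongr <;> linarith
    linarith
  refine (integral_le_of_le_sub_add (iy.const_mul m) it is et es (((ib.const_mul
    (4 * L ^ 4 / m)).add (integrable_const (10 * L ^ 4 * (t - s)))).add
      (((iF t).add (iF s)).const_mul (L * (t - s)))) ?_).trans hb
  have hab : |t - s| = t - s := abs_of_nonneg (by linarith)
  filter_upwards [h.rho_bound t ht, h.rho_bound s hs, h.du_bound t ht, h.du_bound s hs,
    h.u_bound t ht, h.u_bound s hs, h.u_lip s hs t ht, h.jac_bound t ht, h.jac_bound s hs,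
    h.rho_lip s hs t ht, hmr, hex.incompressible t ht, hex.incompressible s hs,
    hvt.jac_sub hΩ hvs] with x h1 h2 h3 h4 h5 h6 h7 h8 h9 h10 h11 h12 h13 h14
  rw [hab] at h7 h10
  have hη' : ∀ a b : ℝ, |η a - η b| ≤ α * |a - b| := fun a b => by
    simpa [Real.dist_eq] using hη.dist_le_mul a b
  have hfr : ∀ A : Matrix (Fin d) (Fin d) ℝ, (∀ i j, |A i j| ≤ K) → frob A ≤ L := fun A hA =>
    (frob_le_of_entries A hd hA).trans (by rw [abs_of_pos hK]; exact hKL)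
  have hst' : 0 ≤ t - s := by linarith
  -- The factor 3 in 3K ≤ L passes from entrywise bounds of a Jacobian to its Frobenius norm in
  -- dimension at most three.
  have key := strain_sub_sq_le (F := f t x) (F0 := f s x) (s := p t x) (s0 := p s x)
    (P := ρ t x) (P0 := ρ s x) (r := r x) (h := η (r x)) (k := η (ρ t x)) (k0 := η (ρ s x))
    (V := u' t x) (V0 := u' s x) (U := u t x) (U0 := u s x) (v := u t x - u s x)
    (J := jac Ω (u t) x) (J0 := jac Ω (u s) x) hL hm hst'
    (h1.trans hKL') (h2.trans hKL') (h3.trans hKL') (h4.trans hKL') (h5.trans hKL')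
    (h6.trans hKL') (h7.trans (by gcongr)) (hfr _ h8) (hfr _ h9)
    ((hη' _ _).trans (by gcongr))
    ((hη' _ _).trans (le_trans (mul_le_mul_of_nonneg_left h10 α.2) (by
      rw [← mul_assoc]; gcongr))) h11 rfl (by
      rw [Matrix.trace_sub]
      simp only [dvg] at h12 h13
      rw [h12, h13, sub_zero])
  simp only [Pi.add_apply, strain_eq_msym, dvg_eq_trace, h14]
  exact key

end

/-! ### The integrated error equation of one time step -/

section

variable {d : ℕ} {Ω : Set (E d)}

/-- `x` is the exact integrand, s₁, …, s₉ are the terms of the scheme, and the identities i₁, i₂ of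
integral zero are added with weights ½ and −1. -/
theorem integral_scheme_balance {X : Type*} [MeasurableSpace X] {μ : Measure X}
    {x f s₁ s₂ s₃ s₄ s₅ s₆ s₇ s₈ s₉ i₁ i₂ : X → ℝ} (hx : Integrable x μ) (hf : Integrable f μ)
    (h₁ : Integrable s₁ μ) (h₂ : Integrable s₂ μ) (h₃ : Integrable s₃ μ) (h₄ : Integrable s₄ μ)
    (h₅ : Integrable s₅ μ) (h₆ : Integrable s₆ μ) (h₇ : Integrable s₇ μ) (h₈ : Integrable s₈ μ)
    (h₉ : Integrable s₉ μ) (hi₁ : Integrable i₁ μ) (hi₂ : Integrable i₂ μ)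
    (hx0 : ∫ t, x t ∂μ = 0) (hi₁0 : ∫ t, i₁ t ∂μ = 0) (hi₂0 : ∫ t, i₂ t ∂μ = 0)
    (hs : ∫ t, s₁ t ∂μ + ∫ t, s₂ t ∂μ + ∫ t, s₃ t ∂μ + ∫ t, s₄ t ∂μ + ∫ t, s₅ t ∂μ
      - ∫ t, s₆ t ∂μ - ∫ t, s₇ t ∂μ - ∫ t, s₈ t ∂μ - ∫ t, s₉ t ∂μ = ∫ t, f t ∂μ) :
    Integrable (fun t => x t + f t - s₁ t - s₂ t - s₃ t - s₄ t - s₅ t + s₆ t + s₇ t + s₈ t + s₉ t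
      + 1 / 2 * i₁ t - i₂ t) μ ∧
    ∫ t, (x t + f t - s₁ t - s₂ t - s₃ t - s₄ t - s₅ t + s₆ t + s₇ t + s₈ t + s₉ t
      + 1 / 2 * i₁ t - i₂ t) ∂μ = 0 := by
  have j1 : Integrable (fun t => x t + f t) μ := by fun_prop
  have j2 : Integrable (fun t => x t + f t - s₁ t) μ := by fun_prop
  have j3 : Integrable (fun t => x t + f t - s₁ t - s₂ t) μ := by fun_prop
  have j4 : Integrable (fun t => x t + f t - s₁ t - s₂ t - s₃ t) μ := by fun_prop
  have j5 : Integrable (fun t => x t + f t - s₁ t - s₂ t - s₃ t - s₄ t) μ := by fun_prop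
  have j6 : Integrable (fun t => x t + f t - s₁ t - s₂ t - s₃ t - s₄ t - s₅ t) μ := by fun_prop
  have j7 : Integrable (fun t => x t + f t - s₁ t - s₂ t - s₃ t - s₄ t - s₅ t + s₆ t) μ := j6.add h₆
  have j8 : Integrable (fun t => x t + f t - s₁ t - s₂ t - s₃ t - s₄ t - s₅ t + s₆ t + s₇ t) μ :=
    j7.add h₇
  have j9 : Integrable (fun t => x t + f t - s₁ t - s₂ t - s₃ t - s₄ t - s₅ t + s₆ t + s₇ t
      + s₈ t) μ := j8.add h₈
  have j10 : Integrable (fun t => x t + f t - s₁ t - s₂ t - s₃ t - s₄ t - s₅ t + s₆ t + s₇ t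
      + s₈ t + s₉ t) μ := j9.add h₉
  have j11 : Integrable (fun t => x t + f t - s₁ t - s₂ t - s₃ t - s₄ t - s₅ t + s₆ t + s₇ t
      + s₈ t + s₉ t + 1 / 2 * i₁ t) μ := j10.add (hi₁.const_mul _)
  refine ⟨j11.sub hi₂, ?_⟩
  rw [integral_sub j11 hi₂, integral_add j10 (hi₁.const_mul _), integral_add j9 h₉,
    integral_add j8 h₈, integral_add j7 h₇, integral_add j6 h₆, integral_sub j5 h₅,
    integral_sub j4 h₄, integral_sub j3 h₃, integral_sub j2 h₂, integral_sub j1 h₁,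
    integral_add hx hf, integral_const_mul, hx0, hi₁0, hi₂0]
  linarith

theorem integrable_integral_eq_zero_congr {X : Type*} [MeasurableSpace X] {μ : Measure X}
    {g g' : X → ℝ} (h : Integrable g μ ∧ ∫ x, g x ∂μ = 0) (hg : ∀ᵐ x ∂μ, g x = g' x) :
    Integrable g' μ ∧ ∫ x, g' x ∂μ = 0 :=
  ⟨h.1.congr hg, (integral_congr_ae hg).symm.trans h.2⟩

/-- The combination of skew identities removes the gradient of the velocity error from the
convection, leaving only the gradient of U, and the density equation rewrites a · ∇q in terms of the
residual. -/
theorem integral_stepResidual (hd : d = 2 ∨ d = 3) (hΩ : IsOpen Ω) (hbd : Bornology.IsBounded Ω)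
    [IsFiniteMeasure (volume.restrict Ω)] {τ ν μ lam : ℝ} {q r P h k R s p : E d → ℝ}
    {a b m m' U V F : E d → E d}
    (hq : MemH1 Ω q) (hq' : MemLp q ∞ (volume.restrict Ω))
    (hr : MemH1 Ω r) (hr' : MemLp r ∞ (volume.restrict Ω))
    (hgr : MemLp (grad Ω r) ∞ (volume.restrict Ω))
    (ha : MemH10v Ω a) (hb : MemH10v Ω b) (hU : MemH10v Ω U)
    (hm : MemLp m 2 (volume.restrict Ω)) (hm' : MemLp m' 2 (volume.restrict Ω))
    (hqa : ∀ j, MemLp (fun x => wd Ω j q x * a x j) 2 (volume.restrict Ω))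
    (hh : MemLp h ∞ (volume.restrict Ω)) (hR : MemLp R 2 (volume.restrict Ω))
    (hp : MemLp p 2 (volume.restrict Ω)) (hF : MemLp F 2 (volume.restrict Ω))
    (hmq : ∀ᵐ x ∂(volume.restrict Ω), m x = q x • a x)
    (hmr : ∀ᵐ x ∂(volume.restrict Ω), m' x = r x • b x)
    (hdens : ∀ᵐ x ∂(volume.restrict Ω), (r x - q x) / τ + inner ℝ (a x) (grad Ω q x) = R x)
    (hXi : Integrable (fun x => P x * inner ℝ (V x) (U x - b x)
      + P x * ddot (tens (U x - b x) (U x)) (jac Ω U x)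
      + 2 * (k x * ddot (strain Ω U x) (strain Ω (fun y => U y - b y) x))
      - s x * dvg Ω (fun y => U y - b y) x - inner ℝ (F x) (U x - b x)) (volume.restrict Ω))
    (hX : ∫ x in Ω, (P x * inner ℝ (V x) (U x - b x)
      + P x * ddot (tens (U x - b x) (U x)) (jac Ω U x)
      + 2 * (k x * ddot (strain Ω U x) (strain Ω (fun y => U y - b y) x))
      - s x * dvg Ω (fun y => U y - b y) x - inner ℝ (F x) (U x - b x)) = 0)
    (hS : (∫ x in Ω, inner ℝ (τ⁻¹ • (m' x - m x)) (U x - b x))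
      + (∫ x in Ω, 2 * ν * ddot (strain Ω (fun y => m' y - r y • a y) x)
          (strain Ω (fun y => U y - b y) x))
      + (∫ x in Ω, 2 * (h x * ddot (strain Ω a x) (strain Ω (fun y => U y - b y) x)))
      + (∫ x in Ω, μ * (dvg Ω (fun y => m' y - r y • a y) x * dvg Ω (fun y => U y - b y) x))
      + (∫ x in Ω, lam * (dvg Ω a x * dvg Ω (fun y => U y - b y) x))
      - (∫ x in Ω, p x * dvg Ω (fun y => U y - b y) x)
      - (∫ x in Ω, ddot (tens (q x • b x) (a x)) (jac Ω (fun y => U y - b y) x))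
      - (∫ x in Ω, 1 / 2 * (q x * dvg Ω a x * inner ℝ (b x) (U x - b x)))
      - (∫ x in Ω, 1 / 2 * (R x * inner ℝ (b x) (U x - b x)))
      = ∫ x in Ω, inner ℝ (F x) (U x - b x)) :
    Integrable (fun x => stepResidual τ ν μ lam (q x) (r x) (P x) (h x) (k x) (R x) (s x) (p x)
      (a x) (b x) (U x) (V x) (grad Ω r x) (jac Ω a x) (jac Ω b x) (jac Ω U x))
      (volume.restrict Ω) ∧
    ∫ x in Ω, stepResidual τ ν μ lam (q x) (r x) (P x) (h x) (k x) (R x) (s x) (p x)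
      (a x) (b x) (U x) (V x) (grad Ω r x) (jac Ω a x) (jac Ω b x) (jac Ω U x) = 0 := by
  have := holderTriple_four
  have hw := hU.sub hΩ hb
  have ha4 := ha.memLp_four hd hbd
  have hb4 := hb.memLp_four hd hbd
  have hw4 := hw.memLp_four hd hbd
  have hba := hb.sub hΩ ha
  have hJba : ∀ᵐ x ∂(volume.restrict Ω), jac Ω (fun y => m' y - r y • a y) x
      = r x • (jac Ω b x - jac Ω a x) + tens (b x - a x) (grad Ω r x) := by
    filter_upwards [jac_smul_ae_eq (m := fun y => m' y - r y • a y) hΩ hr hr' hba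
      (hmr.mono fun x hx => by rw [hx, smul_sub]), hb.jac_sub hΩ ha] with x h1 h2
    rw [h1, h2]
  have hJm : MatLp Ω 2 (jac Ω (fun y => m' y - r y • a y)) := by
    refine MatLp.congr ?_ (hJba.mono fun x hx => hx.symm)
    exact (MatLp.smul (p := ∞) hr' (hb.jac.sub ha.jac)).add
      (MatLp.tens (q := ∞) (r := 2) hba.memLp hgr)
  have i1 : Integrable (fun x => inner ℝ (τ⁻¹ • (m' x - m x)) (U x - b x))
      (volume.restrict Ω) := integrable_inner ((hm'.sub hm).const_smul τ⁻¹) hw.memLp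
  have i2 : Integrable (fun x => 2 * ν * ddot (strain Ω (fun y => m' y - r y • a y) x)
      (strain Ω (fun y => U y - b y) x)) (volume.restrict Ω) :=
    (hJm.msym.integrable_ddot hw.strain).const_mul _
  have i3 : Integrable (fun x => 2 * (h x * ddot (strain Ω a x)
      (strain Ω (fun y => U y - b y) x))) (volume.restrict Ω) := by
    have h1 := (MatLp.smul (p := ∞) hh ha.strain).integrable_ddot hw.strain
    refine (h1.const_mul 2).congr (Eventually.of_forall fun x => ?_)
    simp only [ddot_smul_left]
  have i4 : Integrable (fun x => μ * (dvg Ω (fun y => m' y - r y • a y) x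
      * dvg Ω (fun y => U y - b y) x)) (volume.restrict Ω) :=
    (integrable_mul_of_memLp hJm.trace hw.dvg).const_mul _
  have i5 : Integrable (fun x => lam * (dvg Ω a x * dvg Ω (fun y => U y - b y) x))
      (volume.restrict Ω) := (integrable_mul_of_memLp ha.dvg hw.dvg).const_mul _
  have i6 : Integrable (fun x => p x * dvg Ω (fun y => U y - b y) x) (volume.restrict Ω) :=
    integrable_mul_of_memLp hp hw.dvg
  have i7 : Integrable (fun x => ddot (tens (q x • b x) (a x)) (jac Ω (fun y => U y - b y) x))
      (volume.restrict Ω) :=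
    (MatLp.tens (r := 2) (hb4.smul (p := ∞) (r := 4) hq') ha4).integrable_ddot hw.jac
  have i8 : Integrable (fun x => 1 / 2 * (q x * dvg Ω a x * inner ℝ (b x) (U x - b x)))
      (volume.restrict Ω) :=
    (integrable_mul_of_memLp (memLp_mul (p := ∞) (r := 2) hq' ha.dvg)
      (memLp_inner hb4 hw4)).const_mul _
  have i9 : Integrable (fun x => 1 / 2 * (R x * inner ℝ (b x) (U x - b x)))
      (volume.restrict Ω) := (integrable_mul_of_memLp hR (memLp_inner hb4 hw4)).const_mul _
  have iF : Integrable (fun x => inner ℝ (F x) (U x - b x)) (volume.restrict Ω) :=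
    integrable_inner hF hw.memLp
  -- With b = U − w, the scheme's convection splits into a part with w in both slots, cancelled by
  -- half of the first identity, and a part with U, whose derivative the second identity moves from
  -- w to U.
  obtain ⟨c1, c1'⟩ := integral_convection_skew hd hbd hq hq' ha hqa hw hw
  obtain ⟨c2, c2'⟩ := integral_convection_skew hd hbd hq hq' ha hqa hw hU
  have H := integral_scheme_balance hXi iF i1 i2 i3 i4 i5 i6 i7 i8 i9 c1 c2 hX c1' c2' hS
  refine integrable_integral_eq_zero_congr H ?_
  filter_upwards [hJba, hmq, hmr, hdens, hU.jac_sub hΩ hb] with x h1 h2 h3 h4 h5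
  have e : ∀ Y, ddot (tens (b x) (a x)) Y
      = ddot (tens (U x) (a x)) Y - ddot (tens (U x - b x) (a x)) Y := fun Y => by
    rw [tens_sub_left, ddot_sub_left]; ring
  have e2 : inner ℝ (a x) (grad Ω q x) = R x - (r x - q x) / τ := by rw [← h4]; ring
  rw [stepResidual, e2, h2, h3, ddot_tens_smul_left, e]
  simp only [strain_eq_msym, dvg_eq_trace, h1, h5]
  ring

end

/-! ### The scheme in a fixed setting: verification of the bounds and of integrability -/

section

variable {d : ℕ} {Ω : Set (E d)}

/-- The data of the continuous problem, a constant `L` that dominates all the bounds, and a lower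
bound `m` of the viscosity. -/
structure Setting (Ω : Set (E d)) (T : ℝ) (α : ℝ≥0) (η : ℝ → ℝ) (f : ℝ → LpΩ (E d) 2 Ω)
    (ρ : ℝ → LpΩ ℝ ∞ Ω) (u u' : ℝ → LpΩ (E d) ∞ Ω) (p : ℝ → LpΩ ℝ ∞ Ω) (lam γ K L m : ℝ) :
    Prop where
  dim : d = 2 ∨ d = 3
  isOpen : IsOpen Ω
  isConnected : IsConnected Ω
  isBounded : Bornology.IsBounded Ω
  T_pos : 0 < T
  lip : LipschitzWith α η
  f_cont : ContinuousOn f (Icc 0 T)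
  exact : IsExact Ω T η f ρ u p
  bounds : ExactBounds Ω T K f ρ u u' p
  rho_pos : 0 < rhoMin Ω (ρ 0)
  lam_pos : 0 < lam
  gamma_sq : γ ^ 2 ≤ min (1 / 4) (1 / (64 * nuBar Ω η (ρ 0)))
  one_le : 1 ≤ L
  K_le : 3 * K ≤ L
  α_le : α ≤ L
  αK_le : α * K ≤ L
  nu_le : nuBar Ω η (ρ 0) ≤ L
  inv_lam_le : lam⁻¹ ≤ L
  rhoMax_le : rhoMax Ω (ρ 0) ≤ L
  m_pos : 0 < m
  eta_mem : ∀ s ∈ Icc (rhoMin Ω (ρ 0)) (rhoMax Ω (ρ 0)), m ≤ η s ∧ η s ≤ L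

section

variable {T : ℝ} {α : ℝ≥0} {η : ℝ → ℝ} {f : ℝ → LpΩ (E d) 2 Ω} {ρ : ℝ → LpΩ ℝ ∞ Ω}
  {u u' : ℝ → LpΩ (E d) ∞ Ω} {p : ℝ → LpΩ ℝ ∞ Ω} {lam γ K L m : ℝ} {τ : ℝ} {N : ℕ}
  {ρn : ℕ → E d → ℝ} {mn un : ℕ → E d → E d} {pn Rn : ℕ → E d → ℝ}

theorem Setting.restrict_ne_zero (S : Setting Ω T α η f ρ u u' p lam γ K L m) :
    (volume.restrict Ω) ≠ 0 := ACM.restrict_ne_zero S.isOpen S.isConnected.nonempty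

theorem Setting.dim_le (S : Setting Ω T α η f ρ u u' p lam γ K L m) : d ≤ 3 := by
  rcases S.dim with h | h <;> omega

theorem mem_Icc_of_mul_eq (hτ : 0 < τ) (hN : N * τ = T) {n : ℕ} (hn : n ≤ N) :
    (n : ℝ) * τ ∈ Icc 0 T := by
  refine ⟨by positivity, ?_⟩
  rw [← hN]
  gcongr

theorem Setting.stepBounds [IsFiniteMeasure (volume.restrict Ω)]
    (S : Setting Ω T α η f ρ u u' p lam γ K L m) (hτ : 0 < τ)
    (hN : N * τ = T) (hτ1 : τ ≤ 1)
    (hs : IsScheme Ω η f (ρ 0) (u 0) (p 0) lam τ N ρn mn un pn Rn)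
    (hc : DensityConditions Ω η (ρ 0) lam γ τ N ρn) {n : ℕ} (hn : n < N) :
    ∀ᵐ x ∂(volume.restrict Ω), StepBounds L m τ (nuBar Ω η (ρ 0)) (lamBar Ω lam (ρ 0)) lam
      (ρn n x) (ρn (n + 1) x) (ρ ((n + 1 : ℕ) * τ) x) (ρ (n * τ) x) (η (ρn (n + 1) x))
      (η (ρ ((n + 1 : ℕ) * τ) x)) (p ((n + 1 : ℕ) * τ) x) (p (n * τ) x)
      (u ((n + 1 : ℕ) * τ) x) (u (n * τ) x) (u' ((n + 1 : ℕ) * τ) x) (grad Ω (ρn (n + 1)) x)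
      (jac Ω (u ((n + 1 : ℕ) * τ)) x) := by
  have h0 := mem_Icc_of_mul_eq hτ hN hn.le
  have h1 := mem_Icc_of_mul_eq hτ hN hn
  have hB := S.bounds
  have hK := hB.pos
  have hKL : K ≤ L := by linarith [S.K_le]
  have hL0 : 0 ≤ L := by linarith [S.one_le]
  -- The exact initial density inherits H¹ regularity from the scheme; it is needed to bound ν̄ at
  -- every density value.
  have hH : MemH1 Ω (ρ 0) := (hs.rho_mem 0 (Nat.zero_le _)).congr S.isOpen hs.rho_init
  have hν := nuBar_nonneg (Ω := Ω) (f := ρ 0) η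
  have hμ := (lamBar_pos S.restrict_ne_zero (Lp.memLp (ρ 0)) S.rho_pos S.lam_pos).le
  have hdt : ((n + 1 : ℕ) : ℝ) * τ - n * τ = τ := by push_cast; ring
  have hγ1 := S.gamma_sq.trans (min_le_left _ _)
  have hγ2 := S.gamma_sq.trans (min_le_right _ _)
  have hγ3 : γ ≤ 1 / 2 := by nlinarith
  -- The square root of γ² ≤ 1/(64 ν̄); the case ν̄ = 0, where the quotient has the default value 0,
  -- is separated.
  have hγ4 : 2 * √(nuBar Ω η (ρ 0)) * γ ≤ 1 / 4 := by
    have h2 := Real.sq_sqrt hν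
    rcases hν.eq_or_lt with h3 | h3
    · rw [← h3]; simp
    · rw [le_div_iff₀ (by positivity)] at hγ2
      nlinarith [Real.sqrt_nonneg (nuBar Ω η (ρ 0))]
  filter_upwards [hB.rho_bound _ h1, hB.rho_lip _ h0 _ h1, hc.max_principle n hn.le,
    hc.max_principle (n + 1) hn, hc.grad_nu n hn, hc.grad_lam n hn, hc.incr_nu n hn,
    hc.incr_lam n hn, hB.p_lip _ h0 _ h1, hB.u_bound _ h1, hB.u_lip _ h0 _ h1,
    hB.u_taylor _ h1 _ h0, hB.jac_bound _ h1] with x a1 a2 a3 a4 a5 a6 a7 a8 a9 a10 a11 a12 a13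
  have hη := S.eta_mem _ a4
  have hq := S.rho_pos.trans_le a3.1
  have hr := S.rho_pos.trans_le a4.1
  have hh := S.m_pos.trans_le hη.1
  rw [hdt, abs_of_pos hτ] at a2 a9 a11
  have hS : 0 < √(ρn n x * η (ρn (n + 1) x)) := Real.sqrt_pos.2 (mul_pos hq hh)
  have hKτ : K * τ ≤ L * τ := by gcongr
  rw [← mul_div_assoc, div_le_iff₀ hS] at a5 a6
  exact
    { one_le := S.one_le
      m_pos := S.m_pos
      tau_pos := hτ
      tau_le := hτ1
      nu_nonneg := hν
      nu_le := S.nu_le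
      mu_nonneg := hμ
      lam_pos := S.lam_pos
      inv_lam_le := S.inv_lam_le
      q_nonneg := hq.le
      q_le := a3.2.trans S.rhoMax_le
      r_nonneg := hr.le
      r_le := a4.2.trans S.rhoMax_le
      P_le := a1.trans hKL
      P_sub_le := a2.trans hKτ
      m_le := hη.1
      h_le := hη.2
      k_sub_le := by
        have := S.lip.dist_le_mul (ρ ((n + 1 : ℕ) * τ) x) (ρn (n + 1) x)
        rw [Real.dist_eq, Real.dist_eq] at this
        exact this.trans (mul_le_mul_of_nonneg_right S.α_le (abs_nonneg _))
      s_sub_le := a9.trans hKτ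
      U_le := a10.trans hKL
      U_sub_le := a11.trans hKτ
      taylor := by
        -- The expansion is centred at the later time, where V is evaluated, so the increment is −τ.
        have e : (n : ℝ) * τ - (n + 1 : ℕ) * τ = -τ := by push_cast; ring
        rw [e, neg_sq] at a12
        have e2 : τ • u' ((n + 1 : ℕ) * τ) x - (u ((n + 1 : ℕ) * τ) x - u (n * τ) x)
            = u (n * τ) x - u ((n + 1 : ℕ) * τ) x - (-τ) • u' ((n + 1 : ℕ) * τ) x := by module
        rw [e2]
        exact a12.trans (by gcongr)
      J_le := by
        refine (frob_le_of_entries _ S.dim_le a13).trans ?_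
        rw [abs_of_pos hK]
        exact S.K_le
      nu_r := by
        have := eta_le_nuBar_mul S.isOpen S.isConnected (Lp.memLp (ρ 0)) hH S.lip.continuous
          S.rho_pos a4
        linarith
      mu_r := by
        have := le_lamBar_mul S.restrict_ne_zero (Lp.memLp (ρ 0)) S.rho_pos S.lam_pos a4.1
        linarith [S.lam_pos]
      nu_incr := by
        have := (abs_le.1 a7).2
        rwa [div_le_one hh] at this
      mu_incr := by
        have := (abs_le.1 a8).2
        rwa [div_le_one S.lam_pos] at this
      nu_grad := by
        -- The hypothesis carries √ν̄ while ν̄ is needed; the additional √ν̄ is paired with γ.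
        rw [Real.sqrt_mul hτ.le] at a5
        calc √τ * (2 * nuBar Ω η (ρ 0) * ‖grad Ω (ρn (n + 1)) x‖)
            = 2 * √(nuBar Ω η (ρ 0)) * (√τ * √(nuBar Ω η (ρ 0)) * ‖grad Ω (ρn (n + 1)) x‖) := by
              nth_rewrite 1 [← Real.mul_self_sqrt hν]; ring
          _ ≤ 2 * √(nuBar Ω η (ρ 0)) * (γ * √(ρn n x * η (ρn (n + 1) x))) := by gcongr
          _ = (2 * √(nuBar Ω η (ρ 0)) * γ) * √(ρn n x * η (ρn (n + 1) x)) := by ring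
          _ ≤ _ := by gcongr
      mu_grad := by
        rw [← mul_assoc]
        exact a6.trans (by gcongr) }

theorem Setting.rho_memLp [IsFiniteMeasure (volume.restrict Ω)]
    (S : Setting Ω T α η f ρ u u' p lam γ K L m)
    (hs : IsScheme Ω η f (ρ 0) (u 0) (p 0) lam τ N ρn mn un pn Rn)
    (hc : DensityConditions Ω η (ρ 0) lam γ τ N ρn) {n : ℕ} (hn : n ≤ N) :
    MemLp (ρn n) ∞ (volume.restrict Ω) := by
  refine MemLp.of_bound (hs.rho_mem n hn).1.1 L ?_
  filter_upwards [hc.max_principle n hn] with x hx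
  rw [Real.norm_eq_abs, abs_of_pos (S.rho_pos.trans_le hx.1)]
  exact hx.2.trans S.rhoMax_le

/-- The bound depends on τ and is used for integrability only. The λ̄-condition is the convenient
one, since λ̄ is known to be positive. -/
theorem Setting.grad_memLp [IsFiniteMeasure (volume.restrict Ω)]
    (S : Setting Ω T α η f ρ u u' p lam γ K L m) (hτ : 0 < τ)
    (hN : N * τ = T) (hτ1 : τ ≤ 1)
    (hs : IsScheme Ω η f (ρ 0) (u 0) (p 0) lam τ N ρn mn un pn Rn)
    (hc : DensityConditions Ω η (ρ 0) lam γ τ N ρn) {n : ℕ} (hn : n < N) :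
    MemLp (grad Ω (ρn (n + 1))) ∞ (volume.restrict Ω) := by
  have hg : MemLp (grad Ω (ρn (n + 1))) 2 (volume.restrict Ω) :=
    MemLp.of_eval_piLp fun j => ((hs.rho_mem (n + 1) hn).2 j).2
  have hμ := lamBar_pos S.restrict_ne_zero (Lp.memLp (ρ 0)) S.rho_pos S.lam_pos
  have hσ := Real.sqrt_pos.2 hτ
  refine MemLp.of_bound hg.1 (1 / 2 * L / (√τ * lamBar Ω lam (ρ 0))) ?_
  filter_upwards [S.stepBounds hτ hN hτ1 hs hc hn] with x H
  rw [le_div_iff₀ (by positivity)]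
  have hL0 : 0 ≤ L := by linarith [S.one_le]
  have hS : √(ρn n x * η (ρn (n + 1) x)) ≤ L := by
    refine Real.sqrt_le_iff.2 ⟨hL0, ?_⟩
    rw [sq]
    exact mul_le_mul H.q_le H.h_le (H.m_pos.le.trans H.m_le) hL0
  linarith [H.mu_grad]

theorem Setting.transport_memLp [IsFiniteMeasure (volume.restrict Ω)]
    (S : Setting Ω T α η f ρ u u' p lam γ K L m) (hτ : 0 < τ)
    (hN : N * τ = T) (hτ1 : τ ≤ 1)
    (hs : IsScheme Ω η f (ρ 0) (u 0) (p 0) lam τ N ρn mn un pn Rn)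
    (hc : DensityConditions Ω η (ρ 0) lam γ τ N ρn) {n : ℕ} (hn : n ≤ N) (j : Fin d) :
    MemLp (fun x => wd Ω j (ρn n) x * un n x j) 2 (volume.restrict Ω) := by
  -- The gradient conditions start at index 1. At index 0 the roles are exchanged: ∇ρ⁰ is only in
  -- L², but u⁰ is the bounded exact velocity.
  rcases n with _ | n
  · have h : MemLp (un 0) ∞ (volume.restrict Ω) := (memLp_congr_ae hs.u_init).2 (Lp.memLp (u 0))
    exact memLp_mul (q := ∞) ((hs.rho_mem 0 hn).2 j).2 (h.eval_piLp j)
  · exact memLp_mul (p := ∞) ((S.grad_memLp hτ hN hτ1 hs hc hn).eval_piLp j)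
      ((hs.u_mem (n + 1) hn).memLp.eval_piLp j)

theorem Setting.residual_memLp [IsFiniteMeasure (volume.restrict Ω)]
    (S : Setting Ω T α η f ρ u u' p lam γ K L m) (hτ : 0 < τ)
    (hN : N * τ = T) (hτ1 : τ ≤ 1)
    (hs : IsScheme Ω η f (ρ 0) (u 0) (p 0) lam τ N ρn mn un pn Rn)
    (hc : DensityConditions Ω η (ρ 0) lam γ τ N ρn) {n : ℕ} (hn : n < N) :
    MemLp (Rn (n + 1)) 2 (volume.restrict Ω) := by
  have h1 : MemLp (fun x => (ρn (n + 1) x - ρn n x) / τ) 2 (volume.restrict Ω) := by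
    simp only [div_eq_mul_inv]
    exact ((hs.rho_mem _ hn).1.sub (hs.rho_mem _ hn.le).1).mul_const _
  have h2 : MemLp (fun x => inner ℝ (un n x) (grad Ω (ρn n) x)) 2 (volume.restrict Ω) := by
    have := memLp_finsetSum Finset.univ fun j _ =>
      S.transport_memLp hτ hN hτ1 hs hc hn.le (n := n) j
    refine (memLp_congr_ae (Eventually.of_forall fun x => ?_)).1 this
    rw [inner_eq_sum]
    exact Finset.sum_congr rfl fun j _ => mul_comm _ _
  exact (memLp_congr_ae (hs.density n hn)).1 (h1.add h2)

theorem Setting.momentum_eq [IsFiniteMeasure (volume.restrict Ω)]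
    (S : Setting Ω T α η f ρ u u' p lam γ K L m)
    (hs : IsScheme Ω η f (ρ 0) (u 0) (p 0) lam τ N ρn mn un pn Rn)
    (hc : DensityConditions Ω η (ρ 0) lam γ τ N ρn) {n : ℕ} (hn : n ≤ N) :
    ∀ᵐ x ∂(volume.restrict Ω), mn n x = ρn n x • un n x := by
  filter_upwards [hs.velocity n hn, hc.max_principle n hn] with x h1 h2
  rw [h1, smul_inv_smul₀ (S.rho_pos.trans_le h2.1).ne']

/-- The error equation of one time step, tested with the velocity error. -/
theorem Setting.integral_stepResidual [IsFiniteMeasure (volume.restrict Ω)]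
    (S : Setting Ω T α η f ρ u u' p lam γ K L m) (hτ : 0 < τ)
    (hN : N * τ = T) (hτ1 : τ ≤ 1)
    (hs : IsScheme Ω η f (ρ 0) (u 0) (p 0) lam τ N ρn mn un pn Rn)
    (hc : DensityConditions Ω η (ρ 0) lam γ τ N ρn) {n : ℕ} (hn : n < N) :
    Integrable (fun x => stepResidual τ (nuBar Ω η (ρ 0)) (lamBar Ω lam (ρ 0)) lam (ρn n x)
      (ρn (n + 1) x) (ρ ((n + 1 : ℕ) * τ) x) (η (ρn (n + 1) x)) (η (ρ ((n + 1 : ℕ) * τ) x))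
      (Rn (n + 1) x) (p ((n + 1 : ℕ) * τ) x) (pn n x) (un n x) (un (n + 1) x)
      (u ((n + 1 : ℕ) * τ) x) (u' ((n + 1 : ℕ) * τ) x) (grad Ω (ρn (n + 1)) x)
      (jac Ω (un n) x) (jac Ω (un (n + 1)) x) (jac Ω (u ((n + 1 : ℕ) * τ)) x))
      (volume.restrict Ω) ∧
    ∫ x in Ω, stepResidual τ (nuBar Ω η (ρ 0)) (lamBar Ω lam (ρ 0)) lam (ρn n x)
      (ρn (n + 1) x) (ρ ((n + 1 : ℕ) * τ) x) (η (ρn (n + 1) x)) (η (ρ ((n + 1 : ℕ) * τ) x))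
      (Rn (n + 1) x) (p ((n + 1 : ℕ) * τ) x) (pn n x) (un n x) (un (n + 1) x)
      (u ((n + 1 : ℕ) * τ) x) (u' ((n + 1 : ℕ) * τ) x) (grad Ω (ρn (n + 1)) x)
      (jac Ω (un n) x) (jac Ω (un (n + 1)) x) (jac Ω (u ((n + 1 : ℕ) * τ)) x) = 0 := by
  have h1 := mem_Icc_of_mul_eq hτ hN hn
  have hb := hs.u_mem (n + 1) hn
  have hU := S.exact.u_dirichlet _ h1
  have hw := hU.sub S.isOpen hb
  obtain ⟨x1, x2⟩ := S.bounds.momentum_at S.isOpen S.T_pos S.lip S.f_cont S.exact hw h1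
  have hh : MemLp (fun x => η (ρn (n + 1) x)) ∞ (volume.restrict Ω) := by
    refine MemLp.of_bound (S.lip.continuous.comp_aestronglyMeasurable (hs.rho_mem _ hn).1.1) L ?_
    filter_upwards [hc.max_principle _ hn] with x hx
    have := S.eta_mem _ hx
    rw [Real.norm_eq_abs, abs_of_pos (S.m_pos.trans_le this.1)]
    exact this.2
  exact ACM.integral_stepResidual S.dim S.isOpen S.isBounded (hs.rho_mem n hn.le)
    (S.rho_memLp hs hc hn.le) (hs.rho_mem _ hn) (S.rho_memLp hs hc hn)
    (S.grad_memLp hτ hN hτ1 hs hc hn) (hs.u_mem n hn.le) hb hU (hs.m_mem n hn.le).memLp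
    (hs.m_mem _ hn).memLp (S.transport_memLp hτ hN hτ1 hs hc hn.le) hh
    (S.residual_memLp hτ hN hτ1 hs hc hn) (hs.p_mem n hn.le) (Lp.memLp _)
    (S.momentum_eq hs hc hn.le) (S.momentum_eq hs hc hn) (hs.density n hn) x1 x2
    (hs.momentum n hn _ hw)

end

end

/-! ### The discrete energy and its inequality over one time step -/

section

variable {d : ℕ} {Ω : Set (E d)}

theorem integral_energy_balance {X : Type*} [MeasurableSpace X] {μ : Measure X} [IsFiniteMeasure μ]
    {D₁ D₀ F₁ F₀ e w a b R D c G : X → ℝ} {τ s t C : ℝ}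
    (h₁ : Integrable D₁ μ) (h₂ : Integrable D₀ μ) (h₃ : Integrable F₁ μ) (h₄ : Integrable F₀ μ)
    (h₅ : Integrable e μ) (h₆ : Integrable w μ) (h₇ : Integrable a μ) (h₈ : Integrable b μ)
    (h₉ : Integrable R μ) (h₁₀ : Integrable D μ) (h₁₁ : Integrable c μ) (hG : Integrable G μ)
    (hG0 : ∫ x, G x ∂μ = 0)
    (h : ∀ᵐ x ∂μ, D₁ x - D₀ x + τ * (s * F₁ x - t * F₀ x
      - C * (e x + w x + a x + b x + R x + D x + τ + τ * c x)) ≤ τ * G x) :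
    ∫ x, D₁ x ∂μ - ∫ x, D₀ x ∂μ + τ * (s * ∫ x, F₁ x ∂μ - t * ∫ x, F₀ x ∂μ
      - C * (∫ x, e x ∂μ + ∫ x, w x ∂μ + ∫ x, a x ∂μ + ∫ x, b x ∂μ + ∫ x, R x ∂μ + ∫ x, D x ∂μ
        + μ.real univ * τ + τ * ∫ x, c x ∂μ)) ≤ 0 := by
  have k1 : Integrable (fun x => e x + w x) μ := h₅.add h₆
  have k2 : Integrable (fun x => e x + w x + a x) μ := k1.add h₇
  have k3 : Integrable (fun x => e x + w x + a x + b x) μ := k2.add h₈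
  have k4 : Integrable (fun x => e x + w x + a x + b x + R x) μ := k3.add h₉
  have k5 : Integrable (fun x => e x + w x + a x + b x + R x + D x) μ := k4.add h₁₀
  have k6 : Integrable (fun x => e x + w x + a x + b x + R x + D x + τ) μ :=
    k5.add (integrable_const _)
  have k7 : Integrable (fun x => e x + w x + a x + b x + R x + D x + τ + τ * c x) μ :=
    k6.add (h₁₁.const_mul _)
  have k8 : Integrable (fun x => s * F₁ x - t * F₀ x) μ := (h₃.const_mul _).sub (h₄.const_mul _)
  have k9 : Integrable (fun x => s * F₁ x - t * F₀ x
      - C * (e x + w x + a x + b x + R x + D x + τ + τ * c x)) μ := k8.sub (k7.const_mul _)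
  have k10 : Integrable (fun x => D₁ x - D₀ x) μ := h₁.sub h₂
  have H := integral_mono_ae (k10.add (k9.const_mul τ)) (hG.const_mul τ) h
  rw [integral_add' k10 (k9.const_mul τ), integral_sub h₁ h₂, integral_const_mul,
    integral_sub k8 (k7.const_mul _), integral_sub (h₃.const_mul _) (h₄.const_mul _),
    integral_const_mul, integral_const_mul, integral_const_mul, integral_add k6 (h₁₁.const_mul _),
    integral_add k5 (integrable_const _), integral_add k4 h₁₀, integral_add k3 h₉,
    integral_add k2 h₈, integral_add k1 h₇, integral_add h₅ h₆, integral_const_mul,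
    integral_const, integral_const_mul, hG0, smul_eq_mul] at H
  linarith

/-- The discrete energy of the errors after `n` steps. -/
noncomputable def schemeEnergy (Ω : Set (E d)) (ν μ lam τ : ℝ) (u : ℝ → LpΩ (E d) ∞ Ω)
    (p : ℝ → LpΩ ℝ ∞ Ω) (ρn : ℕ → E d → ℝ) (un : ℕ → E d → E d) (pn : ℕ → E d → ℝ) (n : ℕ) : ℝ :=
  ∫ x in Ω, energyDensity τ ν μ lam (ρn n x) (p (n * τ) x - pn n x) (u (n * τ) x - un n x)
    (jac Ω (u (n * τ)) x - jac Ω (un n) x)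

/-- The squared norm of the strain rate of the velocity error after `n` steps. -/
noncomputable def schemeStrain (Ω : Set (E d)) (τ : ℝ) (u : ℝ → LpΩ (E d) ∞ Ω)
    (un : ℕ → E d → E d) (n : ℕ) : ℝ :=
  ∫ x in Ω, frob (msym (jac Ω (u (n * τ)) x - jac Ω (un n) x)) ^ 2

theorem l2sq_real (g : E d → ℝ) : l2sq Ω g = ∫ x in Ω, g x ^ 2 := by
  simp only [l2sq, Real.norm_eq_abs, sq_abs]

theorem l2sq_nonneg {F : Type*} [NormedAddCommGroup F] (g : E d → F) : 0 ≤ l2sq Ω g :=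
  integral_nonneg fun _ => sq_nonneg _

theorem integrable_sq {g : E d → ℝ} (hg : MemLp g 2 (volume.restrict Ω)) :
    Integrable (fun x => g x ^ 2) (volume.restrict Ω) := by
  simpa using integrable_norm_sq hg

theorem integrable_energyDensity [IsFiniteMeasure (volume.restrict Ω)] {τ ν μ lam : ℝ}
    {q c : E d → ℝ} {e : E d → E d} {X : E d → Matrix (Fin d) (Fin d) ℝ}
    (hq : MemLp q ∞ (volume.restrict Ω)) (hc : MemLp c 2 (volume.restrict Ω))
    (he : MemLp e 2 (volume.restrict Ω)) (hX : MatLp Ω 2 X) :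
    Integrable (fun x => energyDensity τ ν μ lam (q x) (c x) (e x) (X x)) (volume.restrict Ω) := by
  have hmul : ∀ {g : E d → ℝ}, Integrable g (volume.restrict Ω) →
      Integrable (fun x => q x * g x) (volume.restrict Ω) := fun hg =>
    memLp_one_iff_integrable.1 (memLp_mul (p := ∞) hq (memLp_one_iff_integrable.2 hg))
  have h1 := hmul (integrable_norm_sq he)
  have h2 := hmul (integrable_frob_sq hX.msym)
  have h3 := hmul (integrable_sq hX.trace)
  have h4 := integrable_sq hc
  refine ((h1.const_mul (1 / 2)).add ((((h2.const_mul ν).add (h3.const_mul (μ / 2))).add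
    (h4.const_mul (1 / (2 * lam)))).const_mul τ)).congr (Eventually.of_forall fun x => ?_)
  simp only [Pi.add_apply, energyDensity]
  ring

section

variable {T : ℝ} {α : ℝ≥0} {η : ℝ → ℝ} {f : ℝ → LpΩ (E d) 2 Ω} {ρ : ℝ → LpΩ ℝ ∞ Ω}
  {u u' : ℝ → LpΩ (E d) ∞ Ω} {p : ℝ → LpΩ ℝ ∞ Ω} {lam γ K L m : ℝ} {τ : ℝ} {N : ℕ}
  {ρn : ℕ → E d → ℝ} {mn un : ℕ → E d → E d} {pn Rn : ℕ → E d → ℝ}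

theorem Setting.err_memLp [IsFiniteMeasure (volume.restrict Ω)]
    (hs : IsScheme Ω η f (ρ 0) (u 0) (p 0) lam τ N ρn mn un pn Rn) {n : ℕ} (hn : n ≤ N) (t : ℝ) :
    MemLp (fun x => u t x - un n x) 2 (volume.restrict Ω) ∧
    MemLp (fun x => p t x - pn n x) 2 (volume.restrict Ω) ∧
    MemLp (fun x => ρ t x - ρn n x) 2 (volume.restrict Ω) :=
  ⟨(memLp_two_of_top (Lp.memLp _)).sub (hs.u_mem n hn).memLp,
    (memLp_two_of_top (Lp.memLp _)).sub (hs.p_mem n hn),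
    (memLp_two_of_top (Lp.memLp _)).sub (hs.rho_mem n hn).1⟩

theorem Setting.jac_err_memLp [IsFiniteMeasure (volume.restrict Ω)]
    (S : Setting Ω T α η f ρ u u' p lam γ K L m) (hτ : 0 < τ) (hN : N * τ = T)
    (hs : IsScheme Ω η f (ρ 0) (u 0) (p 0) lam τ N ρn mn un pn Rn) {n : ℕ} (hn : n ≤ N) :
    MatLp Ω 2 (fun x => jac Ω (u (n * τ)) x - jac Ω (un n) x) :=
  (S.exact.u_dirichlet _ (mem_Icc_of_mul_eq hτ hN hn)).jac.sub (hs.u_mem n hn).jac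

/-- The discrete energy controls the velocity and the pressure errors. -/
theorem Setting.le_schemeEnergy [IsFiniteMeasure (volume.restrict Ω)]
    (S : Setting Ω T α η f ρ u u' p lam γ K L m) (hτ : 0 < τ) (hN : N * τ = T)
    (hs : IsScheme Ω η f (ρ 0) (u 0) (p 0) lam τ N ρn mn un pn Rn)
    (hc : DensityConditions Ω η (ρ 0) lam γ τ N ρn) {n : ℕ} (hn : n ≤ N) :
    rhoMin Ω (ρ 0) / 2 * l2sq Ω (fun x => u (n * τ) x - un n x)
      + τ / (2 * lam) * (∫ x in Ω, (p (n * τ) x - pn n x) ^ 2)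
      ≤ schemeEnergy Ω (nuBar Ω η (ρ 0)) (lamBar Ω lam (ρ 0)) lam τ u p ρn un pn n := by
  obtain ⟨e1, e2, -⟩ := Setting.err_memLp (u := u) (p := p) (ρ := ρ) hs hn (n * τ)
  have hν := nuBar_nonneg (Ω := Ω) (f := ρ 0) η
  have hμ := (lamBar_pos S.restrict_ne_zero (Lp.memLp (ρ 0)) S.rho_pos S.lam_pos).le
  have i1 := (integrable_norm_sq e1).const_mul (rhoMin Ω (ρ 0) / 2)
  have i2 := (integrable_sq e2).const_mul (τ / (2 * lam))
  rw [l2sq, ← integral_const_mul, ← integral_const_mul, ← integral_add i1 i2]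
  refine integral_mono_ae (i1.add i2) (integrable_energyDensity (S.rho_memLp hs hc hn) e2 e1
    (S.jac_err_memLp hτ hN hs hn)) ?_
  filter_upwards [hc.max_principle n hn] with x hx
  have hq := S.rho_pos.le.trans hx.1
  simp only [energyDensity]
  have h1 := mul_le_mul_of_nonneg_right hx.1 (sq_nonneg ‖u (n * τ) x - un n x‖)
  have h2 : 0 ≤ τ * (nuBar Ω η (ρ 0) * ρn n x
      * frob (msym (jac Ω (u (n * τ)) x - jac Ω (un n) x)) ^ 2) := by positivity
  have h3 : 0 ≤ τ * (lamBar Ω lam (ρ 0) * ρn n x / 2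
      * (jac Ω (u (n * τ)) x - jac Ω (un n) x).trace ^ 2) := by positivity
  have h4 : τ / (2 * lam) * (p (n * τ) x - pn n x) ^ 2
      = τ * ((p (n * τ) x - pn n x) ^ 2 / (2 * lam)) := by ring
  rw [h4]
  linarith

/-- The energy inequality of one time step. -/
theorem Setting.schemeEnergy_succ_le [IsFiniteMeasure (volume.restrict Ω)]
    (S : Setting Ω T α η f ρ u u' p lam γ K L m) (hτ : 0 < τ)
    (hN : N * τ = T) (hτ1 : τ ≤ 1)
    (hs : IsScheme Ω η f (ρ 0) (u 0) (p 0) lam τ N ρn mn un pn Rn)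
    (hc : DensityConditions Ω η (ρ 0) lam γ τ N ρn) {n : ℕ} (hn : n < N) :
    schemeEnergy Ω (nuBar Ω η (ρ 0)) (lamBar Ω lam (ρ 0)) lam τ u p ρn un pn (n + 1)
      - schemeEnergy Ω (nuBar Ω η (ρ 0)) (lamBar Ω lam (ρ 0)) lam τ u p ρn un pn n
      + τ * (m / 8 * schemeStrain Ω τ u un (n + 1) - m / 16 * schemeStrain Ω τ u un n
        - stepConst L m * (l2sq Ω (fun x => u (n * τ) x - un n x)
          + l2sq Ω (fun x => u ((n + 1 : ℕ) * τ) x - un (n + 1) x)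
          + l2sq Ω (fun x => ρ (n * τ) x - ρn n x)
          + l2sq Ω (fun x => ρ ((n + 1 : ℕ) * τ) x - ρn (n + 1) x)
          + l2sq Ω (Rn (n + 1))
          + (∫ x in Ω, frob (msym (jac Ω (u ((n + 1 : ℕ) * τ)) x - jac Ω (u (n * τ)) x)) ^ 2)
          + (volume.restrict Ω).real univ * τ
          + τ * ∫ x in Ω, (p (n * τ) x - pn n x) ^ 2)) ≤ 0 := by
  have t0 := mem_Icc_of_mul_eq hτ hN hn.le
  have t1 := mem_Icc_of_mul_eq hτ hN hn
  obtain ⟨a1, a2, a3⟩ := Setting.err_memLp (u := u) (p := p) (ρ := ρ) hs hn.le (n * τ)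
  obtain ⟨b1, b2, b3⟩ := Setting.err_memLp (u := u) (p := p) (ρ := ρ) hs hn ((n + 1 : ℕ) * τ)
  obtain ⟨G1, G2⟩ := S.integral_stepResidual hτ hN hτ1 hs hc hn
  have hJ0 := S.jac_err_memLp hτ hN hs hn.le
  have hJ1 := S.jac_err_memLp hτ hN hs hn
  have hdJ := (S.exact.u_dirichlet _ t1).jac.sub (S.exact.u_dirichlet _ t0).jac
  simp only [l2sq_real]
  refine integral_energy_balance
    (integrable_energyDensity (S.rho_memLp hs hc hn) b2 b1 hJ1)
    (integrable_energyDensity (S.rho_memLp hs hc hn.le) a2 a1 hJ0)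
    (integrable_frob_sq hJ1.msym) (integrable_frob_sq hJ0.msym) (integrable_norm_sq a1)
    (integrable_norm_sq b1) (integrable_sq a3) (integrable_sq b3)
    (integrable_sq (S.residual_memLp hτ hN hτ1 hs hc hn)) (integrable_frob_sq hdJ.msym)
    (integrable_sq a2) G1 G2 ?_
  filter_upwards [S.stepBounds hτ hN hτ1 hs hc hn, S.exact.incompressible _ t0,
    S.exact.incompressible _ t1, hs.pressure n hn] with x H d0 d1 hp
  exact H.le_stepResidual S.dim_le rfl rfl rfl rfl d0 d1 hp

end

end

/-! ### Discrete Gronwall argument -/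

section

variable {d : ℕ} {Ω : Set (E d)}

/-- The right-hand side itself is the induction variable: it grows at most by the factor 1 + A from
n to n + 1. -/
theorem discrete_gronwall {x : ℕ → ℝ} {A B : ℝ} {N : ℕ} (hA : 0 ≤ A)
    (h : ∀ n ≤ N, x n ≤ B + A * ∑ k ∈ Finset.range n, x k) :
    ∀ n ≤ N + 1, B + A * ∑ k ∈ Finset.range n, x k ≤ B * (1 + A) ^ n := by
  intro n
  induction n with
  | zero => simp
  | succ n ih =>
    intro hn
    have h1 := ih (by omega)
    have h2 := mul_le_mul_of_nonneg_left (h n (by omega)) hA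
    have h3 := mul_le_mul_of_nonneg_right h1 (by linarith : (0 : ℝ) ≤ 1 + A)
    rw [Finset.sum_range_succ, pow_succ]
    linarith

theorem one_add_pow_le_exp {A τ T : ℝ} {n N : ℕ} (hA : 0 ≤ A) (hτ : 0 ≤ τ) (hN : N * τ = T)
    (hn : n ≤ N) : (1 + A * τ) ^ n ≤ Real.exp (A * T) := by
  have h1 : 1 + A * τ ≤ Real.exp (A * τ) := by linarith [Real.add_one_le_exp (A * τ)]
  calc (1 + A * τ) ^ n ≤ Real.exp (A * τ) ^ n := by gcongr
    _ = Real.exp (n * (A * τ)) := (Real.exp_nat_mul _ _).symm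
    _ ≤ Real.exp (A * T) := by
      refine Real.exp_le_exp.2 ?_
      rw [← hN]
      calc (n : ℝ) * (A * τ) ≤ N * (A * τ) := by gcongr
        _ = A * (N * τ) := by ring

/-- The abstract form of the error estimate: the energies `x`, the dissipations `y`, the density
errors `a` and the residuals `R` satisfy a one-step inequality, with `a` and `R` controlled by the
past energies. -/
theorem energy_gronwall {x y a R : ℕ → ℝ} {M B c τ T : ℝ} {N : ℕ} (hM : 0 ≤ M) (hB : 0 ≤ B)
    (hc : 0 ≤ c) (hτ : 0 < τ) (hN : N * τ = T) (hMτ : M * τ ≤ 1 / 2)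
    (hx : ∀ n ≤ N, 0 ≤ x n) (hy : ∀ n ≤ N, 0 ≤ y n) (ha : ∀ n ≤ N, 0 ≤ a n)
    (hx0 : x 0 = 0) (hy0 : y 0 = 0)
    (h : ∀ n < N, x (n + 1) - x n + τ * (2 * c * y (n + 1) - c * y n)
      ≤ M * (τ * (x n + x (n + 1) + a n + a (n + 1) + R (n + 1) + τ)))
    (hR : ∀ n ≤ N, τ * ∑ k ∈ Finset.range n, R (k + 1)
      ≤ B * τ + B * (τ * ∑ k ∈ Finset.range n, x k))
    (hA : ∀ n ≤ N, τ * ∑ k ∈ Finset.range (n + 1), a k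
      ≤ B * τ + B * (τ * ∑ k ∈ Finset.range n, x k)) :
    ∀ n ≤ N, x n + 2 * c * (τ * ∑ k ∈ Finset.range (n + 1), y k)
      ≤ 2 * M * (T + 3 * B) * Real.exp (2 * M * (2 + 3 * B) * T) * τ := by
  have hT : 0 ≤ T := by rw [← hN]; positivity
  -- Summation of the one-step inequality. Each dissipation enters with 2c and leaves with −c at the
  -- next step, so c survives everywhere and 2c at the last index; x and a are counted twice except
  -- at the last index, and `x 0`, `y 0` vanish.
  have key : ∀ n ≤ N, x n + c * (τ * ∑ k ∈ Finset.range (n + 1), y k) + c * τ * y n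
      ≤ M * (2 * (τ * ∑ k ∈ Finset.range n, x k) + τ * x n
        + 2 * (τ * ∑ k ∈ Finset.range (n + 1), a k) - τ * a n
        + τ * ∑ k ∈ Finset.range n, R (k + 1) + n * τ ^ 2) := by
    intro n
    induction n with
    | zero =>
      intro _
      have : 0 ≤ a 0 := ha 0 (Nat.zero_le _)
      simp only [hx0, hy0, zero_add, Finset.range_one, Finset.sum_singleton, Finset.range_zero,
        Finset.sum_empty]
      have : 0 ≤ M * (τ * a 0) := by positivity
      simp only [mul_zero, add_zero, Nat.cast_zero, zero_mul, zero_add]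
      linarith
    | succ n ih =>
      intro hn
      have h1 := ih (by omega)
      have h2 := h n hn
      rw [Finset.sum_range_succ _ (n + 1), Finset.sum_range_succ x n,
        Finset.sum_range_succ (fun k => R (k + 1)), Finset.sum_range_succ a (n + 1)]
      push_cast
      linarith
  -- The implicit term Mτ x n is at most half of x n and is moved to the left; the remaining
  -- inequality is doubled.
  have key2 : ∀ n ≤ N, x n + 2 * c * (τ * ∑ k ∈ Finset.range (n + 1), y k)
      ≤ 2 * M * (T + 3 * B) * τ
        + 2 * M * (2 + 3 * B) * τ * ∑ k ∈ Finset.range n, x k := by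
    intro n hn
    have h1 := key n hn
    have h2 := mul_le_mul_of_nonneg_left (hR n hn) hM
    have h3 := mul_le_mul_of_nonneg_left (hA n hn) hM
    have h4 : M * (n * τ ^ 2) ≤ M * (T * τ) := by
      have : (n : ℝ) * τ ≤ T := by
        rw [← hN]; gcongr
      have := mul_le_mul_of_nonneg_right this hτ.le
      exact mul_le_mul_of_nonneg_left (by linarith) hM
    have h5 := mul_le_mul_of_nonneg_right hMτ (hx n hn)
    have h6 : 0 ≤ c * τ * y n := by have := hy n hn; positivity
    have h7 : 0 ≤ M * (τ * a n) := by have := ha n hn; positivity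
    linarith
  intro n hn
  have hys : ∀ n ≤ N, 0 ≤ 2 * c * (τ * ∑ k ∈ Finset.range (n + 1), y k) := fun n hn => by
    have : 0 ≤ ∑ k ∈ Finset.range (n + 1), y k :=
      Finset.sum_nonneg fun k hk => hy k (by have := Finset.mem_range.1 hk; omega)
    positivity
  have hg := discrete_gronwall (N := N) (x := x) (A := 2 * M * (2 + 3 * B) * τ)
    (B := 2 * M * (T + 3 * B) * τ) (by positivity)
    (fun k hk => by have := key2 k hk; have := hys k hk; linarith) n (by omega)
  refine (key2 n hn).trans (hg.trans ?_)
  have := one_add_pow_le_exp (A := 2 * M * (2 + 3 * B)) (by positivity) hτ.le hN hn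
  calc 2 * M * (T + 3 * B) * τ * (1 + 2 * M * (2 + 3 * B) * τ) ^ n
      ≤ 2 * M * (T + 3 * B) * τ * Real.exp (2 * M * (2 + 3 * B) * T) := by gcongr
    _ = _ := by ring

/-- The constant of the one-step inequality for the discrete energy. -/
noncomputable def growthConst (V L m lam c : ℝ) : ℝ :=
  stepConst L m * (2 / c + 2 * lam + 1 + 4 * L ^ 4 / m / m + (10 * L ^ 4 * V + 2 * L ^ 2) / m + V)

section

variable {T : ℝ} {α : ℝ≥0} {η : ℝ → ℝ} {f : ℝ → LpΩ (E d) 2 Ω} {ρ : ℝ → LpΩ ℝ ∞ Ω}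
  {u u' : ℝ → LpΩ (E d) ∞ Ω} {p : ℝ → LpΩ ℝ ∞ Ω} {lam γ K L m : ℝ} {τ : ℝ} {N : ℕ}
  {ρn : ℕ → E d → ℝ} {mn un : ℕ → E d → E d} {pn Rn : ℕ → E d → ℝ}

theorem Setting.stepConst_nonneg (S : Setting Ω T α η f ρ u u' p lam γ K L m) :
    0 ≤ stepConst L m := by
  have := S.one_le
  have := S.m_pos
  unfold stepConst
  positivity

theorem Setting.growthConst_nonneg (S : Setting Ω T α η f ρ u u' p lam γ K L m) {V : ℝ}
    (hV : 0 ≤ V) : 0 ≤ growthConst V L m lam (rhoMin Ω (ρ 0)) := by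
  have h1 := S.one_le
  have h2 := S.m_pos
  have h3 := S.rho_pos
  have h4 := S.lam_pos
  have h5 := S.stepConst_nonneg
  unfold growthConst
  positivity

/-- All errors on the right are expressed by the energy: velocity errors through ρ_min, τ times the
pressure error through λ, and the strain increment through the density error and τ. -/
theorem Setting.schemeEnergy_growth [IsFiniteMeasure (volume.restrict Ω)]
    (S : Setting Ω T α η f ρ u u' p lam γ K L m) (hτ : 0 < τ)
    (hN : N * τ = T) (hτ1 : τ ≤ 1)
    (hs : IsScheme Ω η f (ρ 0) (u 0) (p 0) lam τ N ρn mn un pn Rn)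
    (hc : DensityConditions Ω η (ρ 0) lam γ τ N ρn) {n : ℕ} (hn : n < N) :
    schemeEnergy Ω (nuBar Ω η (ρ 0)) (lamBar Ω lam (ρ 0)) lam τ u p ρn un pn (n + 1)
      - schemeEnergy Ω (nuBar Ω η (ρ 0)) (lamBar Ω lam (ρ 0)) lam τ u p ρn un pn n
      + τ * (2 * (m / 16) * schemeStrain Ω τ u un (n + 1) - m / 16 * schemeStrain Ω τ u un n)
    ≤ growthConst ((volume.restrict Ω).real univ) L m lam (rhoMin Ω (ρ 0)) * (τ *
      (schemeEnergy Ω (nuBar Ω η (ρ 0)) (lamBar Ω lam (ρ 0)) lam τ u p ρn un pn n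
        + schemeEnergy Ω (nuBar Ω η (ρ 0)) (lamBar Ω lam (ρ 0)) lam τ u p ρn un pn (n + 1)
        + l2sq Ω (fun x => ρ (n * τ) x - ρn n x)
        + l2sq Ω (fun x => ρ ((n + 1 : ℕ) * τ) x - ρn (n + 1) x)
        + l2sq Ω (Rn (n + 1)) + τ)) := by
  have hm := S.m_pos
  have hL : 0 ≤ L := by linarith [S.one_le]
  have hρ := S.rho_pos
  have hlam := S.lam_pos
  have hC := S.stepConst_nonneg
  have H := S.schemeEnergy_succ_le hτ hN hτ1 hs hc hn
  have E0 := S.le_schemeEnergy hτ hN hs hc hn.le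
  have E1 := S.le_schemeEnergy hτ hN hs hc hn
  have hD := S.bounds.integral_strain_sub_le S.dim_le S.isOpen S.T_pos S.lip S.f_cont S.exact
    hm S.one_le S.K_le S.α_le S.αK_le (S.rho_memLp hs hc hn)
    ((hc.max_principle _ hn).mono fun x hx => (S.eta_mem _ hx).1)
    (mem_Icc_of_mul_eq hτ hN hn.le) (mem_Icc_of_mul_eq hτ hN hn)
    (by push_cast; linarith : (n : ℝ) * τ ≤ (n + 1 : ℕ) * τ)
  rw [← l2sq_real fun x => ρ ((n + 1 : ℕ) * τ) x - ρn (n + 1) x] at hD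
  have e0 : ((n + 1 : ℕ) : ℝ) * τ - n * τ = τ := by push_cast; ring
  rw [e0] at hD
  have n1 := l2sq_nonneg (Ω := Ω) (fun x => u (n * τ) x - un n x)
  have n2 := l2sq_nonneg (Ω := Ω) (fun x => u ((n + 1 : ℕ) * τ) x - un (n + 1) x)
  have n3 := l2sq_nonneg (Ω := Ω) (fun x => ρ (n * τ) x - ρn n x)
  have n4 := l2sq_nonneg (Ω := Ω) (fun x => ρ ((n + 1 : ℕ) * τ) x - ρn (n + 1) x)
  have n5 := l2sq_nonneg (Ω := Ω) (Rn (n + 1))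
  have n6 : 0 ≤ ∫ x in Ω, (p (n * τ) x - pn n x) ^ 2 := integral_nonneg fun x => sq_nonneg _
  have n7 : 0 ≤ ∫ x in Ω, (p ((n + 1 : ℕ) * τ) x - pn (n + 1) x) ^ 2 :=
    integral_nonneg fun x => sq_nonneg _
  have hV : 0 ≤ (volume.restrict Ω).real univ := measureReal_nonneg
  rw [growthConst]
  set x0 := schemeEnergy Ω (nuBar Ω η (ρ 0)) (lamBar Ω lam (ρ 0)) lam τ u p ρn un pn n
  set x1 := schemeEnergy Ω (nuBar Ω η (ρ 0)) (lamBar Ω lam (ρ 0)) lam τ u p ρn un pn (n + 1)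
  set a0 := l2sq Ω (fun x => ρ (n * τ) x - ρn n x)
  set a1 := l2sq Ω (fun x => ρ ((n + 1 : ℕ) * τ) x - ρn (n + 1) x)
  set r := l2sq Ω (Rn (n + 1))
  set l0 := l2sq Ω (fun x => u (n * τ) x - un n x)
  set l1 := l2sq Ω (fun x => u ((n + 1 : ℕ) * τ) x - un (n + 1) x)
  set P := ∫ x in Ω, (p (n * τ) x - pn n x) ^ 2
  set P1 := ∫ x in Ω, (p ((n + 1 : ℕ) * τ) x - pn (n + 1) x) ^ 2
  set D := ∫ x in Ω, frob (msym (jac Ω (u ((n + 1 : ℕ) * τ)) x - jac Ω (u (n * τ)) x)) ^ 2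
  set V := (volume.restrict Ω).real univ
  set c := rhoMin Ω (ρ 0)
  have z1 : 0 ≤ τ / (2 * lam) * P := by positivity
  have z2 : 0 ≤ c / 2 * l0 := by positivity
  have z3 : 0 ≤ τ / (2 * lam) * P1 := by positivity
  have z4 : 0 ≤ c / 2 * l1 := by positivity
  have b0 : l0 ≤ 2 / c * x0 := by
    have : l0 = 2 / c * (c / 2 * l0) := by field_simp
    rw [this]; gcongr; linarith
  have b1 : l1 ≤ 2 / c * x1 := by
    have : l1 = 2 / c * (c / 2 * l1) := by field_simp
    rw [this]; gcongr; linarith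
  -- The pressure error is present in the energy only with weight τ, which is exactly the weight
  -- with which it occurs on the right.
  have b2 : τ * P ≤ 2 * lam * x0 := by
    have : τ * P = 2 * lam * (τ / (2 * lam) * P) := by field_simp
    rw [this]; gcongr; linarith
  have b3 : D ≤ 4 * L ^ 4 / m / m * a1 + (10 * L ^ 4 * V + 2 * L ^ 2) / m * τ := by
    have : D = m * D / m := by field_simp
    rw [this, div_le_iff₀ hm]
    refine hD.trans (le_of_eq ?_)
    field_simp
  have hx0 : 0 ≤ x0 := by linarith
  have hx1 : 0 ≤ x1 := by linarith
  have c1 : 0 ≤ 2 / c := by positivity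
  have c2 : 0 ≤ 2 * lam := by positivity
  have c3 : 0 ≤ 4 * L ^ 4 / m / m := by positivity
  have c4 : 0 ≤ (10 * L ^ 4 * V + 2 * L ^ 2) / m := by positivity
  set k3 := 4 * L ^ 4 / m / m
  set k4 := (10 * L ^ 4 * V + 2 * L ^ 2) / m
  set k1 := 2 / c
  have hin : l0 + l1 + a0 + a1 + r + D + V * τ + τ * P
      ≤ (k1 + 2 * lam + 1 + k3 + k4 + V) * (x0 + x1 + a0 + a1 + r + τ) := by
    have s1 := mul_nonneg c1 (by positivity : 0 ≤ a0 + a1 + r + τ)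
    have s2 := mul_nonneg c2 (by positivity : 0 ≤ x1 + a0 + a1 + r + τ)
    have s3 := mul_nonneg c3 (by positivity : 0 ≤ x0 + x1 + a0 + r + τ)
    have s4 := mul_nonneg c4 (by positivity : 0 ≤ x0 + x1 + a0 + a1 + r)
    have s5 := mul_nonneg hV (by positivity : 0 ≤ x0 + x1 + a0 + a1 + r)
    linarith
  have hfin := mul_le_mul_of_nonneg_left hin (mul_nonneg hτ.le hC)
  linarith

end

end

/-! ### From the energy to the error norms -/

section

variable {d : ℕ} {Ω : Set (E d)}

/-- Korn's inequality for the velocity error; the factor 2 is its constant. -/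
theorem h1sq_le (hΩ : IsOpen Ω) [IsFiniteMeasure (volume.restrict Ω)] {v w : E d → E d}
    (hv : MemH10v Ω v) (hw : MemH10v Ω w) :
    h1sq Ω (fun x => v x - w x) ≤ l2sq Ω (fun x => v x - w x)
      + 2 * ∫ x in Ω, frob (msym (jac Ω v x - jac Ω w x)) ^ 2 := by
  have hvw := hv.sub hΩ hw
  have h1 : ∑ i, ∑ j, l2sq Ω (wd Ω j fun x => (v x - w x) i)
      = ∫ x in Ω, ddot (jac Ω (fun y => v y - w y) x) (jac Ω (fun y => v y - w y) x) := by
    rw [integral_ddot hvw.jac hvw.jac]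
    refine Finset.sum_congr rfl fun i _ => Finset.sum_congr rfl fun j _ => ?_
    rw [l2sq_real]
    simp only [jac, Matrix.of_apply, sq]
  have h2 : ∫ x in Ω, ddot (strain Ω (fun y => v y - w y) x) (strain Ω (fun y => v y - w y) x)
      = ∫ x in Ω, frob (msym (jac Ω v x - jac Ω w x)) ^ 2 := by
    refine integral_congr_ae ?_
    filter_upwards [hv.jac_sub hΩ hw] with x hx
    rw [strain_eq_msym, hx, sq_frob]
  have := korn_inequality hvw
  rw [h1sq, h1, ← h2]
  linarith

theorem jac_congr (hΩ : IsOpen Ω) {v w : E d → E d} (hv : MemH10v Ω v)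
    (h : v =ᵐ[volume.restrict Ω] w) : ∀ᵐ x ∂(volume.restrict Ω), jac Ω w x = jac Ω v x := by
  have h' := eventually_all.2 fun i => eventually_all.2 fun j =>
    wd_congr hΩ (hv i).1 (h.mono fun x hx => congrArg (fun z : E d => z i) hx) j (f' := fun x => w x i)
  filter_upwards [h'] with x hx
  ext i j
  exact hx i j

theorem frob_msym_zero : frob (msym (0 : Matrix (Fin d) (Fin d) ℝ)) = 0 := by
  have : msym (0 : Matrix (Fin d) (Fin d) ℝ) = 0 := by
    ext i j
    simp [msym_apply]
  rw [this, frob, ddot_eq_sum]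
  simp

section

variable {T : ℝ} {α : ℝ≥0} {η : ℝ → ℝ} {f : ℝ → LpΩ (E d) 2 Ω} {ρ : ℝ → LpΩ ℝ ∞ Ω}
  {u u' : ℝ → LpΩ (E d) ∞ Ω} {p : ℝ → LpΩ ℝ ∞ Ω} {lam γ K L m : ℝ} {τ : ℝ} {N : ℕ}
  {ρn : ℕ → E d → ℝ} {mn un : ℕ → E d → E d} {pn Rn : ℕ → E d → ℝ}

theorem IsScheme.jac_init (hΩ : IsOpen Ω)
    (hs : IsScheme Ω η f (ρ 0) (u 0) (p 0) lam τ N ρn mn un pn Rn) :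
    ∀ᵐ x ∂(volume.restrict Ω), jac Ω (u 0) x = jac Ω (un 0) x :=
  jac_congr hΩ (hs.u_mem 0 (Nat.zero_le _)) hs.u_init

theorem IsScheme.schemeStrain_zero (hΩ : IsOpen Ω)
    (hs : IsScheme Ω η f (ρ 0) (u 0) (p 0) lam τ N ρn mn un pn Rn) :
    schemeStrain Ω τ u un 0 = 0 := by
  refine integral_eq_zero_of_ae ?_
  filter_upwards [hs.jac_init hΩ] with x hx
  rw [Nat.cast_zero, zero_mul, hx, sub_self, frob_msym_zero]
  simp

theorem IsScheme.schemeEnergy_zero (hΩ : IsOpen Ω) (ν μ : ℝ)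
    (hs : IsScheme Ω η f (ρ 0) (u 0) (p 0) lam τ N ρn mn un pn Rn) :
    schemeEnergy Ω ν μ lam τ u p ρn un pn 0 = 0 := by
  refine integral_eq_zero_of_ae ?_
  filter_upwards [hs.jac_init hΩ, hs.u_init, hs.p_init] with x h1 h2 h3
  rw [Nat.cast_zero, zero_mul, h1, h2, h3, sub_self, sub_self, sub_self, energyDensity,
    frob_msym_zero]
  simp

/-- The assumptions on the residuals and on the density errors involve past velocity errors, which
the past energies dominate by the factor 2/ρ_min; this gives `B`, where τ² is weakened to τ. -/
theorem Setting.error_le [IsFiniteMeasure (volume.restrict Ω)]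
    (S : Setting Ω T α η f ρ u u' p lam γ K L m) {Cρ M B : ℝ} (hCρ : 0 < Cρ)
    (hM : M = growthConst ((volume.restrict Ω).real univ) L m lam (rhoMin Ω (ρ 0)))
    (hB : B = Cρ * (1 + 2 / rhoMin Ω (ρ 0))) (hτ : 0 < τ)
    (hN : N * τ = T) (hτ1 : τ ≤ 1) (hMτ : M * τ ≤ 1 / 2)
    (hs : IsScheme Ω η f (ρ 0) (u 0) (p 0) lam τ N ρn mn un pn Rn)
    (hc : DensityConditions Ω η (ρ 0) lam γ τ N ρn)
    (hR : ∀ n ≤ N, τ * ∑ k ∈ Finset.Icc 1 n, l2sq Ω (Rn k)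
      ≤ Cρ * τ ^ 2
        + Cρ * (τ * ∑ k ∈ Finset.range n, l2sq Ω (fun x => u (k * τ) x - un k x)))
    (hρ : ∀ n ≤ N, τ * ∑ k ∈ Finset.range (n + 1), l2sq Ω (fun x => ρ (k * τ) x - ρn k x)
      ≤ Cρ * τ ^ 2
        + Cρ * (τ * ∑ k ∈ Finset.range n, l2sq Ω (fun x => u (k * τ) x - un k x)))
    {n : ℕ} (hn : n ≤ N) :
    rhoMin Ω (ρ 0) / 2 * l2sq Ω (fun x => u (n * τ) x - un n x)
      + m / 8 * (τ * ∑ k ∈ Finset.range (n + 1), schemeStrain Ω τ u un k)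
      ≤ 2 * M * (T + 3 * B) * Real.exp (2 * M * (2 + 3 * B) * T) * τ := by
  have hpos := S.rho_pos
  have hm := S.m_pos
  have hlam := S.lam_pos
  have hM0 : 0 ≤ M := hM ▸ S.growthConst_nonneg measureReal_nonneg
  have hB0 : 0 ≤ B := by rw [hB]; positivity
  set x := schemeEnergy Ω (nuBar Ω η (ρ 0)) (lamBar Ω lam (ρ 0)) lam τ u p ρn un pn with hx
  have hlow : ∀ n ≤ N, rhoMin Ω (ρ 0) / 2 * l2sq Ω (fun y => u (n * τ) y - un n y) ≤ x n := by
    intro n hn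
    have h1 := S.le_schemeEnergy hτ hN hs hc hn
    have h2 : 0 ≤ τ / (2 * lam) * ∫ y in Ω, (p (n * τ) y - pn n y) ^ 2 :=
      mul_nonneg (by positivity) (integral_nonneg fun y => sq_nonneg _)
    linarith
  have hx0 : ∀ n ≤ N, 0 ≤ x n := fun n hn => (hlow n hn).trans' (by
    have := l2sq_nonneg (Ω := Ω) (fun y => u (n * τ) y - un n y)
    positivity)
  have hsum : ∀ n ≤ N, Cρ * τ ^ 2
      + Cρ * (τ * ∑ k ∈ Finset.range n, l2sq Ω (fun y => u (k * τ) y - un k y))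
      ≤ B * τ + B * (τ * ∑ k ∈ Finset.range n, x k) := by
    intro n hn
    have h1 : ∑ k ∈ Finset.range n, l2sq Ω (fun y => u (k * τ) y - un k y)
        ≤ 2 / rhoMin Ω (ρ 0) * ∑ k ∈ Finset.range n, x k := by
      rw [Finset.mul_sum]
      refine Finset.sum_le_sum fun k hk => ?_
      have := hlow k (by have := Finset.mem_range.1 hk; omega)
      rw [div_mul_eq_mul_div, le_div_iff₀ hpos]
      linarith
    have h2 : 0 ≤ ∑ k ∈ Finset.range n, x k :=
      Finset.sum_nonneg fun k hk => hx0 k (by have := Finset.mem_range.1 hk; omega)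
    have h3 : Cρ * τ ^ 2 ≤ B * τ := by
      have h4 : Cρ * τ ^ 2 ≤ Cρ * τ := by gcongr; nlinarith
      have h5 : 0 ≤ Cρ * (2 / rhoMin Ω (ρ 0)) * τ := by positivity
      rw [hB]
      linarith
    refine add_le_add h3 ?_
    calc Cρ * (τ * ∑ k ∈ Finset.range n, l2sq Ω (fun y => u (k * τ) y - un k y))
        ≤ Cρ * (τ * (2 / rhoMin Ω (ρ 0) * ∑ k ∈ Finset.range n, x k)) := by gcongr
      _ = Cρ * (2 / rhoMin Ω (ρ 0)) * (τ * ∑ k ∈ Finset.range n, x k) := by ring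
      _ ≤ B * (τ * ∑ k ∈ Finset.range n, x k) := by
          rw [hB]
          gcongr
          linarith
  have H := energy_gronwall (x := x) (y := schemeStrain Ω τ u un)
    (a := fun n => l2sq Ω (fun y => ρ (n * τ) y - ρn n y)) (R := fun n => l2sq Ω (Rn n))
    (M := M) (B := B) (c := m / 16) hM0 hB0 (by positivity) hτ hN hMτ hx0
    (fun n _ => integral_nonneg fun y => sq_nonneg _) (fun n _ => l2sq_nonneg _)
    (hs.schemeEnergy_zero S.isOpen _ _) (hs.schemeStrain_zero S.isOpen)
    (fun n hn => hM ▸ S.schemeEnergy_growth hτ hN hτ1 hs hc hn)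
    (fun n hn => by
      refine le_trans (le_of_eq ?_) ((hR n hn).trans (hsum n hn))
      -- The residuals are indexed from 1 in the assumption and from 0, shifted, in the Gronwall
      -- argument.
      rw [Finset.range_eq_Ico, Finset.sum_Ico_add' (fun k => l2sq Ω (Rn k)) 0 n 1]
      rfl)
    (fun n hn => (hρ n hn).trans (hsum n hn)) n hn
  have := hlow n hn
  linarith

end

theorem exists_setting (hd : d = 2 ∨ d = 3) (hΩ_open : IsOpen Ω) (hΩ_conn : IsConnected Ω)
    (hΩ_bdd : Bornology.IsBounded Ω) [IsFiniteMeasure (volume.restrict Ω)]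
    {T : ℝ} (hT : 0 < T) {α : ℝ≥0} {η : ℝ → ℝ} (hη : LipschitzWith α η)
    {f : ℝ → LpΩ (E d) 2 Ω} (hf : ContinuousOn f (Icc 0 T))
    {ρ : ℝ → LpΩ ℝ ∞ Ω} {u : ℝ → LpΩ (E d) ∞ Ω} {p : ℝ → LpΩ ℝ ∞ Ω}
    (hex : IsExact Ω T η f ρ u p) (hρ : 0 < rhoMin Ω (ρ 0))
    (hη_pos : ∀ s ∈ Icc (rhoMin Ω (ρ 0)) (rhoMax Ω (ρ 0)), 0 < η s)
    {lam : ℝ} (hlam : 0 < lam) {γ : ℝ}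
    (hγ2 : γ ^ 2 ≤ min (1 / 4) (1 / (64 * nuBar Ω η (ρ 0)))) :
    ∃ u' K L m, Setting Ω T α η f ρ u u' p lam γ K L m := by
  obtain ⟨K, u', hB⟩ := hex.exists_bounds hT hf
  have hμ := restrict_ne_zero hΩ_open hΩ_conn.nonempty
  obtain ⟨m, M, hm, hmM⟩ := exists_eta_bounds hη.continuous
    (rhoMin_le_rhoMax hμ (Lp.memLp (ρ 0))) hη_pos
  have h1 := nuBar_nonneg (Ω := Ω) (f := ρ 0) η
  have h3 := hB.pos
  have h4 : (0 : ℝ) ≤ α := α.2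
  have h5 : 0 ≤ α * K := by positivity
  have h6 : 0 < lam⁻¹ := by positivity
  have h7 := le_abs_self (rhoMax Ω (ρ 0))
  have h8 := le_abs_self M
  have h9 := abs_nonneg (rhoMax Ω (ρ 0))
  have h10 := abs_nonneg M
  exact ⟨u', K, 1 + 3 * K + α + α * K + nuBar Ω η (ρ 0) + lam⁻¹
    + |rhoMax Ω (ρ 0)| + |M|, m,
    { dim := hd
      isOpen := hΩ_open
      isConnected := hΩ_conn
      isBounded := hΩ_bdd
      T_pos := hT
      lip := hη
      f_cont := hf
      exact := hex
      bounds := hB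
      rho_pos := hρ
      lam_pos := hlam
      gamma_sq := hγ2
      one_le := by linarith
      K_le := by linarith
      α_le := by linarith
      αK_le := by linarith
      nu_le := by linarith
      inv_lam_le := by linarith
      rhoMax_le := by linarith
      m_pos := hm
      eta_mem := fun s hs => ⟨(hmM s hs).1, (hmM s hs).2.trans (by linarith)⟩ }⟩

end

end ACM

open ACM
theorem corollary1 {d : ℕ} (hd : d = 2 ∨ d = 3)
    (Ω : Set (E d)) (hΩ_open : IsOpen Ω) (hΩ_conn : IsConnected Ω)
    (hΩ_bdd : Bornology.IsBounded Ω)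
    (T : ℝ) (hT : 0 < T)
    -- the viscosity, the source term and the exact solution
    (α : ℝ≥0) (η : ℝ → ℝ) (hη_lip : LipschitzWith α η)
    (f : ℝ → LpΩ (E d) 2 Ω) (hf : ContinuousOn f (Icc 0 T))
    (ρ : ℝ → LpΩ ℝ ∞ Ω) (u : ℝ → LpΩ (E d) ∞ Ω) (p : ℝ → LpΩ ℝ ∞ Ω)
    (hexact : IsExact Ω T η f ρ u p)
    (hρ_pos : 0 < rhoMin Ω (ρ 0))
    (hη_pos : ∀ s ∈ Icc (rhoMin Ω (ρ 0)) (rhoMax Ω (ρ 0)), 0 < η s)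
    -- the parameters, and the constant of the assumption on the density approximation
    (lam : ℝ) (hlam : 0 < lam)
    (γ : ℝ) (hγ : 0 < γ) (hγ2 : γ ^ 2 ≤ min (1 / 4) (1 / (64 * nuBar Ω η (ρ 0))))
    (Cρ : ℝ) (hCρ : 0 < Cρ) :
    ∃ C : ℝ, 0 < C ∧ ∃ Ctilde : ℝ, 0 < Ctilde ∧
      ∀ (τ : ℝ) (N : ℕ), 0 < τ → N * τ = T → C * τ < 1 / 2 →
      ∀ (ρn : ℕ → E d → ℝ) (mn un : ℕ → E d → E d) (pn Rn : ℕ → E d → ℝ),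
        IsScheme Ω η f (ρ 0) (u 0) (p 0) lam τ N ρn mn un pn Rn →
        DensityConditions Ω η (ρ 0) lam γ τ N ρn →
        (∀ n ≤ N, τ * ∑ k ∈ Finset.Icc 1 n, l2sq Ω (Rn k)
          ≤ Cρ * τ ^ 2
            + Cρ * (τ * ∑ k ∈ Finset.range n, l2sq Ω (fun x => u (k * τ) x - un k x))) →
        (∀ n ≤ N, τ * ∑ k ∈ Finset.range (n + 1), l2sq Ω (fun x => ρ (k * τ) x - ρn k x)
          ≤ Cρ * τ ^ 2
            + Cρ * (τ * ∑ k ∈ Finset.range n, l2sq Ω (fun x => u (k * τ) x - un k x))) →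
        (⨆ n : Fin (N + 1), l2sq Ω (fun x => u ((n : ℕ) * τ) x - un n x))
          + τ * ∑ n ∈ Finset.range (N + 1), h1sq Ω (fun x => u (n * τ) x - un n x)
          ≤ Ctilde * τ := by
  have : IsFiniteMeasure (volume.restrict Ω) :=
    isFiniteMeasure_restrict.2 hΩ_bdd.measure_lt_top.ne
  obtain ⟨u', K, L, m, S⟩ := exists_setting hd hΩ_open hΩ_conn hΩ_bdd hT hη_lip hf hexact hρ_pos
    hη_pos hlam hγ2
  have hm := S.m_pos
  obtain ⟨M, hM⟩ : ∃ M, M = growthConst ((volume.restrict Ω).real univ) L m lam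
    (rhoMin Ω (ρ 0)) := ⟨_, rfl⟩
  obtain ⟨B, hB⟩ : ∃ B, B = Cρ * (1 + 2 / rhoMin Ω (ρ 0)) := ⟨_, rfl⟩
  obtain ⟨X, hX⟩ : ∃ X, X = 2 * M * (T + 3 * B) * Real.exp (2 * M * (2 + 3 * B) * T) := ⟨_, rfl⟩
  have hM0 : 0 ≤ M := hM ▸ S.growthConst_nonneg measureReal_nonneg
  have hB0 : 0 ≤ B := by rw [hB]; positivity
  have hX0 : 0 ≤ X := by rw [hX]; positivity
  -- The condition (M + 1)τ < 1/2 yields both Mτ ≤ 1/2 and τ ≤ 1. In the second constant, T + 2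
  -- collects the maximum and the summed L² errors, 16/m is Korn's factor 2 times 8/m, and the 1
  -- ensures positivity.
  refine ⟨M + 1, by positivity, 1 + X * (2 / rhoMin Ω (ρ 0)) * (T + 2) + X * (16 / m),
    by positivity, ?_⟩
  intro τ N hτ hN hCτ ρn mn un pn Rn hs hc hR hρ
  have hMτ0 : 0 ≤ M * τ := by positivity
  have hτ1 : τ ≤ 1 := by linarith
  have H : ∀ n ≤ N, _ := fun n hn =>
    S.error_le hCρ hM hB hτ hN hτ1 (by linarith) hs hc hR hρ hn
  rw [← hX] at H
  have hy : ∀ n, 0 ≤ m / 8 * (τ * ∑ k ∈ Finset.range (n + 1), schemeStrain Ω τ u un k) :=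
    fun n => mul_nonneg (by positivity) (mul_nonneg hτ.le
      (Finset.sum_nonneg fun k _ => integral_nonneg fun y => sq_nonneg _))
  have hl2 : ∀ n ≤ N, l2sq Ω (fun x => u (n * τ) x - un n x)
      ≤ X * (2 / rhoMin Ω (ρ 0)) * τ := by
    intro n hn
    have h1 := H n hn
    have h2 := hy n
    rw [mul_div_assoc', div_mul_eq_mul_div, le_div_iff₀ hρ_pos]
    linarith
  have hstr : 2 * (τ * ∑ k ∈ Finset.range (N + 1), schemeStrain Ω τ u un k)
      ≤ X * (16 / m) * τ := by
    have h1 := H N le_rfl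
    have h2 : 0 ≤ rhoMin Ω (ρ 0) / 2 * l2sq Ω (fun x => u (N * τ) x - un N x) :=
      mul_nonneg (by positivity) (l2sq_nonneg _)
    rw [mul_div_assoc', div_mul_eq_mul_div, le_div_iff₀ hm]
    linarith
  have hsup : (⨆ n : Fin (N + 1), l2sq Ω (fun x => u ((n : ℕ) * τ) x - un n x))
      ≤ X * (2 / rhoMin Ω (ρ 0)) * τ := ciSup_le fun n => hl2 n (Nat.lt_succ_iff.1 n.2)
  have hh1 : ∑ n ∈ Finset.range (N + 1), h1sq Ω (fun x => u (n * τ) x - un n x)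
      ≤ ∑ n ∈ Finset.range (N + 1), (X * (2 / rhoMin Ω (ρ 0)) * τ
        + 2 * schemeStrain Ω τ u un n) := by
    refine Finset.sum_le_sum fun n hn => ?_
    have hn' : n ≤ N := Nat.lt_succ_iff.1 (Finset.mem_range.1 hn)
    have h1 := h1sq_le hΩ_open (hexact.u_dirichlet _ (mem_Icc_of_mul_eq hτ hN hn'))
      (hs.u_mem n hn')
    have h2 := hl2 n hn'
    rw [schemeStrain]
    linarith
  rw [Finset.sum_add_distrib, Finset.sum_const, Finset.card_range, nsmul_eq_mul,
    ← Finset.mul_sum] at hh1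
  have h3 := mul_le_mul_of_nonneg_left hh1 hτ.le
  -- The sum has N + 1 terms, whose total weight is Nτ + τ ≤ T + 1.
  have h4 : τ * (((N + 1 : ℕ) : ℝ) * (X * (2 / rhoMin Ω (ρ 0)) * τ))
      ≤ X * (2 / rhoMin Ω (ρ 0)) * (T + 1) * τ := by
    have e : τ * (((N + 1 : ℕ) : ℝ) * (X * (2 / rhoMin Ω (ρ 0)) * τ))
        = X * (2 / rhoMin Ω (ρ 0)) * (N * τ + τ) * τ := by push_cast; ring
    rw [e, hN]
    gcongr
  have h5 : 0 < τ := hτ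
  linarith
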